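/- **Setting.** A bounded discrete domain $\Omega$ is a finite connected subset of the square lattice, given by vertices $\mathcal V$, unit faces $\mathcal F$, interior edges $\mathcal E_{\rm in}$ and boundary half-edges $\mathcal E_{\rm bd}$, such that all edges and vertices of a face in $\mathcal F$ belong to $\Omega$, every vertex in $\mathcal V$ is incident to four edges or half-edges, every vertex incident to an edge or half-edge of $\Omega$ is in $\mathcal V$, and at least one of the two faces incident to an interior edge is in $\mathcal F$. For an interior edge $e$, $z_e$ is its midpoint; for a boundary half-edge it is the endpoint that is not a vertex of $\Omega$. We identify $e$ with $z_e$. Let $\varpi:\widetilde\Omega\to\Omega$ be a double cover, i.e. a two-to-one local graph isomorphism that can branch only around holes (contours of faces of $\mathcal F$ lift to closed contours); $z^*$ denotes the other point over $\varpi(z)$. Put $x=\sqrt2-1$. A generalized configuration is a set $S$ of edges and half-edges (halves of interior edges are allowed) in which each vertex has degree $0$, $2$ or $4$, and which contains at most one of an interior edge and its two halves; $|S|$ is the number of its elements and $\partial S$ the set of points $z_e$ of the half-edges $e\in S$. $\mathrm{Conf}_{e_1,\dots,e_m}$ is the set of those $S$ with $\partial S=\{z_{e_1},\dots,z_{e_m}\}$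 modulo $2$ (points that occur an even number of times are dropped); for points of $\widetilde\Omega$ the subscripts mean their projections. For a boundary half-edge $a$, oriented outwards and viewed as a complex number, $\eta_a:=(ia/|a|)^{-1/2}$ with a fixed choice of the sign. For a curve $\gamma$, $\mathrm{wind}(\gamma)$ is the increment of the argument of its tangent vector. *One source.* Let $a$ be a boundary half-edge of $\widetilde\Omega$ and $z$ an edge or half-edge of $\widetilde\Omega$. Decompose $S\in\mathrm{Conf}_{a,z}$ into loops and a path $\gamma$ from $\varpi(a)$ to $\varpi(z)$ without transversal intersections or self-intersections. Let $l(S)$ be the number of loops that do not lift to closed loops, and let $s(z,\gamma)=1$ if the lift of $\gamma$ from $a$ ends at $z$ and $s(z,\gamma)=-1$ if it ends at $z^*$. Put $$F_\varpi(a;z):=i\eta_a\sum_{S\in\mathrm{Conf}_{a,z}}e^{-\frac i2\mathrm{wind}(\gamma)}(-1)^{l(S)}s(z,\gamma)\,x^{|S|}.$$ *Several sources.* Let $n\ge0$ and let $a_0,\dots,a_{2n}$ be boundary half-edges of $\widetilde\Omega$ with distinct projections; put $A=\{a_1,\dots,a_{2n}\}$ and $\eta_k=\eta_{a_k}$. Let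 $\nu_1,\dots,\nu_n$ be artificial arcs, $\nu_s$ running from $\varpi(a_{2s-1})$ to $\varpi(a_{2s})$. They matter only through the winding of $\nu_s$, taken from the outward direction at $a_{2s-1}$ to the inward direction at $a_{2s}$ (hence determined modulo $2\pi$), and through the way $\nu_s$ lifts, i.e. a bijection between the two lifts of $\varpi(a_{2s-1})$ and those of $\varpi(a_{2s})$; these data can be prescribed arbitrarily. For $S\in\mathrm{Conf}_{a_0,\dots,a_{2n},z}$, decomposed at its vertices as above, adding the arcs yields loops and a single curve $\gamma$ from $\varpi(a_0)$ to $\varpi(z)$. Let $I(S)$ be the number of the loops that have zero winding modulo $4\pi$, define $l(S)$ and $s(z,\gamma)$ as before, and put $$F_\varpi(a_0,A;z):=i\eta_0\sum_{S\in\mathrm{Conf}_{a_0,\dots,a_{2n},z}}e^{-\frac i2\mathrm{wind}(\gamma)}(-1)^{l(S)+I(S)}s(z,\gamma)\,x^{|S|}.$$ **Proposition.** For every choice of the decompositions of configurations, the following holds. All $F_\varpi(a_k;a_k)$ are non-zero, and there is a real antisymmetric $(2n+1)\times(2n+1)$ matrix $G_\varpi$ with entries $$(G_\varpi)_{j,k}=\frac{F_\varpi(a_j;a_k)}{iF_\varpi(a_k;a_k)},\qquad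 j\ne k .$$ Let $G_\varpi[k]$ be $G_\varpi$ with the row and column of index $k$ removed. There is a sign $\varepsilon\in\{1,-1\}$, depending only on the choices made for the $\eta_k$, the sheets of the $a_k$ and the arcs $\nu_s$, such that for all edges and half-edges $z$ of $\widetilde\Omega$ (the marked ones included) $$F_\varpi(a_0,A;z)=\varepsilon\sum_{k=0}^{2n}(-1)^k\,\mathrm{Pf}\,G_\varpi[k]\cdot F_\varpi(a_k;z).$$ More precisely, $\varepsilon=(-1)^{p+q}$, where $p$ is the number of $s$ for which $\nu_s$ does not lift to a path from $a_{2s-1}$ to $a_{2s}$ and $q$ is the number of $s$ for which $e^{-\frac i2\mathrm{wind}(\nu_s)}=\eta_{2s}/(i\eta_{2s-1})$ fails. In particular, $\varepsilon=1$ if every $\nu_s$ lifts to a path from $a_{2s-1}$ to $a_{2s}$ and $e^{-\frac i2\mathrm{wind}(\nu_s)}=\eta_{2s}/(i\eta_{2s-1})$ for all $s$. -/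

import Mathlib

open scoped BigOperators

noncomputable section

namespace Ising

/-- The four lattice directions: `0, 1, 2, 3` are east, north, west, south. -/
abbrev Dir : Type := ZMod 4

/-- The unit vector in direction `d` (lengths are measured in units of the mesh). -/
def shift (d : Dir) : ℤ × ℤ :=
  if d = 0 then (1, 0) else if d = 1 then (0, 1) else if d = 2 then (-1, 0) else (0, -1)

/-- The half-edge `(v, d)` goes from the vertex `v` half a step in direction `d`. -/
abbrev HalfEdge : Type := (ℤ × ℤ) × Dir

/-- The other half of the lattice edge that contains the half-edge `h`. -/
def opp (h : HalfEdge) : HalfEdge := (h.1 + shift h.2, h.2 + 2)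

/-- The unit face that has a corner at `v` between the directions `d` and `d + 1`; faces are named
by their lower left corners. -/
def cornerFace (v : ℤ × ℤ) (d : Dir) : ℤ × ℤ :=
  if d = 0 then v else if d = 1 then v - (1, 0) else if d = 2 then v - (1, 1) else v - (0, 1)

/-- A bounded discrete domain: vertices `V`, faces `F`, and interior edges, given by the set `E` of
their halves. Every vertex of `V` has four incident edges or half-edges, so the boundary half-edges
are exactly the half-edges at vertices of `V` that are not in `E`. -/
structure DiscreteDomain where
  V : Finset (ℤ × ℤ)
  F : Finset (ℤ × ℤ)
  E : Finset HalfEdge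
  opp_mem : ∀ h ∈ E, opp h ∈ E
  vertex_mem : ∀ h ∈ E, h.1 ∈ V
  /-- All edges (hence all vertices) incident to a face of the domain belong to the domain. -/
  edge_of_face : ∀ v d, cornerFace v d ∈ F → (v, d) ∈ E ∧ (v, d + 1) ∈ E
  /-- One of the two faces (left or right) incident to an interior edge belongs to the domain. -/
  face_of_edge : ∀ v d, (v, d) ∈ E → cornerFace v d ∈ F ∨ cornerFace v (d - 1) ∈ F
  connected : ∀ u ∈ V, ∀ v ∈ V,
    Relation.ReflTransGen (fun p q => ∃ d, (p, d) ∈ E ∧ q = p + shift d) u v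

namespace DiscreteDomain

variable (Ω : DiscreteDomain)

/-- All half-edges of the domain: halves of interior edges and boundary half-edges. -/
def halfEdges : Finset HalfEdge := Ω.V ×ˢ Finset.univ

/-- The boundary half-edges. -/
def boundary : Finset HalfEdge := Ω.halfEdges \ Ω.E

/-- `z_g = z_h`: the midpoint of an interior edge is shared by its two halves, while the endpoint
of a boundary half-edge belongs to this half-edge only. -/
def SamePoint (g h : HalfEdge) : Prop := g = h ∨ (h ∈ Ω.E ∧ g = opp h)

/-- The half-edges in the boundary `∂S` of a set `S`. A set of edges and half-edges, containing at
most one of an edge and its two halves, is encoded by the set `S` of all the half-edges that it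
covers: an interior edge belongs to it if both halves are in `S`. -/
def ends (S : Finset HalfEdge) : Finset HalfEdge :=
  S.filter fun h => ¬ (h ∈ Ω.E ∧ opp h ∈ S)

/-- `|S|`, the number of half-edges plus the number of interior edges. -/
def size (S : Finset HalfEdge) : ℕ := (Ω.ends S).card + (S \ Ω.ends S).card / 2

open Classical in
/-- The generalized configurations: each vertex has degree `0`, `2` or `4`. -/
def confGen : Finset (Finset HalfEdge) :=
  Ω.halfEdges.powerset.filter fun S => ∀ v ∈ Ω.V, Even (S.filter fun h => h.1 = v).card

open Classical in
/-- The generalized configurations `S` with `∂S = {z_e : e ∈ es}` modulo `2`. -/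
def conf (es : List HalfEdge) : Finset (Finset HalfEdge) :=
  Ω.confGen.filter fun S => ∀ h ∈ Ω.halfEdges,
    (∃ g ∈ Ω.ends S, Ω.SamePoint g h) ↔ Odd (es.countP fun e => decide (Ω.SamePoint e h))

end DiscreteDomain

/-- A double cover of a discrete domain: a graph with a two-to-one local isomorphism `proj` to
the domain. Here `nbr w d` is the other end of the lift, starting at `w`, of the interior edge
in direction `d` (its value is irrelevant if there is no such edge). The cover branches
around holes only: the contour of each face of the domain lifts to a closed contour. -/
structure DoubleCover (Ω : DiscreteDomain) where
  Vert : Type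
  proj : Vert → ℤ × ℤ
  nbr : Vert → Dir → Vert
  proj_mem : ∀ w, proj w ∈ Ω.V
  two_sheets : ∀ v ∈ Ω.V, {w | proj w = v}.ncard = 2
  proj_nbr : ∀ w d, (proj w, d) ∈ Ω.E → proj (nbr w d) = proj w + shift d
  nbr_nbr : ∀ w d, (proj w, d) ∈ Ω.E → nbr (nbr w d) (d + 2) = w
  face_closed : ∀ w d, cornerFace (proj w) d ∈ Ω.F →
    nbr (nbr (nbr (nbr w d) (d + 1)) (d + 2)) (d + 3) = w

/-- The turn, in units of `π / 2` and counterclockwise, when one enters a vertex along the half-edge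
in direction `d` from it and leaves in direction `d' ≠ d`. -/
def turn (d d' : Dir) : ℤ := if d' = d + 2 then 0 else if d' = d + 3 then 1 else -1

/-- The half-edges in directions `d` and `d'` at `v` are joined in the decomposition of `S`. If `v`
has degree `4` in `S`, there are two ways to join without transversal crossing, and `ρ v` selects
one of them: `0-1, 2-3` or `1-2, 3-0`. -/
def Joined (S : Finset HalfEdge) (ρ : ℤ × ℤ → Bool) (v : ℤ × ℤ) (d d' : Dir) : Prop :=
  d ≠ d' ∧ (v, d) ∈ S ∧ (v, d') ∈ S ∧
    ((∀ c : Dir, (v, c) ∈ S) →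
      if ρ v then d.val / 2 = d'.val / 2 else (d + 1).val / 2 = (d' + 1).val / 2)

namespace DoubleCover

variable {Ω : DiscreteDomain} (C : DoubleCover Ω)

/-- Half-edges of the double cover. A half-edge also names the corresponding point of the cover:
the midpoint of the interior edge that contains it or the endpoint of the boundary half-edge. -/
abbrev HEdge : Type := C.Vert × Dir

/-- The half-edge of the domain below a half-edge of the cover. -/
def down (x : C.HEdge) : HalfEdge := (C.proj x.1, x.2)

/-- Two half-edges of the cover name the same point of the cover. -/
def SamePoint (x z : C.HEdge) : Prop :=
  x = z ∨ (C.down z ∈ Ω.E ∧ x = (C.nbr z.1 z.2, z.2 + 2))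

/-- `C.Trail S ρ J x L m y`: following the decomposition of `S` (joined at vertices according to
`ρ`) together with artificial arcs, one gets from the point `x` of the cover to the point `y`; `L`
lists the half-edges of `S` passed and `m` is the winding in units of `π / 2`. A trail enters
a vertex along the half-edge `x`, leaves it along a joined half-edge, and then continues through the
other half of the interior edge or along an artificial arc; `J y k y'` says that an artificial
arc of winding `k`, lifted to the cover, leads from `y` to `y'`. -/
inductive Trail (S : Finset HalfEdge) (ρ : ℤ × ℤ → Bool) (J : C.HEdge → ℤ → C.HEdge → Prop) :
    C.HEdge → List HalfEdge → ℤ → C.HEdge → Prop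
  | nil (x : C.HEdge) : Trail S ρ J x [] 0 x
  | last {w : C.Vert} {d d' : Dir} (hj : Joined S ρ (C.proj w) d d') :
      Trail S ρ J (w, d) [(C.proj w, d), (C.proj w, d')] (turn d d') (w, d')
  | edge {w : C.Vert} {d d' : Dir} {y : C.HEdge} {L : List HalfEdge} {m : ℤ}
      (hj : Joined S ρ (C.proj w) d d') (he : (C.proj w, d') ∈ Ω.E)
      (ht : Trail S ρ J (C.nbr w d', d' + 2) L m y) :
      Trail S ρ J (w, d) ((C.proj w, d) :: (C.proj w, d') :: L) (turn d d' + m) y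
  | arc {w : C.Vert} {d d' : Dir} {k : ℤ} {x y : C.HEdge} {L : List HalfEdge} {m : ℤ}
      (hj : Joined S ρ (C.proj w) d d') (ha : J (w, d') k x)
      (ht : Trail S ρ J x L m y) :
      Trail S ρ J (w, d) ((C.proj w, d) :: (C.proj w, d') :: L) (turn d d' + k + m) y

section

variable (S : Finset HalfEdge) (ρ : ℤ × ℤ → Bool) (J : C.HEdge → ℤ → C.HEdge → Prop)

/-- `K` is the set of half-edges of a loop in the decomposition of `S` together with the arcs; going
once around it one has winding `m`, and a lift of the loop leads from `x` to `y`. -/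
def IsLoop (K : Finset HalfEdge) (m : ℤ) (x y : C.HEdge) : Prop :=
  ∃ L : List HalfEdge, C.Trail S ρ J x L m y ∧ L ≠ [] ∧ L.Nodup ∧ C.down x = C.down y ∧
    L.toFinset = K

/-- `l(S)`: the number of loops that do not lift to closed loops. -/
def numNontrivial : ℕ := {K | ∃ m x y, C.IsLoop S ρ J K m x y ∧ x ≠ y}.ncard

/-- `I(S)`: the number of loops that have winding zero modulo `4π`. -/
def numZeroWinding : ℕ := {K | ∃ m x y, C.IsLoop S ρ J K m x y ∧ (8 : ℤ) ∣ m}.ncard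

open Classical in
/-- `W = exp(-i wind(γ) / 2) (-1)^{l(S)} s(z, γ)`, where `γ` is the path from `a` to `z` in the
decomposition of `S` together with the arcs, and `s(z, γ) = 1` if the lift of `γ` from `a` ends at
`z` and `-1` if it ends on the other sheet. -/
def IsPhase (a z : C.HEdge) (W : ℂ) : Prop :=
  ∃ L m y, C.Trail S ρ J a L m y ∧ Ω.SamePoint (C.down y) (C.down z) ∧
    W = Complex.exp (-(Complex.I / 2) * ((m : ℂ) * (Real.pi / 2))) *
      (-1) ^ C.numNontrivial S ρ J * (if C.SamePoint y z then 1 else -1)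

open Classical in
/-- The complex phase of `S` without the factor `(-1)^{I(S)}`. -/
def phase (a z : C.HEdge) : ℂ :=
  if h : ∃ W, C.IsPhase S ρ J a z W then h.choose else 0

end

/-- The critical weight. -/
def xCrit : ℝ := √2 - 1

/-- The one-source spinor observable `F(a; z)`, for the square root `η = η_a`; `ρ` selects the
decompositions of configurations into loops and a path. -/
def observable (ρ : Finset HalfEdge → ℤ × ℤ → Bool) (η : ℂ) (a z : C.HEdge) : ℂ :=
  Complex.I * η * ∑ S ∈ Ω.conf [C.down a, C.down z],
    C.phase S (ρ S) (fun _ _ _ => False) a z * (xCrit : ℂ) ^ Ω.size S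

/-- The source `a_{2s+1}` of the `s`-th arc (`s = 0, …, n - 1`). -/
def arcSrc {n : ℕ} (s : Fin n) : Fin (2 * n + 1) := ⟨2 * s + 1, by omega⟩

/-- The target `a_{2s+2}` of the `s`-th arc. -/
def arcTgt {n : ℕ} (s : Fin n) : Fin (2 * n + 1) := ⟨2 * s + 2, by omega⟩

/-- Artificial arcs from `a_{2s+1}` to `a_{2s+2}`. An arc enters only through its winding
(`wind s`, in units of `π / 2`) and the way it lifts to the cover. It leaves the domain in the
direction of `a_{2s+1}` and comes back in the direction opposite to `a_{2s+2}`, which fixes its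
winding modulo `2π`; its lift matches the two lifts of `a_{2s+1}` with those of `a_{2s+2}`. -/
structure Arcs {n : ℕ} (a : Fin (2 * n + 1) → C.HEdge) where
  wind : Fin n → ℤ
  wind_mod : ∀ s, (wind s : Dir) = (a (arcTgt s)).2 + 2 - (a (arcSrc s)).2
  lift : ∀ s, {w // C.proj w = C.proj (a (arcSrc s)).1} ≃
    {w // C.proj w = C.proj (a (arcTgt s)).1}

variable {C} {n : ℕ} {a : Fin (2 * n + 1) → C.HEdge}

/-- A lifted arc, run in one of its two directions, leads from `x` to `y` with winding `k`. -/
def Arcs.Jump (ν : C.Arcs a) (x : C.HEdge) (k : ℤ) (y : C.HEdge) : Prop :=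
  ∃ s u, (x = (u.1, (a (arcSrc s)).2) ∧ y = ((ν.lift s u).1, (a (arcTgt s)).2) ∧ k = ν.wind s) ∨
    (x = ((ν.lift s u).1, (a (arcTgt s)).2) ∧ y = (u.1, (a (arcSrc s)).2) ∧ k = -ν.wind s)

/-- The multi-source observable `F(a_0, a_1, …, a_{2n}; z)`. -/
def Arcs.observable (ν : C.Arcs a) (ρ : Finset HalfEdge → ℤ × ℤ → Bool) (η : ℂ) (z : C.HEdge) : ℂ :=
  Complex.I * η * ∑ S ∈ Ω.conf (List.ofFn (fun k => C.down (a k)) ++ [C.down z]),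
    C.phase S (ρ S) ν.Jump (a 0) z * (-1) ^ C.numZeroWinding S (ρ S) ν.Jump *
      (xCrit : ℂ) ^ Ω.size S

/-- The `s`-th arc lifts to a path from `a_{2s+1}` to `a_{2s+2}`. -/
def Arcs.LiftsToMarked (ν : C.Arcs a) (s : Fin n) : Prop :=
  (ν.lift s ⟨(a (arcSrc s)).1, rfl⟩ : C.Vert) = (a (arcTgt s)).1

/-- `exp(-i wind(ν_s) / 2) = η_{2s+2} / (i η_{2s+1})`. -/
def Arcs.Compatible (ν : C.Arcs a) (η : Fin (2 * n + 1) → ℂ) (s : Fin n) : Prop :=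
  Complex.exp (-(Complex.I / 2) * ((ν.wind s : ℂ) * (Real.pi / 2))) =
    η (arcTgt s) / (Complex.I * η (arcSrc s))

open Classical in
/-- The sign determined by the arcs and by the choices of the square roots: each of the two
conventions contributes `-1` for every arc that violates it. -/
def Arcs.sign (ν : C.Arcs a) (η : Fin (2 * n + 1) → ℂ) : ℤ :=
  ∏ s, (if ν.LiftsToMarked s then 1 else -1) * (if ν.Compatible η s then 1 else -1)

/-- The real matrix with off-diagonal entries `F(a_j; a_k) / (i F(a_k; a_k))`. -/
def gMatrix (a : Fin (2 * n + 1) → C.HEdge) (ρ : Finset HalfEdge → ℤ × ℤ → Bool)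
    (η : Fin (2 * n + 1) → ℂ) : Matrix (Fin (2 * n + 1)) (Fin (2 * n + 1)) ℝ :=
  Matrix.of fun j k => if j = k then 0 else
    (C.observable ρ (η j) (a j) (a k) / (Complex.I * C.observable ρ (η k) (a k) (a k))).re

end DoubleCover

/-- The Pfaffian of a `2m × 2m` matrix. -/
def pfaffian {m : ℕ} (A : Matrix (Fin (2 * m)) (Fin (2 * m)) ℝ) : ℝ :=
  (2 ^ m * (m.factorial : ℝ))⁻¹ * ∑ σ : Equiv.Perm (Fin (2 * m)),
    ((Equiv.Perm.sign σ : ℤ) : ℝ) *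
      ∏ i : Fin m, A (σ ⟨2 * i, by omega⟩) (σ ⟨2 * i + 1, by omega⟩)

end Ising

end

/-! Every observable is a signed partition function of free-fermion type, in which windings and
sheets enter only through the sign of a permutation. Half-edges are ordered lexicographically by
vertex and, within a vertex, cyclically from west. A configuration with ends `t` is given the sign
`listSign` of the list made of `t` and the pairs (half, opposite half) of its edges, times a weight
±x for each edge, the sign recording a change of sheet; `partition` is the sum. Two independent
arguments meet here.

Analytic half. Inserting or deleting one half-edge at a vertex, together with the alternating
identity `dirOrient_relation`, gives linear relations for the partition function as a function of
one movable source (`partition_cons_relation`, `arrival_interior`, `arrival_source`). At the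
critical weight their solution is unique (`eq_zero_of_relation`): the form in `dirOrient_form` is a
sum of squares, while its total over the domain is at most zero, so all the squares vanish and zeros
propagate through the domain. Uniqueness gives the expansion `partition_cons_expansion` with respect
to one source, and `pfaffian_of_expansion` turns expansions into Pfaffians. The normalizing constant
is positive, because even subgraphs of the lattice have sign one (`listSign_even_subgraph`) and the
sum over them is a high-temperature expansion.

Geometric half. A configuration carries two perfect matchings of its half-edges: the non-crossing
joining at vertices, and the matching by edges, arcs and one chord that closes the path. Their
superposition consists of the loops and the closed path. The sign of the second matching is a
product over these loops (`prod_matchSign_loops`), each contributing minus a product of comparisons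
of joined half-edges and of edge signs (`matchSign_loopSet`). By `windPhase_turn`, exp(-i wind/2) of
a turn is i times such a comparison, up to a factor that telescopes. So a loop contributes -exp(-i
wind/2), which is -1 exactly when the winding vanishes modulo 4π; this explains I(S), and changes of
sheet explain l(S) (`Closing.loop_sign`). The path is treated in the same way
(`PathClosing.path_sign`). Hence the complex phase of a configuration is, up to explicit factors,
the sign of its list of ends and edges, for every choice of the decomposition (`phase_generic`,
`phase_marked`).

The observables with one source and with several are therefore `endSum`s of the same partition
functions. With one source no loop has zero winding (`numZeroWinding_noArcs`), so the absence of
(-1)^I there is consistent. Expanding `endSum` in its sources gives the Pfaffian formula, and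
`Arcs.sign_mul_prod` collects the signs of roots, sheets and arcs into ε. -/

noncomputable section

namespace Ising

/-! ### An order on half-edges and the sign of a list of half-edges -/

/-- The place of a direction in the cyclic order that starts at west. -/
def rank (d : Dir) : ℕ := (d + 2).val

/-- Half-edges are ordered by their vertices and then by the rank of their directions. -/
def key (h : HalfEdge) : ℤ ×ₗ (ℤ ×ₗ ℕ) := toLex (h.1.1, toLex (h.1.2, rank h.2))

lemma rank_injective : Function.Injective rank := by decide

lemma key_lt_iff (g h : HalfEdge) : key g < key h ↔
    g.1.1 < h.1.1 ∨ g.1.1 = h.1.1 ∧ (g.1.2 < h.1.2 ∨ g.1.2 = h.1.2 ∧ rank g.2 < rank h.2) := by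
  simp [key, Prod.Lex.toLex_lt_toLex]

lemma key_injective : Function.Injective key := by
  rintro ⟨⟨x, y⟩, d⟩ ⟨⟨x', y'⟩, d'⟩ h
  simp only [key, EmbeddingLike.apply_eq_iff_eq, Prod.mk.injEq] at h
  obtain ⟨rfl, rfl, h⟩ := h
  rw [rank_injective h]

/-- The sign of the comparison of two half-edges. -/
def orient (g h : HalfEdge) : ℝ := if key g < key h then 1 else if key h < key g then -1 else 0

lemma orient_self (g : HalfEdge) : orient g g = 0 := by simp [orient]

lemma orient_of_lt {g h : HalfEdge} (hl : key g < key h) : orient g h = 1 := by simp [orient, hl]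

lemma orient_of_gt {g h : HalfEdge} (hl : key h < key g) : orient g h = -1 := by
  simp [orient, hl, hl.not_gt]

lemma orient_swap (g h : HalfEdge) : orient g h = -orient h g := by
  rcases lt_trichotomy (key g) (key h) with hl | hl | hl
  · rw [orient_of_lt hl, orient_of_gt hl]; ring
  · rw [key_injective hl, orient_self]; ring
  · rw [orient_of_lt hl, orient_of_gt hl]

lemma orient_mul_self {g h : HalfEdge} (hne : g ≠ h) : orient g h * orient g h = 1 := by
  rcases lt_trichotomy (key g) (key h) with hl | hl | hl
  · simp [orient_of_lt hl]
  · exact absurd (key_injective hl) hne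
  · simp [orient_of_gt hl]

/-- The comparison of two directions by rank. -/
def dirOrient (d c : Dir) : ℤ := if rank d < rank c then 1 else if rank c < rank d then -1 else 0

lemma orient_same_vertex (v : ℤ × ℤ) (d c : Dir) : orient (v, d) (v, c) = dirOrient d c := by
  unfold orient dirOrient
  simp only [key_lt_iff, lt_irrefl, false_or, true_and]
  split_ifs <;> simp

/-- The vertex dominates the lexicographic order, so half-edges at one vertex form an interval. This
makes signs factor into local and distant parts. -/
lemma orient_vertex_indep {v : ℤ × ℤ} {b : HalfEdge} (hb : b.1 ≠ v) (d c : Dir) :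
    orient (v, d) b = orient (v, c) b := by
  have h : ∀ d : Dir, (key (v, d) < key b ↔ v.1 < b.1.1 ∨ v.1 = b.1.1 ∧ v.2 < b.1.2) ∧
      (key b < key (v, d) ↔ b.1.1 < v.1 ∨ b.1.1 = v.1 ∧ b.1.2 < v.2) := by
    intro d
    have : ¬ (b.1.1 = v.1 ∧ b.1.2 = v.2) := fun h => hb (Prod.ext h.1 h.2)
    constructor
    · rw [key_lt_iff]
      dsimp only
      constructor
      · rintro (h | ⟨h, h' | ⟨h', -⟩⟩)
        · exact .inl h
        · exact .inr ⟨h, h'⟩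
        · exact absurd ⟨h.symm, h'.symm⟩ this
      · rintro (h | ⟨h, h'⟩)
        · exact .inl h
        · exact .inr ⟨h, .inl h'⟩
    · rw [key_lt_iff]
      dsimp only
      constructor
      · rintro (h | ⟨h, h' | ⟨h', -⟩⟩)
        · exact .inl h
        · exact .inr ⟨h, h'⟩
        · exact absurd ⟨h, h'⟩ this
      · rintro (h | ⟨h, h'⟩)
        · exact .inl h
        · exact .inr ⟨h, .inl h'⟩
  unfold orient
  simp only [h]

/-- The product of all comparisons between two lists. -/
def crossSign (A B : List HalfEdge) : ℝ := (A.map fun a => (B.map (orient a)).prod).prod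

/-- The parity of the number of inversions of a list, as a sign; it is zero if the list has
repetitions. -/
def listSign : List HalfEdge → ℝ
  | [] => 1
  | a :: L => (L.map (orient a)).prod * listSign L

lemma listSign_append (A B : List HalfEdge) :
    listSign (A ++ B) = listSign A * listSign B * crossSign A B := by
  induction A with
  | nil => simp [listSign, crossSign]
  | cons a A ih =>
    simp only [List.cons_append, listSign, List.map_append, List.prod_append, ih, crossSign,
      List.map_cons, List.prod_cons]
    ring

lemma crossSign_perm {A A' B B' : List HalfEdge} (hA : A.Perm A') (hB : B.Perm B') :
    crossSign A B = crossSign A' B' := by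
  have : ∀ a, (B.map (orient a)).prod = (B'.map (orient a)).prod := fun a =>
    (hB.map _).prod_eq
  simp only [crossSign, this]
  exact (hA.map _).prod_eq

lemma listSign_move_cons (h : HalfEdge) (M B : List HalfEdge) :
    listSign (h :: (M ++ B)) = (-1) ^ M.length * listSign (M ++ h :: B) := by
  induction M with
  | nil => simp
  | cons m M ih =>
    have e : listSign (h :: (m :: M ++ B)) = -listSign (m :: h :: (M ++ B)) := by
      simp only [List.cons_append, listSign, List.map_cons, List.prod_cons, orient_swap h m]
      ring
    rw [e, listSign, List.map_cons, List.prod_cons, ih, List.cons_append, listSign,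
      List.map_append, List.map_append, List.map_cons, List.prod_append, List.prod_append,
      List.prod_cons, List.length_cons, pow_succ]
    ring

lemma listSign_move (A : List HalfEdge) (h : HalfEdge) (M B : List HalfEdge) :
    listSign (A ++ h :: (M ++ B)) = (-1) ^ M.length * listSign (A ++ (M ++ h :: B)) := by
  rw [listSign_append, listSign_append, listSign_move_cons,
    crossSign_perm (List.Perm.refl A) (List.perm_middle (a := h) (l₁ := M) (l₂ := B)).symm]
  ring

lemma listSign_swap (A : List HalfEdge) (g h : HalfEdge) (B : List HalfEdge) :
    listSign (A ++ g :: h :: B) = -listSign (A ++ h :: g :: B) := by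
  simpa using listSign_move A g [h] B

/-- A pair of neighbours can be moved through a list without a change of sign. -/
lemma listSign_move_pair (A : List HalfEdge) (g h : HalfEdge) (M B : List HalfEdge) :
    listSign (A ++ g :: h :: (M ++ B)) = listSign (A ++ (M ++ g :: h :: B)) := by
  have h1 := listSign_move (A ++ [g]) h M B
  have h2 := listSign_move A g M (h :: B)
  simp only [List.append_assoc, List.cons_append, List.nil_append] at h1 h2
  rw [h1, h2, ← mul_assoc, ← mul_pow]
  norm_num

lemma listSign_ofFn {m : ℕ} (t : Fin m → HalfEdge) :
    listSign (List.ofFn t) = ∏ i, ∏ j ∈ Finset.Ioi i, orient (t i) (t j) := by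
  induction m with
  | zero => simp [listSign]
  | succ m ih =>
    rw [List.ofFn_succ, listSign, ih, Fin.prod_univ_succ]
    congr 1
    · rw [List.map_ofFn, List.prod_ofFn, Fin.Ioi_zero_eq_map, Finset.prod_map]
      rfl
    · refine Finset.prod_congr rfl fun i _ => ?_
      rw [Fin.Ioi_succ, Finset.prod_map]
      rfl

lemma listSign_ofFn_comp {m : ℕ} (t : Fin m → HalfEdge) (σ : Equiv.Perm (Fin m))
    (R : List HalfEdge) : listSign (List.ofFn (t ∘ σ) ++ R) =
      ((Equiv.Perm.sign σ : ℤ) : ℝ) * listSign (List.ofFn t ++ R) := by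
  have hp : (List.ofFn (t ∘ σ)).Perm (List.ofFn t) := by
    rw [List.ofFn_eq_map, List.ofFn_eq_map, ← List.map_map]
    refine List.Perm.map _ ?_
    refine (List.perm_ext_iff_of_nodup ((List.nodup_finRange m).map σ.injective)
      (List.nodup_finRange m)).2 fun i => ?_
    simp only [List.mem_map, List.mem_finRange, true_and, iff_true]
    exact ⟨σ.symm i, by simp⟩
  rw [listSign_append, listSign_append, crossSign_perm hp (List.Perm.refl R), listSign_ofFn,
    listSign_ofFn]
  have := σ.prod_Ioi_comp_eq_sign_mul_prod (f := fun i j => orient (t i) (t j))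
    (fun i j => orient_swap _ _)
  simp only [Function.comp_apply]
  rw [this]
  ring

/-- Moving the `l`-th entry to the front is the inverse of `Fin.cycleRange`, a cycle of sign `(-1) ^
l`. -/
lemma listSign_ofFn_succAbove {m : ℕ} (t : Fin (m + 1) → HalfEdge) (l : Fin (m + 1))
    (R : List HalfEdge) : listSign (List.ofFn t ++ R) =
      (-1) ^ (l : ℕ) * listSign (t l :: (List.ofFn (t ∘ l.succAbove) ++ R)) := by
  have h := listSign_ofFn_comp t l.cycleRange.symm R
  rw [Equiv.Perm.sign_symm, Fin.sign_cycleRange] at h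
  have e : List.ofFn (t ∘ l.cycleRange.symm) = t l :: List.ofFn (t ∘ l.succAbove) := by
    rw [List.ofFn_succ]
    simp [Fin.cycleRange_symm_zero, Fin.cycleRange_symm_succ, Function.comp_def]
  rw [e, List.cons_append] at h
  rw [h, ← mul_assoc]
  push_cast
  rw [← mul_pow]
  norm_num

end Ising
end

/-! ### Analytic half: fermionic partition functions, uniqueness at criticality, Pfaffians,
positivity. -/

noncomputable section

namespace Ising

/-! ### Pairs of half-edges -/

/-- The east and north directions represent interior edges. -/
abbrev Primary (h : HalfEdge) : Prop := h.2 = 0 ∨ h.2 = 1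

lemma opp_opp (h : HalfEdge) : opp (opp h) = h := by
  obtain ⟨⟨x, y⟩, d⟩ := h
  have : shift d + shift (d + 2) = 0 := by revert d; decide
  have h4 : d + 2 + 2 = d := by revert d; decide
  simp only [opp, h4, add_assoc, this, add_zero]

lemma primary_opp (h : HalfEdge) : Primary (opp h) ↔ ¬ Primary h := by
  obtain ⟨v, d⟩ := h
  simp only [Primary, opp]
  revert d; decide

lemma opp_ne_self (h : HalfEdge) : opp h ≠ h := fun e => by
  have := primary_opp h
  rw [e] at this
  tauto

lemma opp_injective : Function.Injective opp := fun g h e => by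
  rw [← opp_opp g, e, opp_opp]

/-- The list of the entries of a list of pairs. -/
def flatPairs (P : List (HalfEdge × HalfEdge)) : List HalfEdge := P.flatMap fun p => [p.1, p.2]

lemma flatPairs_cons (p : HalfEdge × HalfEdge) (P : List (HalfEdge × HalfEdge)) :
    flatPairs (p :: P) = p.1 :: p.2 :: flatPairs P := rfl

lemma flatPairs_append (P Q : List (HalfEdge × HalfEdge)) :
    flatPairs (P ++ Q) = flatPairs P ++ flatPairs Q := by
  simp [flatPairs]

lemma flatPairs_perm {P Q : List (HalfEdge × HalfEdge)} (h : P.Perm Q) :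
    (flatPairs P).Perm (flatPairs Q) := h.flatMap_right _

/-- Pairs have even length and commute, so the arbitrary order chosen by `Finset.toList` for the
edges is harmless. -/
lemma listSign_flatPairs_perm {P Q : List (HalfEdge × HalfEdge)} (h : P.Perm Q) :
    listSign (flatPairs P) = listSign (flatPairs Q) := by
  induction h with
  | nil => rfl
  | @cons p l₁ l₂ h ih =>
    rw [flatPairs_cons, flatPairs_cons]
    have := crossSign_perm (List.Perm.refl [p.1, p.2]) (flatPairs_perm h)
    have e : ∀ L : List HalfEdge, listSign (p.1 :: p.2 :: L) =
        listSign [p.1, p.2] * listSign L * crossSign [p.1, p.2] L :=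
      fun L => listSign_append [p.1, p.2] L
    rw [e (flatPairs l₁), e (flatPairs l₂), ih, this]
  | swap p q P => exact listSign_move_pair [] q.1 q.2 [p.1, p.2] (flatPairs P)
  | trans _ _ h1 h2 => exact h1.trans h2

lemma listSign_append_flatPairs_perm (A : List HalfEdge) {P Q : List (HalfEdge × HalfEdge)}
    (h : P.Perm Q) : listSign (A ++ flatPairs P) = listSign (A ++ flatPairs Q) := by
  rw [listSign_append, listSign_append, listSign_flatPairs_perm h,
    crossSign_perm (List.Perm.refl A) (flatPairs_perm h)]

lemma listSign_flatPairs_cons (A : List HalfEdge) (p : HalfEdge × HalfEdge)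
    (P : List (HalfEdge × HalfEdge)) :
    listSign (A ++ flatPairs (p :: P)) = listSign (p.1 :: p.2 :: (A ++ flatPairs P)) :=
  (listSign_move_pair [] p.1 p.2 A (flatPairs P)).symm

namespace DiscreteDomain

variable (Ω : DiscreteDomain)

/-! ### Partition functions with sources -/

/-- The interior edges contained in `S`, each given by its primary half. -/
def edgeSet (S : Finset HalfEdge) : Finset HalfEdge :=
  S.filter fun h => Primary h ∧ h ∈ Ω.E ∧ opp h ∈ S

/-- The interior edges contained in `S` as a list of pairs of halves. -/
def edgePairs (S : Finset HalfEdge) : List (HalfEdge × HalfEdge) :=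
  (Ω.edgeSet S).toList.map fun h => (h, opp h)

/-- The halves of the interior edges contained in `S`. -/
def edgeFlat (S : Finset HalfEdge) : List HalfEdge := flatPairs (Ω.edgePairs S)

/-- The product of edge weights. -/
def weight (c : HalfEdge → ℝ) (S : Finset HalfEdge) : ℝ := ∏ h ∈ Ω.edgeSet S, c h

open Classical in
/-- The signed partition function of the configurations with half-edges at the points of `t`. -/
def partition (c : HalfEdge → ℝ) (t : List HalfEdge) : ℝ :=
  ∑ S ∈ Ω.confGen.filter (fun S => Ω.ends S = t.toFinset),
    listSign (t ++ Ω.edgeFlat S) * Ω.weight c S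

variable {Ω}

lemma mem_halfEdges {h : HalfEdge} : h ∈ Ω.halfEdges ↔ h.1 ∈ Ω.V := by
  simp [halfEdges]

lemma mem_boundary {h : HalfEdge} : h ∈ Ω.boundary ↔ h.1 ∈ Ω.V ∧ h ∉ Ω.E := by
  simp [boundary, mem_halfEdges]

lemma opp_mem_iff {h : HalfEdge} : opp h ∈ Ω.E ↔ h ∈ Ω.E :=
  ⟨fun e => opp_opp h ▸ Ω.opp_mem _ e, Ω.opp_mem h⟩

lemma mem_confGen {S : Finset HalfEdge} : S ∈ Ω.confGen ↔ S ⊆ Ω.halfEdges ∧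
    ∀ v ∈ Ω.V, Even (S.filter fun h => h.1 = v).card := by
  simp [confGen]

lemma mem_ends {S : Finset HalfEdge} {h : HalfEdge} :
    h ∈ Ω.ends S ↔ h ∈ S ∧ ¬ (h ∈ Ω.E ∧ opp h ∈ S) := by
  simp [ends]

lemma mem_edgeSet {S : Finset HalfEdge} {h : HalfEdge} :
    h ∈ Ω.edgeSet S ↔ h ∈ S ∧ Primary h ∧ h ∈ Ω.E ∧ opp h ∈ S := by
  simp [edgeSet]

lemma mem_edgeFlat {S : Finset HalfEdge} {h : HalfEdge} :
    h ∈ Ω.edgeFlat S ↔ h ∈ S ∧ h ∈ Ω.E ∧ opp h ∈ S := by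
  simp only [edgeFlat, flatPairs, edgePairs, List.flatMap_map, List.mem_flatMap,
    Finset.mem_toList, mem_edgeSet, List.mem_cons, List.not_mem_nil, or_false]
  constructor
  · rintro ⟨g, ⟨h1, h2, h3, h4⟩, rfl | rfl⟩
    · exact ⟨h1, h3, h4⟩
    · exact ⟨h4, Ω.opp_mem _ h3, by rwa [opp_opp]⟩
  · rintro ⟨h1, h2, h3⟩
    by_cases hp : Primary h
    · exact ⟨h, ⟨h1, hp, h2, h3⟩, .inl rfl⟩
    · exact ⟨opp h, ⟨h3, (primary_opp h).2 hp, Ω.opp_mem _ h2, by rwa [opp_opp]⟩,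
        .inr (opp_opp h).symm⟩

lemma nodup_edgeFlat (S : Finset HalfEdge) : (Ω.edgeFlat S).Nodup := by
  simp only [edgeFlat, flatPairs, edgePairs, List.flatMap_map]
  rw [List.nodup_flatMap]
  refine ⟨fun h _ => by simp [(opp_ne_self h).symm], ?_⟩
  refine (Finset.nodup_toList _).pairwise_of_forall_ne fun g hg h hh hne => ?_
  rw [Finset.mem_toList, mem_edgeSet] at hg hh
  have h1 := primary_opp g
  have h2 := primary_opp h
  simp only [Function.onFun, List.disjoint_cons_left, List.mem_cons, List.not_mem_nil, or_false,
    not_or, List.disjoint_nil_left, and_true]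
  refine ⟨⟨hne, ?_⟩, ?_, fun e => hne (opp_injective e)⟩
  · rintro rfl; tauto
  · rintro rfl; tauto

/-- A half-edge of `S` is either an end or half of a full edge, so the list behind the sign
enumerates `S` once. -/
lemma perm_toList {S : Finset HalfEdge} {t : List HalfEdge} (ht : t.Nodup)
    (hS : Ω.ends S = t.toFinset) : (t ++ Ω.edgeFlat S).Perm S.toList := by
  have hm : ∀ h, h ∈ t ↔ h ∈ S ∧ ¬ (h ∈ Ω.E ∧ opp h ∈ S) := fun h => by
    rw [← mem_ends, hS, List.mem_toFinset]
  refine (List.perm_ext_iff_of_nodup ?_ (Finset.nodup_toList _)).2 fun h => ?_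
  · refine List.Nodup.append ht (nodup_edgeFlat S) fun h h1 h2 => ?_
    rw [hm] at h1
    rw [mem_edgeFlat] at h2
    tauto
  · rw [List.mem_append, hm, mem_edgeFlat, Finset.mem_toList]
    tauto

lemma prod_orient_eq {S : Finset HalfEdge} {t : List HalfEdge} (ht : t.Nodup)
    (hS : Ω.ends S = t.toFinset) (h : HalfEdge) :
    ((t ++ Ω.edgeFlat S).map (orient h)).prod = ∏ b ∈ S, orient h b := by
  rw [((perm_toList ht hS).map _).prod_eq, Finset.prod_map_toList]

/-! ### The local relation at a vertex -/

/-- The product attached to `k` is the parity of the position of `k` in `D`, so the right side is an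
alternating sum whose sign is reversed below `j`. As `D` is odd, the sum leaves a single unit if `j
∉ D` and cancels if `j ∈ D`. -/
lemma dirOrient_relation : ∀ D : Finset Dir, Odd D.card → ∀ j : Dir,
    (if j ∈ D then 0 else ∏ d ∈ D.erase j, dirOrient j d) =
      ∑ k ∈ Finset.univ.erase j,
        if k ∈ D then dirOrient j k * ∏ d ∈ D.erase k, dirOrient k d else 0 := by
  decide

variable (Ω) in
open Classical in
/-- Sets with sources `t` that have odd degree at the vertex `v` only. -/
def oddConf (v : ℤ × ℤ) (t : List HalfEdge) : Finset (Finset HalfEdge) :=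
  Ω.halfEdges.powerset.filter fun S =>
    (∀ u ∈ Ω.V, Even (S.filter fun h => h.1 = u).card ↔ u ≠ v) ∧ Ω.ends S = t.toFinset

lemma mem_oddConf {v : ℤ × ℤ} {t : List HalfEdge} {S : Finset HalfEdge} :
    S ∈ Ω.oddConf v t ↔ S ⊆ Ω.halfEdges ∧
      (∀ u ∈ Ω.V, Even (S.filter fun h => h.1 = u).card ↔ u ≠ v) ∧ Ω.ends S = t.toFinset := by
  simp [oddConf]

/-- The comparisons of `h` with the other elements of `S`. -/
def localSign (h : HalfEdge) (S : Finset HalfEdge) : ℝ := ∏ b ∈ S.erase h, orient h b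

/-- The factor from other vertices is independent of `j` by `orient_vertex_indep`, hence common to
all terms of the relation at `v`. -/
lemma localSign_eq (v : ℤ × ℤ) (j : Dir) (S : Finset HalfEdge) : localSign (v, j) S =
    (∏ b ∈ S.filter (fun b => b.1 ≠ v), orient (v, 0) b) *
      ((∏ d ∈ (Finset.univ.filter fun d => (v, d) ∈ S).erase j, dirOrient j d : ℤ) : ℝ) := by
  have hs : S.erase (v, j) = S.filter (fun b => b.1 ≠ v) ∪
      ((Finset.univ.filter fun d => (v, d) ∈ S).erase j).image (fun d => (v, d)) := by
    ext ⟨u, d⟩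
    simp only [Finset.mem_erase, Finset.mem_union, Finset.mem_filter, Finset.mem_image,
      Finset.mem_univ, true_and, Prod.mk.injEq, ne_eq]
    by_cases hu : u = v
    · subst hu
      simp
    · have : v ≠ u := fun e => hu e.symm
      simp [hu, this]
  rw [localSign, hs, Finset.prod_union, Finset.prod_image]
  · push_cast
    congr 1
    · exact Finset.prod_congr rfl fun b hb =>
        orient_vertex_indep (Finset.mem_filter.1 hb).2 _ _
    · exact Finset.prod_congr rfl fun d _ => orient_same_vertex v j d
  · simp
  · rw [Finset.disjoint_left]
    rintro b hb hb'
    obtain ⟨d, -, rfl⟩ := Finset.mem_image.1 hb'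
    exact (Finset.mem_filter.1 hb).2 rfl

lemma card_filter_vertex (S : Finset HalfEdge) (v : ℤ × ℤ) :
    (S.filter fun h => h.1 = v).card = (Finset.univ.filter fun d : Dir => (v, d) ∈ S).card := by
  symm
  refine Finset.card_bij (fun d _ => (v, d)) ?_ ?_ ?_
  · intro d hd
    simpa using hd
  · intro d _ d' _ h
    exact (Prod.mk.inj h).2
  · rintro ⟨u, d⟩ hb
    obtain ⟨h1, rfl⟩ := Finset.mem_filter.1 hb
    exact ⟨d, by simpa using h1, rfl⟩

lemma localSign_relation {v : ℤ × ℤ} (hv : v ∈ Ω.V) {t : List HalfEdge} {S : Finset HalfEdge}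
    (hS : S ∈ Ω.oddConf v t) (j : Dir) :
    (if (v, j) ∈ S then 0 else localSign (v, j) S) =
      ∑ k ∈ Finset.univ.erase j,
        (dirOrient j k : ℝ) * (if (v, k) ∈ S then localSign (v, k) S else 0) := by
  set D : Finset Dir := Finset.univ.filter fun d => (v, d) ∈ S with hD
  have hmem : ∀ d, (v, d) ∈ S ↔ d ∈ D := fun d => by simp [hD]
  have hodd : Odd D.card := by
    rw [← Nat.not_even_iff_odd, hD, ← card_filter_vertex, (mem_oddConf.1 hS).2.1 v hv]
    simp
  have key := congrArg (Int.cast : ℤ → ℝ) (dirOrient_relation D hodd j)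
  have hl : ∀ k, localSign (v, k) S = (∏ b ∈ S.filter (fun b => b.1 ≠ v), orient (v, 0) b) *
      ((∏ d ∈ D.erase k, dirOrient k d : ℤ) : ℝ) := fun k => localSign_eq v k S
  simp only [hl, hmem]
  push_cast at key ⊢
  calc _ = (∏ b ∈ S.filter (fun b => b.1 ≠ v), orient (v, 0) b) *
        (if j ∈ D then (0 : ℝ) else ∏ d ∈ D.erase j, (dirOrient j d : ℝ)) := by
        split_ifs <;> simp
    _ = _ := by
        rw [key, Finset.mul_sum]
        refine Finset.sum_congr rfl fun k _ => ?_
        split_ifs <;> ring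

variable (Ω) in
/-- The sum over the configurations that arrive at the vertex of `h` along `h`. -/
def arrival (c : HalfEdge → ℝ) (t : List HalfEdge) (h : HalfEdge) : ℝ :=
  ∑ S ∈ Ω.oddConf h.1 t, if h ∈ S then
    localSign h S * (listSign (t ++ Ω.edgeFlat S) * Ω.weight c S) else 0

lemma filter_insert_card (S : Finset HalfEdge) {h : HalfEdge} (hS : h ∉ S) (u : ℤ × ℤ) :
    Even ((insert h S).filter fun g => g.1 = u).card ↔
      (Even (S.filter fun g => g.1 = u).card ↔ u ≠ h.1) := by
  rw [Finset.filter_insert]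
  split_ifs with hu
  · rw [Finset.card_insert_of_notMem (fun e => hS (Finset.mem_of_mem_filter _ e)),
      Nat.even_add_one]
    simp [hu]
  · have : u ≠ h.1 := fun e => hu e.symm
    simp [this]

lemma insert_mem_confGen_iff {S : Finset HalfEdge} {h : HalfEdge} (hh : h.1 ∈ Ω.V) (hS : h ∉ S) :
    insert h S ∈ Ω.confGen ↔ S ⊆ Ω.halfEdges ∧
      ∀ u ∈ Ω.V, Even (S.filter fun g => g.1 = u).card ↔ u ≠ h.1 := by
  rw [mem_confGen, Finset.insert_subset_iff, mem_halfEdges]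
  simp only [hh, true_and, filter_insert_card S hS]

lemma mem_confGen_iff_insert {S : Finset HalfEdge} {h : HalfEdge} (hh : h.1 ∈ Ω.V) (hS : h ∉ S) :
    S ∈ Ω.confGen ↔ insert h S ⊆ Ω.halfEdges ∧
      ∀ u ∈ Ω.V, Even ((insert h S).filter fun g => g.1 = u).card ↔ u ≠ h.1 := by
  rw [mem_confGen, Finset.insert_subset_iff, mem_halfEdges]
  simp only [hh, true_and, filter_insert_card S hS]
  refine and_congr_right fun _ => forall₂_congr fun u _ => ?_
  tauto

lemma ends_insert {S : Finset HalfEdge} {h : HalfEdge} (ho : h ∈ Ω.E → opp h ∉ S) :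
    Ω.ends (insert h S) = insert h (Ω.ends S) := by
  ext g
  simp only [mem_ends, Finset.mem_insert]
  by_cases hg : g = h
  · subst hg
    simp only [true_or, true_and, iff_true, not_and]
    intro hE
    simp only [opp_ne_self, ho hE, or_self, not_false_eq_true]
  · simp only [hg, false_or]
    refine and_congr_right fun hgS => not_congr (and_congr_right fun hgE => ?_)
    refine ⟨?_, .inr⟩
    rintro (e | e)
    · subst e
      rw [opp_mem_iff, opp_opp] at ho
      exact absurd hgS (ho hgE)
    · exact e

lemma edgeSet_insert {S : Finset HalfEdge} {h : HalfEdge} (ho : h ∈ Ω.E → opp h ∉ S) :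
    Ω.edgeSet (insert h S) = Ω.edgeSet S := by
  ext g
  simp only [mem_edgeSet, Finset.mem_insert]
  constructor
  · rintro ⟨rfl | h1, h2, h3, h4 | h4⟩
    · exact absurd h4 (opp_ne_self _)
    · exact absurd h4 (ho h3)
    · rw [← h4, opp_mem_iff, opp_opp] at ho
      exact absurd h1 (ho h3)
    · exact ⟨h1, h2, h3, h4⟩
  · rintro ⟨h1, h2, h3, h4⟩
    exact ⟨.inr h1, h2, h3, .inr h4⟩

/-- Deleting the source `h` leaves a set that is odd at the vertex of `h` only. If `h` is already in
`t`, both sides vanish: the list repeats `h`, and `h` is an end of every set on the right. -/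
lemma partition_cons_eq_sum (c : HalfEdge → ℝ) {t : List HalfEdge} (ht : t.Nodup)
    (htb : ∀ g ∈ t, g ∈ Ω.boundary) {h : HalfEdge} (hh : h.1 ∈ Ω.V) :
    Ω.partition c (h :: t) = ∑ S ∈ Ω.oddConf h.1 t,
      if h ∈ S then 0 else localSign h S * (listSign (t ++ Ω.edgeFlat S) * Ω.weight c S) := by
  classical
  by_cases hht : h ∈ t
  · rw [partition, Finset.sum_eq_zero, Finset.sum_eq_zero]
    · intro S hS
      rw [mem_oddConf] at hS
      have : h ∈ Ω.ends S := by rw [hS.2.2]; simpa using hht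
      simp [(mem_ends.1 this).1]
    · intro S _
      have : (((t ++ Ω.edgeFlat S)).map (orient h)).prod = 0 := by
        refine List.prod_eq_zero ?_
        rw [List.mem_map]
        exact ⟨h, by simp [hht], orient_self h⟩
      rw [List.cons_append, listSign, this]
      ring
  rw [← Finset.sum_filter_add_sum_filter_not _ (fun S => h ∈ S)]
  rw [Finset.sum_eq_zero (s := (Ω.oddConf h.1 t).filter fun S => h ∈ S)
    (fun S hS => by simp [(Finset.mem_filter.1 hS).2]), zero_add, partition]
  have hins : ∀ S, h ∉ S → S ∈ Ω.oddConf h.1 t → h ∈ Ω.E → opp h ∉ S := by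
    intro S hS hSo hE ho
    rw [mem_oddConf] at hSo
    have : opp h ∈ Ω.ends S := mem_ends.2 ⟨ho, by rw [opp_opp]; tauto⟩
    rw [hSo.2.2, List.mem_toFinset] at this
    exact (mem_boundary.1 (htb _ this)).2 (Ω.opp_mem _ hE)
  symm
  refine Finset.sum_nbij' (fun S => insert h S) (fun S => S.erase h) ?_ ?_ ?_ ?_ ?_
  · intro S hS
    obtain ⟨hSo, hS⟩ := Finset.mem_filter.1 hS
    rw [Finset.mem_filter, insert_mem_confGen_iff hh hS, ends_insert (hins S hS hSo)]
    rw [mem_oddConf] at hSo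
    exact ⟨⟨hSo.1, hSo.2.1⟩, by rw [hSo.2.2, List.toFinset_cons]⟩
  · intro S hS
    obtain ⟨hSc, hSe⟩ := Finset.mem_filter.1 hS
    have hhe : h ∈ Ω.ends S := by simp [hSe]
    have hhS := (mem_ends.1 hhe).1
    have hi := Finset.insert_erase hhS
    have ho : h ∈ Ω.E → opp h ∉ S.erase h := fun hE ho =>
      (mem_ends.1 hhe).2 ⟨hE, Finset.mem_of_mem_erase ho⟩
    rw [← hi, insert_mem_confGen_iff hh (Finset.notMem_erase h S)] at hSc
    rw [Finset.mem_filter, mem_oddConf]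
    refine ⟨⟨hSc.1, hSc.2, ?_⟩, Finset.notMem_erase h S⟩
    rw [← hi, ends_insert ho, List.toFinset_cons] at hSe
    have h1 : h ∉ Ω.ends (S.erase h) := fun e => Finset.notMem_erase h S (mem_ends.1 e).1
    have h2 : h ∉ t.toFinset := by simpa using hht
    rw [← Finset.erase_insert h1, hSe, Finset.erase_insert h2]
  · intro S hS
    exact Finset.erase_insert (Finset.mem_filter.1 hS).2
  · intro S hS
    have hhe : h ∈ Ω.ends S := by simp [(Finset.mem_filter.1 hS).2]
    exact Finset.insert_erase (mem_ends.1 hhe).1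
  · intro S hS
    obtain ⟨hSo, hS⟩ := Finset.mem_filter.1 hS
    have he := edgeSet_insert (hins S hS hSo)
    rw [if_neg hS, weight, weight, edgeFlat, edgeFlat, edgePairs, edgePairs, he, List.cons_append,
      listSign, ← mul_assoc]
    have := prod_orient_eq ht (mem_oddConf.1 hSo).2.2 h
    rw [edgeFlat, edgePairs] at this
    rw [this, localSign, Finset.erase_eq_of_notMem hS]

/-- The linear relation between the observables at the half-edges of a vertex. -/
lemma partition_cons_relation (c : HalfEdge → ℝ) {t : List HalfEdge} (ht : t.Nodup)
    (htb : ∀ g ∈ t, g ∈ Ω.boundary) {v : ℤ × ℤ} (hv : v ∈ Ω.V) (j : Dir) :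
    Ω.partition c ((v, j) :: t) =
      ∑ k ∈ Finset.univ.erase j, (dirOrient j k : ℝ) * Ω.arrival c t (v, k) := by
  rw [partition_cons_eq_sum c ht htb hv]
  simp only [arrival, Finset.mul_sum]
  rw [Finset.sum_comm]
  refine Finset.sum_congr rfl fun S hS => ?_
  have := congrArg (· * (listSign (t ++ Ω.edgeFlat S) * Ω.weight c S))
    (localSign_relation hv hS j)
  simp only [ite_mul, zero_mul, Finset.sum_mul] at this
  rw [this]
  refine Finset.sum_congr rfl fun k _ => ?_
  split_ifs <;> ring

/-- The orientation of an interior edge. -/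
def edgeOrient (h : HalfEdge) : ℝ := if Primary h then 1 else -1

lemma edgeOrient_opp (h : HalfEdge) : edgeOrient (opp h) = -edgeOrient h := by
  have := primary_opp h
  unfold edgeOrient
  split_ifs <;> first | tauto | norm_num

lemma edgeOrient_mul_self (h : HalfEdge) : edgeOrient h * edgeOrient h = 1 := by
  unfold edgeOrient; split_ifs <;> norm_num

/-- The completed edge is listed with its primary half first and can be moved to the front as a
pair; the factor `edgeOrient h` accounts for writing `h` first. -/
lemma listSign_edgeFlat_insert {S : Finset HalfEdge} {h : HalfEdge} (hh : h ∈ Ω.E) (hS : h ∉ S)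
    (ho : opp h ∈ S) (c : HalfEdge → ℝ) (hc : ∀ g ∈ Ω.E, c (opp g) = c g) (t : List HalfEdge) :
    listSign (t ++ Ω.edgeFlat (insert h S)) * Ω.weight c (insert h S) =
      edgeOrient h * c h * (listSign (h :: opp h :: (t ++ Ω.edgeFlat S)) * Ω.weight c S) := by
  have key : ∀ e, Primary e → (e = h ∨ e = opp h) →
      listSign (t ++ Ω.edgeFlat (insert h S)) * Ω.weight c (insert h S) =
        c e * (listSign (e :: opp e :: (t ++ Ω.edgeFlat S)) * Ω.weight c S) := by
    intro e hpe he
    have hn : e ∉ Ω.edgeSet S := by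
      rw [mem_edgeSet]
      rintro ⟨h1, -, -, h4⟩
      rcases he with rfl | rfl
      · exact hS h1
      · rw [opp_opp] at h4; exact hS h4
    have hset : Ω.edgeSet (insert h S) = insert e (Ω.edgeSet S) := by
      ext g
      simp only [mem_edgeSet, Finset.mem_insert]
      constructor
      · rintro ⟨h1, h2, h3, h4⟩
        by_cases hge : g = e
        · exact .inl hge
        refine .inr ⟨h1.resolve_left ?_, h2, h3, h4.resolve_left ?_⟩
        · rintro rfl
          rcases he with rfl | rfl
          · exact hge rfl
          · exact (primary_opp _).1 hpe h2
        · intro e4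
          rcases he with rfl | rfl
          · rw [← e4] at hpe; exact (primary_opp _).1 hpe h2
          · apply hge; rw [← e4, opp_opp]
      · rintro (rfl | ⟨h1, h2, h3, h4⟩)
        · rcases he with rfl | rfl
          · exact ⟨.inl rfl, hpe, hh, .inr ho⟩
          · exact ⟨.inr ho, hpe, Ω.opp_mem _ hh, .inl (opp_opp _)⟩
        · exact ⟨.inr h1, h2, h3, .inr h4⟩
    have hp : (Ω.edgePairs (insert h S)).Perm ((e, opp e) :: Ω.edgePairs S) := by
      rw [edgePairs, hset, edgePairs, ← List.map_cons (f := fun h => (h, opp h))]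
      exact (Finset.toList_insert hn).map _
    rw [edgeFlat, listSign_append_flatPairs_perm t hp, listSign_flatPairs_cons, weight, hset,
      Finset.prod_insert hn, edgeFlat, weight]
    ring
  by_cases hp : Primary h
  · rw [key h hp (.inl rfl), edgeOrient, if_pos hp, one_mul]
  · rw [key (opp h) ((primary_opp h).2 hp) (.inr rfl), edgeOrient, if_neg hp, opp_opp, hc h hh]
    have := listSign_swap [] h (opp h) (t ++ Ω.edgeFlat S)
    simp only [List.nil_append] at this
    rw [this]
    ring

lemma ends_insert_of_opp_mem {S : Finset HalfEdge} {h : HalfEdge} (hh : h ∈ Ω.E) (hS : h ∉ S)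
    (ho : opp h ∈ S) : Ω.ends S = insert (opp h) (Ω.ends (insert h S)) ∧
      opp h ∉ Ω.ends (insert h S) := by
  constructor
  · ext g
    simp only [mem_ends, Finset.mem_insert]
    by_cases hg : g = opp h
    · subst hg
      simp [ho, opp_opp, hS]
    · have h1 : opp g ≠ h := fun e => hg (by rw [← e, opp_opp])
      simp only [hg, h1, false_or]
      constructor
      · rintro ⟨h1, h2⟩
        exact ⟨.inr h1, h2⟩
      · rintro ⟨rfl | h1, h2⟩
        · exact absurd ⟨hh, ho⟩ h2
        · exact ⟨h1, h2⟩
  · rw [mem_ends, opp_opp]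
    intro h1
    exact h1.2 ⟨Ω.opp_mem _ hh, by simp⟩

lemma nodup_opp_cons {t : List HalfEdge} (ht : t.Nodup) (htb : ∀ g ∈ t, g ∈ Ω.boundary)
    {h : HalfEdge} (hh : h ∈ Ω.E) : (opp h :: t).Nodup := by
  rw [List.nodup_cons]
  exact ⟨fun e => (mem_boundary.1 (htb _ e)).2 (Ω.opp_mem _ hh), ht⟩

/-- Sources lie on the boundary, so a set that contains the interior half-edge `h` contains its
whole edge; deleting `h` turns `opp h` into a source. The comparisons of `h` with the rest then
occur twice and square to one. -/
lemma arrival_interior (c : HalfEdge → ℝ) (hc : ∀ g ∈ Ω.E, c (opp g) = c g) {t : List HalfEdge}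
    (ht : t.Nodup) (htb : ∀ g ∈ t, g ∈ Ω.boundary) {h : HalfEdge} (hh : h ∈ Ω.E) :
    Ω.arrival c t h = edgeOrient h * c h * Ω.partition c (opp h :: t) := by
  classical
  have hv := Ω.vertex_mem h hh
  rw [arrival, ← Finset.sum_filter, partition, Finset.mul_sum]
  have hends : ∀ S ∈ Ω.oddConf h.1 t, h ∈ S → opp h ∈ S := by
    intro S hS hhS
    by_contra ho
    rw [mem_oddConf] at hS
    have : h ∈ Ω.ends S := mem_ends.2 ⟨hhS, by tauto⟩
    rw [hS.2.2, List.mem_toFinset] at this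
    exact (mem_boundary.1 (htb _ this)).2 hh
  refine Finset.sum_nbij' (fun S => S.erase h) (fun S => insert h S) ?_ ?_ ?_ ?_ ?_
  · intro S hS
    obtain ⟨hSo, hhS⟩ := Finset.mem_filter.1 hS
    have ho : opp h ∈ S.erase h := Finset.mem_erase.2 ⟨opp_ne_self h, hends S hSo hhS⟩
    have hi := Finset.insert_erase hhS
    rw [mem_oddConf] at hSo
    rw [Finset.mem_filter, mem_confGen_iff_insert hv (Finset.notMem_erase h S), hi,
      (ends_insert_of_opp_mem hh (Finset.notMem_erase h S) ho).1, hi, hSo.2.2, List.toFinset_cons]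
    exact ⟨⟨hSo.1, hSo.2.1⟩, rfl⟩
  · intro S hS
    obtain ⟨hSc, hSe⟩ := Finset.mem_filter.1 hS
    have hoe : opp h ∈ Ω.ends S := by simp [hSe]
    have ho := (mem_ends.1 hoe).1
    have hhS : h ∉ S := fun e => (mem_ends.1 hoe).2 ⟨Ω.opp_mem _ hh, by rwa [opp_opp]⟩
    rw [mem_confGen_iff_insert hv hhS] at hSc
    obtain ⟨e1, e2⟩ := ends_insert_of_opp_mem hh hhS ho
    rw [Finset.mem_filter, mem_oddConf]
    refine ⟨⟨hSc.1, hSc.2, ?_⟩, Finset.mem_insert_self _ _⟩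
    have h2 : opp h ∉ t.toFinset := by
      simpa using (List.nodup_cons.1 (nodup_opp_cons ht htb hh)).1
    rw [← Finset.erase_insert e2, ← e1, hSe, List.toFinset_cons, Finset.erase_insert h2]
  · intro S hS
    exact Finset.insert_erase (Finset.mem_filter.1 hS).2
  · intro S hS
    have hoe : opp h ∈ Ω.ends S := by simp [(Finset.mem_filter.1 hS).2]
    exact Finset.erase_insert fun e => (mem_ends.1 hoe).2 ⟨Ω.opp_mem _ hh, by rwa [opp_opp]⟩
  · intro S hS
    obtain ⟨hSo, hhS⟩ := Finset.mem_filter.1 hS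
    have hn := Finset.notMem_erase h S
    have ho : opp h ∈ S.erase h := Finset.mem_erase.2 ⟨opp_ne_self h, hends S hSo hhS⟩
    have hi := Finset.insert_erase hhS
    have hSe : Ω.ends (S.erase h) = (opp h :: t).toFinset := by
      rw [(ends_insert_of_opp_mem hh hn ho).1, hi, (mem_oddConf.1 hSo).2.2, List.toFinset_cons]
    have h1 := listSign_edgeFlat_insert hh hn ho c hc t
    rw [hi, listSign] at h1
    have h2 := prod_orient_eq (nodup_opp_cons ht htb hh) hSe h
    rw [List.cons_append] at h2
    rw [h1, h2, localSign, List.cons_append]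
    have h3 : (∏ b ∈ S.erase h, orient h b) * (∏ b ∈ S.erase h, orient h b) = 1 := by
      rw [← Finset.prod_mul_distrib]
      exact Finset.prod_eq_one fun b hb => orient_mul_self (Finset.ne_of_mem_erase hb).symm
    linear_combination (edgeOrient h * c h * (listSign (opp h :: (t ++ Ω.edgeFlat (S.erase h))) *
      Ω.weight c (S.erase h))) * h3

/-- Deleting the source itself removes it from the list; bringing it to the front first costs `(-1)
^ l`. These values are the boundary data in the uniqueness argument. -/
lemma arrival_source (c : HalfEdge → ℝ) {m : ℕ} {t : Fin (m + 1) → HalfEdge}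
    (ht : Function.Injective t) (htb : ∀ l, t l ∈ Ω.boundary) (l : Fin (m + 1)) :
    Ω.arrival c (List.ofFn t) (t l) =
      (-1) ^ (l : ℕ) * Ω.partition c (List.ofFn (t ∘ l.succAbove)) := by
  classical
  have hv := (mem_boundary.1 (htb l)).1
  have hE := (mem_boundary.1 (htb l)).2
  have hins : ∀ S : Finset HalfEdge, t l ∈ Ω.E → opp (t l) ∉ S := fun _ h => absurd h hE
  have htf : (List.ofFn t).toFinset = insert (t l) (List.ofFn (t ∘ l.succAbove)).toFinset := by
    ext g
    simp only [List.mem_toFinset, List.mem_ofFn, Finset.mem_insert, Function.comp_apply]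
    constructor
    · rintro ⟨i, rfl⟩
      rcases eq_or_ne i l with rfl | hi
      · exact .inl rfl
      · obtain ⟨k, rfl⟩ := Fin.exists_succAbove_eq hi
        exact .inr ⟨k, rfl⟩
    · rintro (rfl | ⟨k, rfl⟩)
      · exact ⟨l, rfl⟩
      · exact ⟨_, rfl⟩
  have hnot : t l ∉ (List.ofFn (t ∘ l.succAbove)).toFinset := by
    simp only [List.mem_toFinset, List.mem_ofFn, Function.comp_apply, not_exists]
    exact fun k e => Fin.succAbove_ne l k (ht e)
  have hnd : (List.ofFn (t ∘ l.succAbove)).Nodup :=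
    List.nodup_ofFn.2 (ht.comp Fin.succAbove_right_injective)
  rw [arrival, ← Finset.sum_filter, partition, Finset.mul_sum]
  refine Finset.sum_nbij' (fun S => S.erase (t l)) (fun S => insert (t l) S) ?_ ?_ ?_ ?_ ?_
  · intro S hS
    obtain ⟨hSo, hhS⟩ := Finset.mem_filter.1 hS
    have hi := Finset.insert_erase hhS
    have hn := Finset.notMem_erase (t l) S
    rw [mem_oddConf] at hSo
    rw [Finset.mem_filter, mem_confGen_iff_insert hv hn, hi]
    refine ⟨⟨hSo.1, hSo.2.1⟩, ?_⟩
    have h1 := ends_insert (hins (S.erase (t l)))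
    rw [hi, hSo.2.2, htf] at h1
    have h2 : t l ∉ Ω.ends (S.erase (t l)) := fun e => hn (mem_ends.1 e).1
    rw [← Finset.erase_insert h2, ← h1, Finset.erase_insert hnot]
  · intro S hS
    obtain ⟨hSc, hSe⟩ := Finset.mem_filter.1 hS
    have hn : t l ∉ S := fun e => hnot (by
      rw [← hSe]; exact mem_ends.2 ⟨e, fun e => hE e.1⟩)
    rw [mem_confGen_iff_insert hv hn] at hSc
    rw [Finset.mem_filter, mem_oddConf, ends_insert (hins S), hSe, htf]
    exact ⟨⟨hSc.1, hSc.2, rfl⟩, Finset.mem_insert_self _ _⟩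
  · intro S hS
    exact Finset.insert_erase (Finset.mem_filter.1 hS).2
  · intro S hS
    exact Finset.erase_insert fun e => hnot (by
      rw [← (Finset.mem_filter.1 hS).2]; exact mem_ends.2 ⟨e, fun e => hE e.1⟩)
  · intro S hS
    obtain ⟨hSo, hhS⟩ := Finset.mem_filter.1 hS
    have hi := Finset.insert_erase hhS
    have hn := Finset.notMem_erase (t l) S
    have hSe : Ω.ends (S.erase (t l)) = (List.ofFn (t ∘ l.succAbove)).toFinset := by
      have h1 := ends_insert (hins (S.erase (t l)))
      rw [hi, (mem_oddConf.1 hSo).2.2, htf] at h1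
      have h2 : t l ∉ Ω.ends (S.erase (t l)) := fun e => hn (mem_ends.1 e).1
      rw [← Finset.erase_insert h2, ← h1, Finset.erase_insert hnot]
    have he := edgeSet_insert (hins (S.erase (t l)))
    rw [hi] at he
    have he' : Ω.edgeFlat S = Ω.edgeFlat (S.erase (t l)) := by
      rw [edgeFlat, edgeFlat, edgePairs, edgePairs, he]
    rw [he', weight, he, ← weight, listSign_ofFn_succAbove t l, listSign,
      prod_orient_eq hnd hSe, localSign]
    have h3 : (∏ b ∈ S.erase (t l), orient (t l) b) * (∏ b ∈ S.erase (t l), orient (t l) b) = 1 := by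
      rw [← Finset.prod_mul_distrib]
      exact Finset.prod_eq_one fun b hb => orient_mul_self (Finset.ne_of_mem_erase hb).symm
    linear_combination ((-1) ^ (l : ℕ) * listSign (List.ofFn (t ∘ l.succAbove) ++
      Ω.edgeFlat (S.erase (t l))) * Ω.weight c (S.erase (t l))) * h3

lemma arrival_boundary (c : HalfEdge → ℝ) {t : List HalfEdge} {h : HalfEdge} (hh : h ∉ Ω.E)
    (hht : h ∉ t) : Ω.arrival c t h = 0 := by
  refine Finset.sum_eq_zero fun S hS => if_neg fun hhS => hht ?_
  rw [← List.mem_toFinset, ← (mem_oddConf.1 hS).2.2]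
  exact mem_ends.2 ⟨hhS, fun e => hh e.1⟩

end DiscreteDomain
end Ising
end

noncomputable section

namespace Ising

namespace DiscreteDomain

variable {Ω : DiscreteDomain}

/-! ### Uniqueness for the linear relations at the critical weight -/

lemma sum_dir (F : Dir → ℝ) : ∑ d, F d = F 0 + F 1 + F 2 + F 3 :=
  Fin.sum_univ_four F

lemma sum_dirOrient (u : Dir → ℝ) (j : Dir) :
    ∑ k ∈ Finset.univ.erase j, (dirOrient j k : ℝ) * u k = ∑ k, (dirOrient j k : ℝ) * u k := by
  rw [← Finset.sum_erase_add _ _ (Finset.mem_univ j)]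
  simp [dirOrient]

/-- The constant is (1 + √2)² = x⁻². In the order west, south, east, north the four linear forms are
the recursion w(k-1) - √2 w(k) + w(k+1) = 0 with w(k+4) = -w(k), so two neighbouring zero values
force the others to vanish. -/
lemma dirOrient_form (u : Dir → ℝ) :
    (3 + 2 * √2) * ∑ k, u k ^ 2 - ∑ j, (∑ k, (dirOrient j k : ℝ) * u k) ^ 2 =
      √2 / 2 * ((u 2 - √2 * u 3 + u 0) ^ 2 + (u 3 - √2 * u 0 + u 1) ^ 2 +
        (u 0 - √2 * u 1 - u 2) ^ 2 + (u 1 + √2 * u 2 - u 3) ^ 2) := by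
  have e00 : dirOrient 0 0 = 0 := by decide
  have e01 : dirOrient 0 1 = 1 := by decide
  have e02 : dirOrient 0 2 = -1 := by decide
  have e03 : dirOrient 0 3 = -1 := by decide
  have e10 : dirOrient 1 0 = -1 := by decide
  have e11 : dirOrient 1 1 = 0 := by decide
  have e12 : dirOrient 1 2 = -1 := by decide
  have e13 : dirOrient 1 3 = -1 := by decide
  have e20 : dirOrient 2 0 = 1 := by decide
  have e21 : dirOrient 2 1 = 1 := by decide
  have e22 : dirOrient 2 2 = 0 := by decide
  have e23 : dirOrient 2 3 = 1 := by decide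
  have e30 : dirOrient 3 0 = 1 := by decide
  have e31 : dirOrient 3 1 = 1 := by decide
  have e32 : dirOrient 3 2 = -1 := by decide
  have e33 : dirOrient 3 3 = 0 := by decide
  simp only [sum_dir, e00, e01, e02, e03, e10, e11, e12, e13, e20, e21, e22, e23, e30, e31, e32,
    e33]
  push_cast
  have hr : √2 * √2 = 2 := Real.mul_self_sqrt (by norm_num)
  generalize √2 = r at hr
  generalize u 0 = a
  generalize u 1 = b
  generalize u 2 = c
  generalize u 3 = d
  linear_combination (-(r / 2) * (a ^ 2 + b ^ 2 + c ^ 2 + d ^ 2) +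
    2 * (a * b - a * (-d) + c * d - b * c)) * hr

/-- An energy argument: the local form is nonnegative at each vertex, but the edge relations make
its total nonpositive. Thus all the squares vanish, and the domain is swept from its north-east
extremity. -/
lemma eq_zero_of_relation {f g s : HalfEdge → ℝ}
    (hf : ∀ v ∈ Ω.V, ∀ j, f (v, j) =
      ∑ k ∈ Finset.univ.erase j, (dirOrient j k : ℝ) * g (v, k))
    (hg : ∀ h ∈ Ω.E, g h = s h * f (opp h))
    (hs : ∀ h ∈ Ω.E, s h * s h = DoubleCover.xCrit * DoubleCover.xCrit)
    (hb : ∀ h ∈ Ω.boundary, g h = 0) : ∀ v ∈ Ω.V, ∀ j, f (v, j) = 0 := by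
  simp only [sum_dirOrient] at hf
  have hr : √2 * √2 = 2 := Real.mul_self_sqrt (by norm_num)
  have hr0 : 0 < √2 := by positivity
  have hx : (3 + 2 * √2) * (DoubleCover.xCrit * DoubleCover.xCrit) = 1 := by
    unfold DoubleCover.xCrit
    linear_combination (2 * √2 - 1) * hr
  set D : ℤ × ℤ → ℝ := fun v => (3 + 2 * √2) * ∑ k, g (v, k) ^ 2 - ∑ j, f (v, j) ^ 2 with hD
  have hDform : ∀ v ∈ Ω.V, D v = √2 / 2 * ((g (v, 2) - √2 * g (v, 3) + g (v, 0)) ^ 2 +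
      (g (v, 3) - √2 * g (v, 0) + g (v, 1)) ^ 2 + (g (v, 0) - √2 * g (v, 1) - g (v, 2)) ^ 2 +
      (g (v, 1) + √2 * g (v, 2) - g (v, 3)) ^ 2) := by
    intro v hv
    rw [← dirOrient_form fun k => g (v, k)]
    simp only [hD, hf v hv]
  have hD0 : ∀ v ∈ Ω.V, 0 ≤ D v := fun v hv => by rw [hDform v hv]; positivity
  -- On interior edges, x⁻² g² is f² at the opposite half, and g vanishes on the boundary. What is
  -- left is minus the sum of f² over the boundary half-edges.
  have hsum : ∑ v ∈ Ω.V, D v ≤ 0 := by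
    have h1 : ∑ h ∈ Ω.halfEdges, g h ^ 2 =
        DoubleCover.xCrit * DoubleCover.xCrit * ∑ h ∈ Ω.E, f h ^ 2 := by
      have hsub : Ω.E ⊆ Ω.halfEdges := fun h hh => mem_halfEdges.2 (Ω.vertex_mem h hh)
      rw [← Finset.sum_subset hsub fun h hh hE => by
        rw [hb h (mem_boundary.2 ⟨mem_halfEdges.1 hh, hE⟩)]; ring, Finset.mul_sum]
      refine Finset.sum_nbij' opp opp Ω.opp_mem Ω.opp_mem (fun h _ => opp_opp h)
        (fun h _ => opp_opp h) fun h hh => ?_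
      rw [hg h hh, mul_pow, sq (s h), hs h hh]
    have h2 : ∑ h ∈ Ω.E, f h ^ 2 ≤ ∑ h ∈ Ω.halfEdges, f h ^ 2 :=
      Finset.sum_le_sum_of_subset_of_nonneg
        (fun h hh => mem_halfEdges.2 (Ω.vertex_mem h hh)) fun _ _ _ => sq_nonneg _
    have h3 : ∑ v ∈ Ω.V, D v =
        (3 + 2 * √2) * ∑ h ∈ Ω.halfEdges, g h ^ 2 - ∑ h ∈ Ω.halfEdges, f h ^ 2 := by
      simp only [hD, halfEdges, Finset.sum_product, Finset.sum_sub_distrib, Finset.mul_sum]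
    rw [h3, h1, ← mul_assoc, hx]
    linarith
  have hDz : ∀ v ∈ Ω.V, D v = 0 := by
    have := (Finset.sum_eq_zero_iff_of_nonneg hD0).1
      (le_antisymm hsum (Finset.sum_nonneg hD0))
    exact this
  obtain ⟨B, hB⟩ : ∃ B : ℤ, ∀ v ∈ Ω.V, v.1 + v.2 ≤ B := by
    obtain ⟨B, hB⟩ := (Ω.V.image fun v => v.1 + v.2).bddAbove
    exact ⟨B, fun v hv => hB (Finset.mem_coe.2 (Finset.mem_image_of_mem _ hv))⟩
  -- Induction on the distance of the diagonal of `v` from the last one. Neighbours to the east and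
  -- north lie one diagonal further, so the arrivals from there vanish.
  have main : ∀ n : ℕ, ∀ v ∈ Ω.V, B < v.1 + v.2 + n → ∀ j, f (v, j) = 0 := by
    intro n
    induction n with
    | zero =>
      intro v hv h
      have := hB v hv
      push_cast at h
      omega
    | succ n ih =>
      intro v hv h
      have hz : ∀ d : Dir, (shift d).1 + (shift d).2 = 1 → g (v, d) = 0 := by
        intro d hd
        by_cases hE : (v, d) ∈ Ω.E
        · have hv' := Ω.vertex_mem _ (Ω.opp_mem _ hE)
          rw [hg _ hE]
          have : f (opp (v, d)) = 0 := by
            refine ih (v + shift d) hv' ?_ (d + 2)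
            simp only [Prod.fst_add, Prod.snd_add]
            push_cast at h
            omega
          rw [this, mul_zero]
        · exact hb _ (mem_boundary.2 ⟨hv, hE⟩)
      have h0 := hz 0 (by decide)
      have h1 := hz 1 (by decide)
      have hDv := hDz v hv
      rw [hDform v hv, h0, h1] at hDv
      -- With no arrivals from east and north, the second square is the arrival from the south and
      -- the third is the one from the west.
      have hq : ∀ a b c d : ℝ, √2 / 2 * (a ^ 2 + b ^ 2 + c ^ 2 + d ^ 2) = 0 → b = 0 ∧ c = 0 := by
        intro a b c d hq
        have : a ^ 2 + b ^ 2 + c ^ 2 + d ^ 2 = 0 := by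
          rcases mul_eq_zero.1 hq with h | h
          · linarith
          · exact h
        constructor <;> nlinarith [sq_nonneg a, sq_nonneg b, sq_nonneg c, sq_nonneg d]
      obtain ⟨h3, h2⟩ := hq _ _ _ _ hDv
      have h3' : g (v, 3) = 0 := by linarith
      have h2' : g (v, 2) = 0 := by linarith
      intro j
      rw [hf v hv, sum_dir, h0, h1, h2', h3']
      ring
  intro v hv
  refine main (B - (v.1 + v.2) + 1).toNat v hv ?_
  have := hB v hv
  omega

/-- The expansion of a partition function with respect to its first source. -/
theorem partition_cons_expansion {c : HalfEdge → ℝ} (hc : ∀ g ∈ Ω.E, c (opp g) = c g)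
    (hc2 : ∀ g ∈ Ω.E, c g * c g = DoubleCover.xCrit * DoubleCover.xCrit) {m : ℕ}
    {t : Fin (m + 1) → HalfEdge} (ht : Function.Injective t) (htb : ∀ l, t l ∈ Ω.boundary)
    {h : HalfEdge} (hh : h.1 ∈ Ω.V) :
    Ω.partition c (h :: List.ofFn t) * Ω.partition c [] =
      ∑ l : Fin (m + 1), (-1) ^ (l : ℕ) * Ω.partition c [h, t l] * Ω.partition c (List.ofFn (t ∘ l.succAbove)) := by
  have hnd := List.nodup_ofFn.2 ht
  have hbd : ∀ g ∈ List.ofFn t, g ∈ Ω.boundary := by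
    intro g hg
    obtain ⟨l, rfl⟩ := List.mem_ofFn.1 hg
    exact htb l
  have hnd1 : ∀ l, [t l].Nodup := fun l => List.nodup_singleton _
  have hbd1 : ∀ l, ∀ g ∈ [t l], g ∈ Ω.boundary := by
    intro l g hg
    rw [List.mem_singleton] at hg
    exact hg ▸ htb l
  have hsingle : ∀ l, Ω.arrival c [t l] (t l) = Ω.partition c [] := by
    intro l
    have := arrival_source (Ω := Ω) c (m := 0) (t := fun _ => t l)
      (fun i j _ => Fin.ext (by omega)) (fun _ => htb l) 0
    simpa using this
  set C : Fin (m + 1) → ℝ := fun l =>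
    (-1) ^ (l : ℕ) * Ω.partition c (List.ofFn (t ∘ l.succAbove)) with hC
  -- Both sides of the expansion, as functions of `h`, satisfy the same relations. The coefficients
  -- `C l` are those for which the arrivals cancel at each source: there the full function arrives
  -- with `(-1) ^ l` times the partition function without that source, and only the `l`-th two-point
  -- function arrives.
  have key := eq_zero_of_relation (Ω := Ω)
    (f := fun h => Ω.partition c (h :: List.ofFn t) * Ω.partition c [] -
      ∑ l, C l * Ω.partition c [h, t l])
    (g := fun h => Ω.arrival c (List.ofFn t) h * Ω.partition c [] -
      ∑ l, C l * Ω.arrival c [t l] h)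
    (s := fun h => edgeOrient h * c h) ?_ ?_ ?_ ?_ h.1 hh h.2
  · have := sub_eq_zero.1 key
    rw [this]
    refine Finset.sum_congr rfl fun l _ => ?_
    simp only [hC, Prod.mk.eta]
    ring
  · intro v hv j
    rw [partition_cons_relation c hnd hbd hv j]
    simp only [fun l => partition_cons_relation c (hnd1 l) (hbd1 l) hv j]
    simp only [mul_sub, Finset.sum_sub_distrib, Finset.mul_sum, Finset.sum_mul]
    rw [Finset.sum_comm]
    congr 1
    · exact Finset.sum_congr rfl fun k _ => by ring
    · exact Finset.sum_congr rfl fun k _ => Finset.sum_congr rfl fun l _ => by ring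
  · intro h hE
    rw [arrival_interior c hc hnd hbd hE]
    simp only [fun l => arrival_interior c hc (hnd1 l) (hbd1 l) hE]
    rw [mul_sub, Finset.mul_sum]
    congr 1
    · ring
    · exact Finset.sum_congr rfl fun k _ => by ring
  · intro h hE
    rw [← hc2 h hE]
    linear_combination c h * c h * edgeOrient_mul_self h
  · intro h hbdh
    have hE := (mem_boundary.1 hbdh).2
    by_cases hm : h ∈ List.ofFn t
    · obtain ⟨l, rfl⟩ := List.mem_ofFn.1 hm
      rw [arrival_source c ht htb l, Finset.sum_eq_single l, hsingle]
      · simp [hC]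
      · intro k _ hk
        rw [arrival_boundary c hE (by simpa using fun e => hk (ht e).symm), mul_zero]
      · simp
    · rw [arrival_boundary c hE hm, Finset.sum_eq_zero]
      · ring
      · intro k _
        rw [arrival_boundary c hE, mul_zero]
        intro e
        rw [List.mem_singleton] at e
        exact hm (e ▸ List.mem_ofFn.2 ⟨k, rfl⟩)

end DiscreteDomain
end Ising
end

noncomputable section

namespace Ising

/-! ### Pfaffians from expansions with respect to the first index -/

/-- The pair `(0, e)` encodes the extension of `e` to a permutation that fixes `0`; applied twice,
it leaves the first pair of positions alone. -/
lemma decomposeFin_zero_succ {n : ℕ} (e : Equiv.Perm (Fin n)) (i : Fin n) :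
    Equiv.Perm.decomposeFin.symm (0, e) i.succ = (e i).succ := by
  simp

lemma decomposeFin_zero_zero {n : ℕ} (e : Equiv.Perm (Fin n)) :
    Equiv.Perm.decomposeFin.symm (0, e) 0 = 0 := by
  simp

lemma decomposeFin_zero_sign {n : ℕ} (e : Equiv.Perm (Fin n)) :
    Equiv.Perm.sign (Equiv.Perm.decomposeFin.symm (0, e)) = Equiv.Perm.sign e := by
  simp

/-- An alternating family of functions with an expansion with respect to the first argument is
given by Pfaffians. -/
theorem pfaffian_of_expansion {X : Type*} (P : ∀ m, (Fin m → X) → ℝ) (g : X → X → ℝ)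
    (h0 : ∀ t, P 0 t = 1)
    (hexp : ∀ m (t : Fin (m + 2) → X), Function.Injective t → P (m + 2) t =
      ∑ k : Fin (m + 1), (-1) ^ (k : ℕ) * g (t 0) (t k.succ) *
        P m (fun i => t (k.succAbove i).succ))
    (hanti : ∀ m (t : Fin m → X) (σ : Equiv.Perm (Fin m)),
      P m (t ∘ σ) = ((Equiv.Perm.sign σ : ℤ) : ℝ) * P m t)
    (m : ℕ) (t : Fin (2 * m) → X) (ht : Function.Injective t) :
    pfaffian (Matrix.of fun i j => g (t i) (t j)) = P (2 * m) t := by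
  suffices h : ∀ (m : ℕ) (t : Fin (2 * m) → X), Function.Injective t →
      ∑ σ : Equiv.Perm (Fin (2 * m)), ((Equiv.Perm.sign σ : ℤ) : ℝ) *
        ∏ i : Fin m, g (t (σ ⟨2 * i, by omega⟩)) (t (σ ⟨2 * i + 1, by omega⟩)) =
      2 ^ m * (m.factorial : ℝ) * P (2 * m) t by
    have hne : (2 ^ m * (m.factorial : ℝ)) ≠ 0 := by positivity
    rw [pfaffian]
    simp only [Matrix.of_apply]
    rw [h m t ht, inv_mul_cancel_left₀ hne]
  clear m t ht
  intro m
  induction m with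
  | zero =>
    intro t _
    have : P (2 * 0) t = 1 := h0 t
    rw [this]
    simp
  | succ m ih =>
    intro t ht
    change Fin (2 * m + 2) → X at t
    -- The bridge between the two sides: antisymmetrization of a function that pairs the first two
    -- positions and leaves `P` on the rest.
    set A : ℝ := ∑ σ : Equiv.Perm (Fin (2 * m + 2)), ((Equiv.Perm.sign σ : ℤ) : ℝ) *
      (g (t (σ 0)) (t (σ 1)) * P (2 * m) (fun i => t (σ i.succ.succ))) with hA
    have hsq : ∀ {n : ℕ} (σ : Equiv.Perm (Fin n)),
        ((Equiv.Perm.sign σ : ℤ) : ℝ) * ((Equiv.Perm.sign σ : ℤ) : ℝ) = 1 := fun σ => by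
      rcases Int.units_eq_one_or (Equiv.Perm.sign σ) with h | h <;> simp [h]
    have h1 : ((2 * m + 2).factorial : ℝ) * P (2 * m + 2) t = (2 * m + 1) * A := by
      have e1 : ((2 * m + 2).factorial : ℝ) * P (2 * m + 2) t =
          ∑ σ : Equiv.Perm (Fin (2 * m + 2)), ((Equiv.Perm.sign σ : ℤ) : ℝ) *
            P (2 * m + 2) (t ∘ σ) := by
        simp only [hanti, ← mul_assoc, hsq, one_mul, Finset.sum_const, nsmul_eq_mul,
          Finset.card_univ, Fintype.card_perm, Fintype.card_fin]
      rw [e1]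
      simp only [fun σ : Equiv.Perm (Fin (2 * m + 2)) =>
        hexp (2 * m) (t ∘ σ) (ht.comp σ.injective), Finset.mul_sum]
      rw [Finset.sum_comm]
      have e2 : ∀ k : Fin (2 * m + 1), ∑ σ : Equiv.Perm (Fin (2 * m + 2)),
          ((Equiv.Perm.sign σ : ℤ) : ℝ) * ((-1) ^ (k : ℕ) * g ((t ∘ σ) 0) ((t ∘ σ) k.succ) *
            P (2 * m) (fun i => (t ∘ σ) (k.succAbove i).succ)) = A := by
        intro k
        -- Reindexing by the cycle that takes position 1 to `k.succ` and fixes 0; its sign cancels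
        -- `(-1) ^ k`.
        rw [hA, ← Equiv.sum_comp
          (Equiv.mulRight (Equiv.Perm.decomposeFin.symm (0, k.cycleRange.symm)))
          fun σ : Equiv.Perm (Fin (2 * m + 2)) => ((Equiv.Perm.sign σ : ℤ) : ℝ) *
            (g (t (σ 0)) (t (σ 1)) * P (2 * m) (fun i => t (σ i.succ.succ)))]
        refine Finset.sum_congr rfl fun σ _ => ?_
        have z1 : (1 : Fin (2 * m + 2)) = Fin.succ 0 := rfl
        simp only [Equiv.coe_mulRight, Equiv.Perm.mul_apply, map_mul, Units.val_mul,
          decomposeFin_zero_sign, decomposeFin_zero_zero, z1, decomposeFin_zero_succ,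
          Fin.cycleRange_symm_zero, Fin.cycleRange_symm_succ, Equiv.Perm.sign_symm,
          Fin.sign_cycleRange, Function.comp_apply]
        push_cast
        ring
      rw [Finset.sum_congr rfl fun k _ => e2 k]
      simp
    have h2 : ((2 * m).factorial : ℝ) * ∑ σ : Equiv.Perm (Fin (2 * m + 2)),
        ((Equiv.Perm.sign σ : ℤ) : ℝ) * ∏ i : Fin (m + 1),
          g (t (σ ⟨2 * i, by omega⟩)) (t (σ ⟨2 * i + 1, by omega⟩)) =
        2 ^ m * (m.factorial : ℝ) * A := by
      set F : Equiv.Perm (Fin (2 * m + 2)) → ℝ := fun σ => ((Equiv.Perm.sign σ : ℤ) : ℝ) *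
        ∏ i : Fin (m + 1), g (t (σ ⟨2 * i, by omega⟩)) (t (σ ⟨2 * i + 1, by omega⟩)) with hF
      set lift : Equiv.Perm (Fin (2 * m)) → Equiv.Perm (Fin (2 * m + 2)) := fun π =>
        Equiv.Perm.decomposeFin.symm (0, Equiv.Perm.decomposeFin.symm (0, π)) with hlift
      -- Permuting the positions from 2 onwards reproduces the whole sum `(2 * m)!` times; the inner
      -- sum over `π` is then the induction hypothesis.
      have e1 : ((2 * m).factorial : ℝ) * ∑ σ, F σ =
          ∑ σ, ∑ π, F (σ * lift π) := by
        rw [Finset.sum_comm]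
        have : ∀ π, ∑ σ, F (σ * lift π) = ∑ σ, F σ := fun π =>
          Equiv.sum_comp (Equiv.mulRight (lift π)) F
        simp [this, Fintype.card_perm]
      rw [e1, hA, Finset.mul_sum]
      refine Finset.sum_congr rfl fun σ _ => ?_
      have e2 := ih (fun i => t (σ i.succ.succ))
        (ht.comp (σ.injective.comp ((Fin.succ_injective _).comp (Fin.succ_injective _))))
      have e3 : ∀ π, F (σ * lift π) = ((Equiv.Perm.sign σ : ℤ) : ℝ) * g (t (σ 0)) (t (σ 1)) *
          (((Equiv.Perm.sign π : ℤ) : ℝ) * ∏ i : Fin m,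
            g (t (σ (π ⟨2 * i, by omega⟩).succ.succ))
              (t (σ (π ⟨2 * i + 1, by omega⟩).succ.succ))) := by
        intro π
        have a0 : lift π 0 = 0 := by simp [hlift]
        have a1 : lift π 1 = 1 := by
          have : (1 : Fin (2 * m + 2)) = Fin.succ 0 := rfl
          rw [this, hlift]
          simp only [decomposeFin_zero_succ, decomposeFin_zero_zero]
        have a2 : ∀ i : Fin (2 * m), lift π i.succ.succ = (π i).succ.succ := fun i => by
          simp only [hlift, decomposeFin_zero_succ]
        have as : Equiv.Perm.sign (lift π) = Equiv.Perm.sign π := by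
          simp only [hlift, decomposeFin_zero_sign]
        simp only [hF]
        rw [Fin.prod_univ_succ, map_mul, as]
        have b0 : ∀ h, (⟨2 * ((0 : Fin (m + 1)) : ℕ), h⟩ : Fin (2 * m + 2)) = 0 :=
          fun h => Fin.ext (by simp)
        have b1 : ∀ h, (⟨2 * ((0 : Fin (m + 1)) : ℕ) + 1, h⟩ : Fin (2 * m + 2)) = 1 :=
          fun h => Fin.ext (by simp)
        have b2 : ∀ (i : Fin m) h, (⟨2 * (i.succ : ℕ), h⟩ : Fin (2 * m + 2)) =
            (⟨2 * i, by omega⟩ : Fin (2 * m)).succ.succ := fun i h => Fin.ext (by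
          simp only [Fin.val_succ]; ring)
        have b3 : ∀ (i : Fin m) h, (⟨2 * (i.succ : ℕ) + 1, h⟩ : Fin (2 * m + 2)) =
            (⟨2 * i + 1, by omega⟩ : Fin (2 * m)).succ.succ := fun i h => Fin.ext (by
          simp only [Fin.val_succ]; ring)
        simp only [Equiv.Perm.mul_apply, b0, b1, b2, b3, a0, a1, a2]
        push_cast
        ring
      rw [Finset.sum_congr rfl fun π _ => e3 π, ← Finset.mul_sum, e2]
      ring
    have hf : ((2 * m + 2).factorial : ℝ) =
        (2 * m + 2) * ((2 * m + 1) * ((2 * m).factorial : ℝ)) := by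
      rw [Nat.factorial_succ, Nat.factorial_succ]
      push_cast
      ring
    have hne : ((2 * m).factorial : ℝ) ≠ 0 := by positivity
    have hne2 : (2 * (m : ℝ) + 1) ≠ 0 := by positivity
    refine mul_left_cancel₀ hne (h2.trans ?_)
    refine mul_left_cancel₀ hne2 ?_
    change _ = (2 * (m : ℝ) + 1) * (((2 * m).factorial : ℝ) *
      (2 ^ (m + 1) * ((m + 1).factorial : ℝ) * P (2 * m + 2) t))
    rw [hf] at h1
    rw [Nat.factorial_succ, pow_succ]
    push_cast
    linear_combination (-(2 ^ m * (m.factorial : ℝ))) * h1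

end Ising
end

noncomputable section

namespace Ising

/-! ### The sign of an even subgraph of the square lattice -/

lemma key_lt_key_opp {h : HalfEdge} (hh : Primary h) : key h < key (opp h) := by
  obtain ⟨⟨x, y⟩, d⟩ := h
  rw [key_lt_iff]
  have s0 : shift 0 = (1, 0) := by decide
  have s1 : shift 1 = (0, 1) := by decide
  rcases hh with h | h <;> dsimp only at h <;> subst h <;> simp [opp, s0, s1]

/-- The comparison sign of two edges: `-1` if the first one starts first and they interlace. -/
def interlace (p q : HalfEdge) : ℝ :=
  if key p < key q ∧ key q < key (opp p) ∧ key (opp p) < key (opp q) then -1 else 1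

/-- Two chords on a line have comparison sign -1 exactly if their endpoints interlace; at most one
of the two factors on the right is -1. -/
lemma orient_pairs_eq_interlace {p q : HalfEdge} (hp : Primary p) (hq : Primary q) (hne : p ≠ q) :
    orient p q * orient p (opp q) * (orient (opp p) q * orient (opp p) (opp q)) =
      interlace p q * interlace q p := by
  have h1 := key_lt_key_opp hp
  have h2 := key_lt_key_opp hq
  have n1 : key p ≠ key q := fun e => hne (key_injective e)
  have n2 : key p ≠ key (opp q) := fun e => by
    rw [key_injective e] at hp; exact (primary_opp q).1 hp hq
  have n3 : key (opp p) ≠ key q := fun e => by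
    rw [← key_injective e] at hq; exact (primary_opp p).1 hq hp
  have n4 : key (opp p) ≠ key (opp q) := fun e => hne (opp_injective (key_injective e))
  unfold orient interlace
  generalize key p = a at *
  generalize key q = b at *
  generalize key (opp p) = a' at *
  generalize key (opp q) = b' at *
  rcases n1.lt_or_gt with l1 | l1 <;> rcases n2.lt_or_gt with l2 | l2 <;>
    rcases n3.lt_or_gt with l3 | l3 <;> rcases n4.lt_or_gt with l4 | l4 <;>
    first
    | (exfalso; order)
    | simp [l1, l2, l3, l4, l1.not_gt, l2.not_gt, l3.not_gt, l4.not_gt]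

lemma interlace_self (p : HalfEdge) : interlace p p = 1 := by simp [interlace]

lemma listSign_edges_eq {L : List HalfEdge} (hL : L.Nodup) (hp : ∀ p ∈ L, Primary p) :
    listSign (flatPairs (L.map fun h => (h, opp h))) =
      (L.map fun p => (L.map fun q => interlace p q).prod).prod := by
  induction L with
  | nil => simp [flatPairs, listSign]
  | cons p L ih =>
    rw [List.nodup_cons] at hL
    have hpp : Primary p := hp p (by simp)
    have hpL : ∀ q ∈ L, Primary q := fun q hq => hp q (by simp [hq])
    have e1 : ∀ M : List HalfEdge,
        ((flatPairs (M.map fun h => (h, opp h))).map (orient p)).prod *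
        ((flatPairs (M.map fun h => (h, opp h))).map (orient (opp p))).prod =
        (M.map fun q => orient p q * orient p (opp q) *
          (orient (opp p) q * orient (opp p) (opp q))).prod := by
      intro M
      induction M with
      | nil => simp [flatPairs]
      | cons q M ihM =>
        simp only [List.map_cons, flatPairs_cons, List.prod_cons]
        rw [← ihM]
        ring
    have e2 : (L.map fun q => orient p q * orient p (opp q) *
          (orient (opp p) q * orient (opp p) (opp q))).prod =
        (L.map fun q => interlace p q).prod * (L.map fun q => interlace q p).prod := by
      rw [← List.prod_map_mul]
      refine congrArg _ (List.map_congr_left fun q hq => ?_)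
      exact orient_pairs_eq_interlace hpp (hpL q hq) fun e => hL.1 (e ▸ hq)
    simp only [List.map_cons, flatPairs_cons, listSign, List.prod_cons, interlace_self, one_mul]
    rw [List.prod_map_mul, ih hL.2 hpL, orient_of_lt (key_lt_key_opp hpp)]
    linear_combination ((L.map fun p => (L.map fun q => interlace p q).prod).prod) * (e1 L |>.trans e2)

/-- The sign of a vertex with respect to the quadrant below and to the right of an edge `p`. -/
def quadrantSign (p : HalfEdge) (v : ℤ × ℤ) : ℝ :=
  if p.2 = 0 ∧ v.1 = p.1.1 + 1 ∧ v.2 < p.1.2 then -1 else 1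

/-- The sign of two different horizontal edges in the same column. -/
def columnSign (p q : HalfEdge) : ℝ :=
  if p ≠ q ∧ p.2 = 0 ∧ q.2 = 0 ∧ p.1.1 = q.1.1 then -1 else 1

/-- A vertical edge spans no vertex and is never interlaced by a later edge. For a horizontal `p`,
what matters is which ends of `q` lie straight below the right end of `p`, up to a correction for
horizontal edges in the same column. Starting the order of directions at west settles the borderline
cases. -/
lemma interlace_eq {p q : HalfEdge} (hp : Primary p) (hq : Primary q) : interlace p q =
    columnSign p q * (quadrantSign p q.1 * quadrantSign p (opp q).1) := by
  obtain ⟨⟨x, y⟩, d⟩ := p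
  obtain ⟨⟨x', y'⟩, d'⟩ := q
  have r0 : rank 0 = 2 := by decide
  have r1 : rank 1 = 3 := by decide
  have r2 : rank (0 + 2) = 0 := by decide
  have r3 : rank (1 + 2) = 1 := by decide
  have s0 : shift 0 = (1, 0) := by decide
  have s1 : shift 1 = (0, 1) := by decide
  have d01 : (0 : Dir) ≠ 1 := by decide
  have d10 : (1 : Dir) ≠ 0 := by decide
  rcases hp with h | h <;> rcases hq with h' | h' <;> dsimp only at h h' <;> subst h <;> subst h' <;>
    simp only [interlace, columnSign, quadrantSign, key_lt_iff, opp, r0, r1, r2, r3, s0, s1,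
      Prod.mk_add_mk, ne_eq, Prod.mk.injEq, d01, d10, and_true, true_and, and_false, false_and,
      if_false, one_mul, mul_one, not_false_eq_true] <;>
    split_ifs <;> first | (exfalso; omega) | norm_num

lemma prod_opp_closed {K : Finset HalfEdge} (hK : ∀ h ∈ K, opp h ∈ K) (F : HalfEdge → ℝ) :
    ∏ h ∈ K, F h = ∏ q ∈ K.filter fun h => Primary h, F q * F (opp q) := by
  rw [← Finset.prod_filter_mul_prod_filter_not K (fun h => Primary h), Finset.prod_mul_distrib]
  congr 1
  refine Finset.prod_nbij' opp opp ?_ ?_ (fun h _ => opp_opp h) (fun h _ => opp_opp h) ?_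
  · intro h hh
    rw [Finset.mem_filter] at hh ⊢
    exact ⟨hK h hh.1, (primary_opp h).2 hh.2⟩
  · intro h hh
    rw [Finset.mem_filter] at hh ⊢
    exact ⟨hK h hh.1, fun e => (primary_opp h).1 e hh.2⟩
  · intro h _
    rw [opp_opp]

lemma prod_vertex_sign {K : Finset HalfEdge}
    (he : ∀ v, Even (K.filter fun h => h.1 = v).card) (F : ℤ × ℤ → ℝ)
    (hF : ∀ v, F v * F v = 1) : ∏ h ∈ K, F h.1 = 1 := by
  rw [Finset.prod_comp F Prod.fst]
  refine Finset.prod_eq_one fun v _ => ?_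
  obtain ⟨k, hk⟩ := he v
  rw [hk, pow_add, ← mul_pow, hF, one_pow]

/-- In the lattice, the sign of an even subgraph is `1`. -/
theorem listSign_even_subgraph {K : Finset HalfEdge} (hK : ∀ h ∈ K, opp h ∈ K)
    (he : ∀ v, Even (K.filter fun h => h.1 = v).card) :
    listSign (flatPairs ((K.filter fun h => Primary h).toList.map fun h => (h, opp h))) = 1 := by
  set P := K.filter fun h => Primary h with hP
  have hprim : ∀ p ∈ P, Primary p := fun p hp => (Finset.mem_filter.1 hp).2
  rw [listSign_edges_eq (Finset.nodup_toList _) fun p hp => hprim p (Finset.mem_toList.1 hp)]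
  simp only [Finset.prod_map_toList]
  -- The quadrant signs of both ends of all edges form a product over half-edges of a sign of their
  -- vertex; even degrees make it one.
  have h1 : ∀ p ∈ P, ∏ q ∈ P, interlace p q = ∏ q ∈ P, columnSign p q := by
    intro p hp
    rw [Finset.prod_congr rfl fun q hq => interlace_eq (hprim p hp) (hprim q hq),
      Finset.prod_mul_distrib, hP, ← prod_opp_closed hK fun h => quadrantSign p h.1,
      prod_vertex_sign he (quadrantSign p), mul_one]
    intro v
    unfold quadrantSign
    split_ifs <;> norm_num
  rw [Finset.prod_congr rfl h1, ← Finset.prod_product']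
  -- The column sign is symmetric, so the two orderings of a pair of edges cancel, and on the
  -- diagonal it is one.
  refine Finset.prod_involution (fun pq _ => (pq.2, pq.1)) ?_ ?_ ?_ ?_
  · rintro ⟨p, q⟩ -
    have : columnSign q p = columnSign p q := by
      unfold columnSign
      congr 1
      rw [eq_iff_iff]
      constructor <;> rintro ⟨a, b, c, d⟩ <;> exact ⟨Ne.symm a, c, b, d.symm⟩
    dsimp only
    rw [this]
    unfold columnSign
    split_ifs <;> norm_num
  · rintro ⟨p, q⟩ - h1 h2
    apply h1
    obtain rfl : q = p := (Prod.mk.inj h2).1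
    simp [columnSign]
  · rintro ⟨p, q⟩ h
    simpa [and_comm] using h
  · rintro ⟨p, q⟩ _
    rfl

/-! ### Positivity of the partition function by the high-temperature expansion. -/

namespace DiscreteDomain

variable {Ω : DiscreteDomain}

/-- The partition function without sources is positive. -/
theorem partition_nil_pos {c : HalfEdge → ℝ} (hc : ∀ g ∈ Ω.E, |c g| < 1) :
    0 < Ω.partition c [] := by
  classical
  set Ep := Ω.E.filter fun h => Primary h with hEp
  set span : Finset HalfEdge → Finset HalfEdge := fun A => A ∪ A.image opp with hspan
  have hspanc : ∀ A, ∀ h ∈ span A, opp h ∈ span A := by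
    intro A h hh
    simp only [hspan, Finset.mem_union, Finset.mem_image] at hh ⊢
    rcases hh with hh | ⟨g, hg, rfl⟩
    · exact .inr ⟨h, hh, rfl⟩
    · rw [opp_opp]; exact .inl hg
  have hspanp : ∀ A ⊆ Ep, (span A).filter (fun h => Primary h) = A := by
    intro A hA
    ext h
    simp only [hspan, Finset.mem_filter, Finset.mem_union, Finset.mem_image]
    constructor
    · rintro ⟨hh | ⟨g, hg, rfl⟩, hp⟩
      · exact hh
      · exact absurd (Finset.mem_filter.1 (hA hg)).2 ((primary_opp g).1 hp)
    · exact fun hh => ⟨.inl hh, (Finset.mem_filter.1 (hA hh)).2⟩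
  have hspanE : ∀ A ⊆ Ep, ∀ h ∈ span A, h ∈ Ω.E := by
    intro A hA h hh
    simp only [hspan, Finset.mem_union, Finset.mem_image] at hh
    rcases hh with hh | ⟨g, hg, rfl⟩
    · exact (Finset.mem_filter.1 (hA hh)).1
    · exact Ω.opp_mem _ (Finset.mem_filter.1 (hA hg)).1
  have hedge : ∀ A ⊆ Ep, Ω.edgeSet (span A) = A := by
    intro A hA
    rw [← hspanp A hA]
    ext h
    rw [mem_edgeSet, Finset.mem_filter, hspanp A hA]
    exact ⟨fun hh => ⟨hh.1, hh.2.1⟩,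
      fun hh => ⟨hh.1, hh.2, hspanE A hA h hh.1, hspanc A h hh.1⟩⟩
  -- Without sources the configurations are even subgraphs, and `listSign_even_subgraph` removes all
  -- the signs.
  have hZ : Ω.partition c [] = ∑ A ∈ Ep.powerset.filter
      (fun A => ∀ v ∈ Ω.V, Even ((span A).filter fun h => h.1 = v).card), ∏ h ∈ A, c h := by
    symm
    refine Finset.sum_nbij' span Ω.edgeSet ?_ ?_ ?_ ?_ ?_
    · intro A hA
      rw [Finset.mem_filter, Finset.mem_powerset] at hA
      rw [Finset.mem_filter, mem_confGen]
      refine ⟨⟨fun h hh => mem_halfEdges.2 (Ω.vertex_mem h (hspanE A hA.1 h hh)), hA.2⟩, ?_⟩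
      rw [List.toFinset_nil, Finset.eq_empty_iff_forall_notMem]
      intro h hh
      rw [mem_ends] at hh
      exact hh.2 ⟨hspanE A hA.1 h hh.1, hspanc A h hh.1⟩
    · intro S hS
      rw [Finset.mem_filter, mem_confGen] at hS
      have hcl : ∀ h ∈ S, h ∈ Ω.E ∧ opp h ∈ S := by
        intro h hh
        by_contra hn
        have : h ∈ Ω.ends S := mem_ends.2 ⟨hh, hn⟩
        rw [hS.2] at this
        simp at this
      have hsp : span (Ω.edgeSet S) = S := by
        ext h
        simp only [hspan, Finset.mem_union, Finset.mem_image, mem_edgeSet]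
        constructor
        · rintro (hh | ⟨g, hg, rfl⟩)
          · exact hh.1
          · exact hg.2.2.2
        · intro hh
          obtain ⟨h1, h2⟩ := hcl h hh
          by_cases hp : Primary h
          · exact .inl ⟨hh, hp, h1, h2⟩
          · exact .inr ⟨opp h, ⟨h2, (primary_opp h).2 hp, Ω.opp_mem _ h1, by rwa [opp_opp]⟩,
              opp_opp h⟩
      rw [Finset.mem_filter, Finset.mem_powerset, hsp]
      refine ⟨fun h hh => ?_, hS.1.2⟩
      rw [mem_edgeSet] at hh
      exact Finset.mem_filter.2 ⟨hh.2.2.1, hh.2.1⟩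
    · intro A hA
      exact hedge A (Finset.mem_powerset.1 (Finset.mem_filter.1 hA).1)
    · intro S hS
      rw [Finset.mem_filter, mem_confGen] at hS
      ext h
      simp only [hspan, Finset.mem_union, Finset.mem_image, mem_edgeSet]
      constructor
      · rintro (hh | ⟨g, hg, rfl⟩)
        · exact hh.1
        · exact hg.2.2.2
      · intro hh
        obtain ⟨h1, h2⟩ : h ∈ Ω.E ∧ opp h ∈ S := by
          by_contra hn
          have : h ∈ Ω.ends S := mem_ends.2 ⟨hh, hn⟩
          rw [hS.2] at this
          simp at this
        by_cases hp : Primary h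
        · exact .inl ⟨hh, hp, h1, h2⟩
        · exact .inr ⟨opp h, ⟨h2, (primary_opp h).2 hp, Ω.opp_mem _ h1, by rwa [opp_opp]⟩,
            opp_opp h⟩
    · intro A hA
      rw [Finset.mem_filter, Finset.mem_powerset] at hA
      have hev : ∀ v, Even ((span A).filter fun h => h.1 = v).card := by
        intro v
        by_cases hv : v ∈ Ω.V
        · exact hA.2 v hv
        · rw [Finset.filter_eq_empty_iff.2]
          · simp
          · rintro h hh rfl
            exact hv (Ω.vertex_mem h (hspanE A hA.1 h hh))
      have := listSign_even_subgraph (hspanc A) hev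
      rw [hspanp A hA.1] at this
      rw [weight, edgeFlat, edgePairs, hedge A hA.1, List.nil_append, this, one_mul]
  -- An Ising partition function, with `U` the set of minus spins: every factor 1 ± c is positive,
  -- even where c is negative.
  have hpos : 0 < ∑ U ∈ Ω.V.powerset, ∏ h ∈ Ep,
      (c h * ((if h.1 ∈ U then -1 else 1) * if (opp h).1 ∈ U then -1 else 1) + 1) := by
    refine Finset.sum_pos (fun U _ => Finset.prod_pos fun h hh => ?_)
      ⟨∅, Finset.empty_mem_powerset _⟩
    have := abs_lt.1 (hc h (Finset.mem_filter.1 hh).1)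
    split_ifs <;> linarith
  -- Expanding the product over edges and summing over spins: a set of edges with a vertex of odd
  -- degree contributes zero, an even one contributes `2 ^ Ω.V.card` times its weight.
  have hexp : ∑ U ∈ Ω.V.powerset, ∏ h ∈ Ep,
      (c h * ((if h.1 ∈ U then -1 else 1) * if (opp h).1 ∈ U then -1 else 1) + 1) =
      2 ^ Ω.V.card * Ω.partition c [] := by
    simp only [Finset.prod_add_one]
    rw [Finset.sum_comm, hZ, Finset.sum_filter, Finset.mul_sum]
    refine Finset.sum_congr rfl fun A hA => ?_
    rw [Finset.mem_powerset] at hA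
    have h1 : ∀ U ∈ Ω.V.powerset, ∏ h ∈ A,
        (c h * ((if h.1 ∈ U then -1 else 1) * if (opp h).1 ∈ U then -1 else 1)) =
        (∏ h ∈ A, c h) * ∏ v ∈ U, (-1) ^ ((span A).filter fun h => h.1 = v).card := by
      intro U hU
      rw [Finset.prod_mul_distrib]
      congr 1
      have := prod_opp_closed (hspanc A) fun h => if h.1 ∈ U then -1 else 1
      rw [hspanp A hA] at this
      rw [← this, ← Finset.prod_filter, Finset.prod_const,
        Finset.card_eq_sum_card_fiberwise (f := Prod.fst) (t := U), ← Finset.prod_pow_eq_pow_sum]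
      · refine Finset.prod_congr rfl fun v hv => ?_
        congr 2
        ext h
        simp only [Finset.mem_filter]
        constructor
        · rintro ⟨⟨a, -⟩, b⟩; exact ⟨a, b⟩
        · rintro ⟨a, b⟩; exact ⟨⟨a, b ▸ hv⟩, b⟩
      · intro h hh
        exact (Finset.mem_filter.1 hh).2
    rw [Finset.sum_congr rfl h1, ← Finset.mul_sum, ← Finset.prod_add_one]
    split_ifs with hev
    · have h2 : ∏ v ∈ Ω.V, ((-1 : ℝ) ^ ((span A).filter fun h => h.1 = v).card + 1) =
          2 ^ Ω.V.card := by
        rw [← Finset.prod_const]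
        refine Finset.prod_congr rfl fun v hv => ?_
        rw [(hev v hv).neg_one_pow]
        norm_num
      rw [h2, mul_comm]
    · push Not at hev
      obtain ⟨v, hv, hodd⟩ := hev
      rw [Finset.prod_eq_zero hv, mul_zero, mul_zero]
      rw [(Nat.not_even_iff_odd.1 hodd).neg_one_pow]
      ring
  rw [hexp] at hpos
  exact (mul_pos_iff_of_pos_left (by positivity)).1 hpos

end DiscreteDomain
end Ising
end

/-! ### Geometric half: signs of superposed matchings, windings and sheets. -/

noncomputable section

namespace Ising

/-! ### Superpositions of two perfect matchings -/

/-- `m` restricts to a perfect matching of `S`. -/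
structure PairedBy (m : HalfEdge → HalfEdge) (S : Finset HalfEdge) : Prop where
  mem : ∀ h ∈ S, m h ∈ S
  ne : ∀ h ∈ S, m h ≠ h
  inv : ∀ h ∈ S, m (m h) = h

/-- The chords of the matching `m` of `S` do not cross. -/
def NonCrossing (m : HalfEdge → HalfEdge) (S : Finset HalfEdge) : Prop :=
  ∀ a ∈ S, ∀ b ∈ S, b ≠ a → b ≠ m a →
    orient a b * orient a (m b) * (orient (m a) b * orient (m a) (m b)) = 1

/-- The sign of a list of chords, decorated by an orientation of chords. -/
def chordSign (B : HalfEdge → ℝ) (P : List (HalfEdge × HalfEdge)) : ℝ :=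
  listSign (flatPairs P) * (P.map fun p => B p.1).prod

lemma chordSign_perm (B : HalfEdge → ℝ) {P Q : List (HalfEdge × HalfEdge)} (h : P.Perm Q) :
    chordSign B P = chordSign B Q := by
  rw [chordSign, chordSign, listSign_flatPairs_perm h, (h.map _).prod_eq]

lemma chordSign_cons (B : HalfEdge → ℝ) (p : HalfEdge × HalfEdge)
    (P : List (HalfEdge × HalfEdge)) : chordSign B (p :: P) =
      orient p.1 p.2 * B p.1 * crossSign [p.1, p.2] (flatPairs P) * chordSign B P := by
  have := listSign_append [p.1, p.2] (flatPairs P)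
  simp only [List.cons_append, List.nil_append] at this
  rw [chordSign, chordSign, flatPairs_cons, this, List.map_cons, List.prod_cons]
  simp only [listSign, List.map_cons, List.map_nil, List.prod_cons, List.prod_nil]
  ring

lemma chordSign_append (B : HalfEdge → ℝ) (P Q : List (HalfEdge × HalfEdge)) :
    chordSign B (P ++ Q) =
      chordSign B P * chordSign B Q * crossSign (flatPairs P) (flatPairs Q) := by
  rw [chordSign, chordSign, chordSign, flatPairs_append, listSign_append, List.map_append,
    List.prod_append]
  ring

/-- The sign of a matching does not depend on the order and on the orientation of the chords. -/
lemma chordSign_eq_of_perm {m : HalfEdge → HalfEdge} {B : HalfEdge → ℝ} :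
    ∀ {P Q : List (HalfEdge × HalfEdge)}, (∀ p ∈ P, p.2 = m p.1) → (∀ p ∈ Q, p.2 = m p.1) →
      (∀ h ∈ flatPairs P, m (m h) = h ∧ B (m h) = -B h) →
      (flatPairs P).Perm (flatPairs Q) → chordSign B P = chordSign B Q := by
  intro P
  induction P with
  | nil =>
    intro Q _ _ _ hperm
    cases Q with
    | nil => rfl
    | cons q Q => simp [flatPairs] at hperm
  | cons p P ih =>
    intro Q hP hQ hB hperm
    have hp : p.1 ∈ flatPairs Q := hperm.subset (by simp [flatPairs_cons])
    simp only [flatPairs, List.mem_flatMap, List.mem_cons, List.not_mem_nil, or_false] at hp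
    obtain ⟨q, hq, hpq⟩ := hp
    obtain ⟨Q1, Q2, rfl⟩ := List.append_of_mem hq
    rw [chordSign_perm B (List.perm_middle (a := q) (l₁ := Q1) (l₂ := Q2))]
    have hperm2 := hperm.trans (flatPairs_perm (List.perm_middle (a := q) (l₁ := Q1) (l₂ := Q2)))
    have hpp := hP p (by simp)
    have hqq := hQ q (by simp)
    have hB1 := hB p.1 (by simp [flatPairs_cons])
    have hrec : ∀ (hc : [q.1, q.2].Perm [p.1, p.2]),
        (flatPairs P).Perm (flatPairs (Q1 ++ Q2)) := by
      intro hc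
      rw [flatPairs_cons, flatPairs_cons] at hperm2
      have : ([p.1, p.2] ++ flatPairs P).Perm ([p.1, p.2] ++ flatPairs (Q1 ++ Q2)) :=
        hperm2.trans (hc.append_right _)
      exact (List.perm_append_left_iff _).1 this
    have hfin : ∀ (hc : [q.1, q.2].Perm [p.1, p.2]),
        orient p.1 p.2 * B p.1 = orient q.1 q.2 * B q.1 →
        chordSign B (p :: P) = chordSign B (q :: (Q1 ++ Q2)) := by
      intro hc he
      have h1 := ih (fun x hx => hP x (by simp [hx]))
        (fun x hx => hQ x (by rw [List.mem_append] at hx; simp; tauto))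
        (fun h hh => hB h (by simp [flatPairs_cons, hh])) (hrec hc)
      rw [chordSign_cons, chordSign_cons, he, h1, crossSign_perm hc.symm (hrec hc)]
    rcases hpq with h1 | h1
    · have h2 : q.2 = p.2 := by rw [hqq, hpp, h1]
      exact hfin (by rw [h1, h2]) (by rw [h1, h2])
    -- The second list runs through the chord backwards; the comparison of its ends and `B` both
    -- change sign.
    · have h2 : q.1 = p.2 := by
        have : p.1 = m q.1 := by rw [h1, hqq]
        have hmem : q.1 ∈ flatPairs (p :: P) := hperm2.symm.subset (by simp [flatPairs_cons])
        rw [hpp, this, (hB q.1 hmem).1]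
      refine hfin (by rw [← h1, h2]; exact List.Perm.swap _ _ _) ?_
      rw [← h1, h2, orient_swap p.2 p.1, hpp, hB1.2]
      ring

/-- A list of the chords of the matching `m` of `U`. -/
def chordList (m : HalfEdge → HalfEdge) (U : Finset HalfEdge) : List (HalfEdge × HalfEdge) :=
  (U.filter fun h => key h < key (m h)).toList.map fun h => (h, m h)

lemma chordList_snd (m : HalfEdge → HalfEdge) (U : Finset HalfEdge) :
    ∀ p ∈ chordList m U, p.2 = m p.1 := by
  intro p hp
  obtain ⟨h, -, rfl⟩ := List.mem_map.1 hp
  rfl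

lemma chordList_perm {m : HalfEdge → HalfEdge} {U : Finset HalfEdge} (hU : PairedBy m U) :
    (flatPairs (chordList m U)).Perm U.toList := by
  refine (List.perm_ext_iff_of_nodup ?_ (Finset.nodup_toList _)).2 fun h => ?_
  · simp only [flatPairs, chordList, List.flatMap_map]
    rw [List.nodup_flatMap]
    refine ⟨fun h hh => ?_, ?_⟩
    · have := (Finset.mem_filter.1 (Finset.mem_toList.1 hh)).1
      simp [(hU.ne h this).symm]
    refine (Finset.nodup_toList _).pairwise_of_forall_ne fun g hg h hh hne => ?_
    rw [Finset.mem_toList, Finset.mem_filter] at hg hh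
    simp only [Function.onFun, List.disjoint_cons_left, List.mem_cons, List.not_mem_nil, or_false,
      not_or, List.disjoint_nil_left, and_true]
    refine ⟨⟨hne, ?_⟩, ?_, fun e => hne ?_⟩
    · rintro rfl
      rw [hU.inv h hh.1] at hg
      exact lt_asymm hg.2 hh.2
    · rintro rfl
      rw [hU.inv g hg.1] at hh
      exact lt_asymm hg.2 hh.2
    · rw [← hU.inv g hg.1, e, hU.inv h hh.1]
  · simp only [flatPairs, chordList, List.flatMap_map, List.mem_flatMap, Finset.mem_toList,
      Finset.mem_filter, List.mem_cons, List.not_mem_nil, or_false]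
    constructor
    · rintro ⟨g, hg, rfl | rfl⟩
      · exact hg.1
      · exact hU.mem _ hg.1
    · intro hh
      rcases lt_trichotomy (key h) (key (m h)) with hl | hl | hl
      · exact ⟨h, ⟨hh, hl⟩, .inl rfl⟩
      · exact absurd (key_injective hl).symm (hU.ne h hh)
      · exact ⟨m h, ⟨hU.mem h hh, by rwa [hU.inv h hh]⟩, .inr (hU.inv h hh).symm⟩

/-- The sign of the matching `m` of `U`, decorated by an orientation of chords. -/
def matchSign (m : HalfEdge → HalfEdge) (B : HalfEdge → ℝ) (U : Finset HalfEdge) : ℝ :=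
  chordSign B (chordList m U)

/-- `matchSign` may be computed from any convenient listing: chords in the order in which a loop
passes them, or in the order of sources and edges. -/
lemma chordSign_eq_matchSign {m : HalfEdge → HalfEdge} {B : HalfEdge → ℝ} {U : Finset HalfEdge}
    (hU : PairedBy m U) (hB : ∀ h ∈ U, B (m h) = -B h) {P : List (HalfEdge × HalfEdge)}
    (hP : ∀ p ∈ P, p.2 = m p.1) (hperm : (flatPairs P).Perm U.toList) :
    chordSign B P = matchSign m B U := by
  refine chordSign_eq_of_perm hP (chordList_snd m U) (fun h hh => ?_)
    (hperm.trans (chordList_perm hU).symm)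
  have : h ∈ U := Finset.mem_toList.1 (hperm.subset hh)
  exact ⟨hU.inv h this, hB h this⟩

lemma crossSign_toList (U W : Finset HalfEdge) :
    crossSign U.toList W.toList = ∏ a ∈ U, ∏ b ∈ W, orient a b := by
  simp only [crossSign, Finset.prod_map_toList]

lemma prod_eq_one_of_paired {m : HalfEdge → HalfEdge} {U : Finset HalfEdge} (hU : PairedBy m U)
    {F : HalfEdge → ℝ} (hF : ∀ h ∈ U, F h * F (m h) = 1) : ∏ h ∈ U, F h = 1 :=
  Finset.prod_involution (fun h _ => m h) hF (fun h hh _ => hU.ne h hh) (fun h hh => hU.mem h hh)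
    fun h hh => hU.inv h hh

/-- The chords of `m₂` may well cross. But the cross sign depends only on the sets `U` and `W`, and
when their elements are grouped into chords of `m₁`, which do not cross, it is one. -/
lemma matchSign_union {m₁ m₂ : HalfEdge → HalfEdge} {B : HalfEdge → ℝ} {S U W : Finset HalfEdge}
    (hnc : NonCrossing m₁ S) (hUS : U ⊆ S) (hWS : W ⊆ S)
    (hU₁ : PairedBy m₁ U) (hU₂ : PairedBy m₂ U) (hW₁ : PairedBy m₁ W) (hW₂ : PairedBy m₂ W)
    (hB : ∀ h ∈ S, B (m₂ h) = -B h) (hd : Disjoint U W) :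
    matchSign m₂ B (U ∪ W) = matchSign m₂ B U * matchSign m₂ B W := by
  have hUW : PairedBy m₂ (U ∪ W) := by
    refine ⟨fun h hh => ?_, fun h hh => ?_, fun h hh => ?_⟩ <;> rw [Finset.mem_union] at hh
    · rw [Finset.mem_union]
      exact hh.imp (hU₂.mem h) (hW₂.mem h)
    · exact hh.elim (hU₂.ne h) (hW₂.ne h)
    · exact hh.elim (hU₂.inv h) (hW₂.inv h)
  have h1 := chordSign_eq_matchSign (B := B) hUW
    (fun h hh => hB h (Finset.union_subset hUS hWS hh))
    (P := chordList m₂ U ++ chordList m₂ W)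
    (fun p hp => (List.mem_append.1 hp).elim (chordList_snd m₂ U p) (chordList_snd m₂ W p)) (by
      rw [flatPairs_append]
      refine ((chordList_perm hU₂).append (chordList_perm hW₂)).trans ?_
      refine (List.perm_ext_iff_of_nodup ?_ (Finset.nodup_toList _)).2 fun h => by simp
      refine List.Nodup.append (Finset.nodup_toList _) (Finset.nodup_toList _) fun h h1 h2 => ?_
      exact Finset.disjoint_left.1 hd (Finset.mem_toList.1 h1) (Finset.mem_toList.1 h2))
  have h2 : crossSign (flatPairs (chordList m₂ U)) (flatPairs (chordList m₂ W)) = 1 := by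
    rw [crossSign_perm (chordList_perm hU₂) (chordList_perm hW₂), crossSign_toList]
    refine prod_eq_one_of_paired hU₁ fun a ha => ?_
    rw [← Finset.prod_mul_distrib]
    refine prod_eq_one_of_paired hW₁ fun b hb => ?_
    have := hnc a (hUS ha) b (hWS hb) (fun e => Finset.disjoint_left.1 hd ha (e ▸ hb))
      (fun e => Finset.disjoint_left.1 hd (hU₁.mem a ha) (e ▸ hb))
    linear_combination this
  rw [← h1, chordSign_append, h2, mul_one, matchSign, matchSign]

/-! ### Loops in the superposition of two matchings. -/

section Orbits

variable (m₁ m₂ : HalfEdge → HalfEdge)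

/-- The half-edges passed in `p` double steps from `h`. -/
def steps : ℕ → HalfEdge → List HalfEdge
  | 0, _ => []
  | p + 1, h => h :: m₁ h :: steps p (m₂ (m₁ h))

/-- The `m₂`-chords passed in `p` double steps from `h`. -/
def stepChords : ℕ → HalfEdge → List (HalfEdge × HalfEdge)
  | 0, _ => []
  | p + 1, h => (m₁ h, m₂ (m₁ h)) :: stepChords p (m₂ (m₁ h))

/-- A double step. -/
def dstep (h : HalfEdge) : HalfEdge := m₂ (m₁ h)

/-- The half-edges of the loop through `h` in the superposition of two matchings. -/
def loopSet (h : HalfEdge) : Finset HalfEdge :=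
  (steps m₁ m₂ (Function.minimalPeriod (dstep m₁ m₂) h) h).toFinset

variable {m₁ m₂}

lemma steps_succ (p : ℕ) (h : HalfEdge) :
    steps m₁ m₂ (p + 1) h = h :: m₁ h :: steps m₁ m₂ p (dstep m₁ m₂ h) := rfl

lemma mem_steps {p : ℕ} {h g : HalfEdge} : g ∈ steps m₁ m₂ p h ↔
    ∃ i < p, g = (dstep m₁ m₂)^[i] h ∨ g = m₁ ((dstep m₁ m₂)^[i] h) := by
  induction p generalizing h with
  | zero => simp [steps]
  | succ p ih =>
    rw [steps_succ, List.mem_cons, List.mem_cons, ih]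
    constructor
    · rintro (rfl | rfl | ⟨i, hi, hg⟩)
      · exact ⟨0, by omega, .inl rfl⟩
      · exact ⟨0, by omega, .inr rfl⟩
      · exact ⟨i + 1, by omega, hg⟩
    · rintro ⟨i, hi, hg⟩
      cases i with
      | zero => exact hg.elim .inl fun e => .inr (.inl e)
      | succ i => exact .inr (.inr ⟨i, by omega, hg⟩)

/-- The sequence of half-edges along a loop reads as `m₁`-chords from its first entry and as
`m₂`-chords from its second, so the two lists differ by a shift. -/
lemma cons_stepChords (p : ℕ) (h : HalfEdge) : h :: flatPairs (stepChords m₁ m₂ p h) =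
    steps m₁ m₂ p h ++ [(dstep m₁ m₂)^[p] h] := by
  induction p generalizing h with
  | zero => rfl
  | succ p ih =>
    rw [stepChords, flatPairs_cons, steps_succ]
    change h :: m₁ h :: dstep m₁ m₂ h :: flatPairs (stepChords m₁ m₂ p (dstep m₁ m₂ h)) = _
    rw [ih]
    rfl

lemma stepChords_snd (p : ℕ) (h : HalfEdge) :
    ∀ c ∈ stepChords m₁ m₂ p h, c.2 = m₂ c.1 := by
  induction p generalizing h with
  | zero => simp [stepChords]
  | succ p ih =>
    intro c hc
    rcases List.mem_cons.1 hc with rfl | hc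
    · rfl
    · exact ih _ c hc

lemma stepChords_prod (B : HalfEdge → ℝ) (p : ℕ) (h : HalfEdge) :
    ((stepChords m₁ m₂ p h).map fun c => B c.1).prod =
      ∏ i ∈ Finset.range p, B (m₁ ((dstep m₁ m₂)^[i] h)) := by
  induction p generalizing h with
  | zero => rfl
  | succ p ih =>
    rw [Finset.prod_range_succ', stepChords, List.map_cons, List.prod_cons]
    change _ * (((stepChords m₁ m₂ p (dstep m₁ m₂ h)).map fun c => B c.1).prod) = _
    rw [ih, mul_comm]
    rfl

lemma length_steps (p : ℕ) (h : HalfEdge) : (steps m₁ m₂ p h).length = 2 * p := by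
  induction p generalizing h with
  | zero => rfl
  | succ p ih => rw [steps_succ, List.length_cons, List.length_cons, ih]; ring

lemma dstep_mem {S : Finset HalfEdge} (h₁ : PairedBy m₁ S) (h₂ : PairedBy m₂ S) {h : HalfEdge}
    (hh : h ∈ S) : dstep m₁ m₂ h ∈ S := h₂.mem _ (h₁.mem _ hh)

lemma iterate_mem {S : Finset HalfEdge} (h₁ : PairedBy m₁ S) (h₂ : PairedBy m₂ S) {h : HalfEdge}
    (hh : h ∈ S) (i : ℕ) : (dstep m₁ m₂)^[i] h ∈ S := by
  induction i generalizing h with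
  | zero => exact hh
  | succ i ih => exact ih (dstep_mem h₁ h₂ hh)

lemma dstep_injOn {S : Finset HalfEdge} (h₁ : PairedBy m₁ S) (h₂ : PairedBy m₂ S)
    {g h : HalfEdge} (hg : g ∈ S) (hh : h ∈ S) (e : dstep m₁ m₂ g = dstep m₁ m₂ h) : g = h := by
  unfold dstep at e
  rw [← h₁.inv g hg, ← h₂.inv _ (h₁.mem g hg), e, h₂.inv _ (h₁.mem h hh), h₁.inv h hh]

lemma iterate_injOn {S : Finset HalfEdge} (h₁ : PairedBy m₁ S) (h₂ : PairedBy m₂ S)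
    {g h : HalfEdge} (hg : g ∈ S) (hh : h ∈ S) (i : ℕ)
    (e : (dstep m₁ m₂)^[i] g = (dstep m₁ m₂)^[i] h) : g = h := by
  induction i generalizing g h with
  | zero => exact e
  | succ i ih => exact dstep_injOn h₁ h₂ hg hh (ih (dstep_mem h₁ h₂ hg) (dstep_mem h₁ h₂ hh) e)

lemma minimalPeriod_pos_of_mem {S : Finset HalfEdge} (h₁ : PairedBy m₁ S) (h₂ : PairedBy m₂ S)
    {h : HalfEdge} (hh : h ∈ S) : 0 < Function.minimalPeriod (dstep m₁ m₂) h := by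
  obtain ⟨i, j, hij, e⟩ := Set.Finite.exists_lt_map_eq_of_forall_mem
    (t := (S : Set HalfEdge)) (f := fun i : ℕ => (dstep m₁ m₂)^[i] h)
    (fun i => iterate_mem h₁ h₂ hh i) S.finite_toSet
  obtain ⟨k, rfl⟩ := Nat.exists_eq_add_of_lt hij
  refine Function.minimalPeriod_pos_of_mem_periodicPts ⟨k + 1, by omega, ?_⟩
  have : (dstep m₁ m₂)^[i] h = (dstep m₁ m₂)^[i] ((dstep m₁ m₂)^[k + 1] h) := by
    rw [← Function.iterate_add_apply]
    exact e
  exact (iterate_injOn h₁ h₂ hh (iterate_mem h₁ h₂ hh _) i this).symm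

/-- If an alternating walk from `x` came back in the opposite direction, removing a double step at
each end would leave a shorter such walk, and finally a fixed point of one of the matchings. Hence
loops are never run in both directions. -/
lemma iterate_ne_partner {S : Finset HalfEdge} (h₁ : PairedBy m₁ S) (h₂ : PairedBy m₂ S) (n : ℕ) :
    ∀ x ∈ S, (dstep m₁ m₂)^[n] x ≠ m₁ x := by
  induction n using Nat.strong_induction_on with
  | _ n ih =>
    intro x hx e
    match n with
    | 0 => exact h₁.ne x hx e.symm
    | 1 => exact h₂.ne _ (h₁.mem x hx) e
    | n + 2 =>
      set y := dstep m₁ m₂ x with hy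
      have hyS : y ∈ S := dstep_mem h₁ h₂ hx
      have hz := iterate_mem h₁ h₂ hyS n
      have e1 : m₂ (m₁ ((dstep m₁ m₂)^[n] y)) = m₁ x := by
        rw [← e, Function.iterate_succ_apply, Function.iterate_succ_apply']
        rfl
      have e2 : m₁ ((dstep m₁ m₂)^[n] y) = y := by
        rw [← h₂.inv _ (h₁.mem _ hz), e1]; rfl
      refine ih n (by omega) y hyS ?_
      rw [← e2, h₁.inv _ hz, e2]

lemma iterate_ne_partner_iterate {S : Finset HalfEdge} (h₁ : PairedBy m₁ S) (h₂ : PairedBy m₂ S)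
    {h : HalfEdge} (hh : h ∈ S) (i j : ℕ) :
    (dstep m₁ m₂)^[i] h ≠ m₁ ((dstep m₁ m₂)^[j] h) := by
  intro e
  rcases le_total j i with hij | hij
  · obtain ⟨k, rfl⟩ := Nat.exists_eq_add_of_le' hij
    rw [Function.iterate_add_apply] at e
    exact iterate_ne_partner h₁ h₂ k _ (iterate_mem h₁ h₂ hh j) e
  · obtain ⟨k, rfl⟩ := Nat.exists_eq_add_of_le' hij
    have e' : (dstep m₁ m₂)^[k + i] h = m₁ ((dstep m₁ m₂)^[i] h) := by
      rw [e, h₁.inv _ (iterate_mem h₁ h₂ hh _)]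
    rw [Function.iterate_add_apply] at e'
    exact iterate_ne_partner h₁ h₂ k _ (iterate_mem h₁ h₂ hh i) e'

lemma nodup_steps {S : Finset HalfEdge} (h₁ : PairedBy m₁ S) (h₂ : PairedBy m₂ S) {p : ℕ}
    {h : HalfEdge} (hh : h ∈ S)
    (hp : ∀ i < p, ∀ j < p, (dstep m₁ m₂)^[i] h = (dstep m₁ m₂)^[j] h → i = j) :
    (steps m₁ m₂ p h).Nodup := by
  induction p generalizing h with
  | zero => exact List.nodup_nil
  | succ p ih =>
    rw [steps_succ, List.nodup_cons, List.nodup_cons, List.mem_cons]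
    refine ⟨?_, ?_, ih (dstep_mem h₁ h₂ hh) fun i hi j hj e => by
      have := hp (i + 1) (by omega) (j + 1) (by omega) e
      omega⟩
    · rintro (e | e)
      · exact h₁.ne h hh e.symm
      · obtain ⟨i, hi, e | e⟩ := mem_steps.1 e
        · have := hp 0 (by omega) (i + 1) (by omega) e
          omega
        · exact iterate_ne_partner_iterate h₁ h₂ hh 0 (i + 1) e
    · intro e
      obtain ⟨i, hi, e | e⟩ := mem_steps.1 e
      · exact iterate_ne_partner_iterate h₁ h₂ hh (i + 1) 0 e.symm
      · have e' : h = (dstep m₁ m₂)^[i + 1] h := by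
          have := congrArg m₁ e
          rwa [h₁.inv h hh, h₁.inv _ (iterate_mem h₁ h₂ (dstep_mem h₁ h₂ hh) i)] at this
        have := hp 0 (by omega) (i + 1) (by omega) e'
        omega

lemma nodup_steps_minimalPeriod {S : Finset HalfEdge} (h₁ : PairedBy m₁ S) (h₂ : PairedBy m₂ S)
    {h : HalfEdge} (hh : h ∈ S) :
    (steps m₁ m₂ (Function.minimalPeriod (dstep m₁ m₂) h) h).Nodup :=
  nodup_steps h₁ h₂ hh fun _ hi _ hj e =>
    Function.iterate_injOn_Iio_minimalPeriod (Set.mem_Iio.2 hi) (Set.mem_Iio.2 hj) e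

lemma mem_loopSet {h g : HalfEdge} : g ∈ loopSet m₁ m₂ h ↔
    ∃ i < Function.minimalPeriod (dstep m₁ m₂) h,
      g = (dstep m₁ m₂)^[i] h ∨ g = m₁ ((dstep m₁ m₂)^[i] h) := by
  rw [loopSet, List.mem_toFinset, mem_steps]

lemma self_mem_loopSet {S : Finset HalfEdge} (h₁ : PairedBy m₁ S) (h₂ : PairedBy m₂ S)
    {h : HalfEdge} (hh : h ∈ S) : h ∈ loopSet m₁ m₂ h :=
  mem_loopSet.2 ⟨0, minimalPeriod_pos_of_mem h₁ h₂ hh, .inl rfl⟩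

lemma loopSet_subset {S : Finset HalfEdge} (h₁ : PairedBy m₁ S) (h₂ : PairedBy m₂ S)
    {h : HalfEdge} (hh : h ∈ S) : loopSet m₁ m₂ h ⊆ S := by
  intro g hg
  obtain ⟨i, -, rfl | rfl⟩ := mem_loopSet.1 hg
  · exact iterate_mem h₁ h₂ hh i
  · exact h₁.mem _ (iterate_mem h₁ h₂ hh i)

lemma iterate_mem_loopSet {S : Finset HalfEdge} (h₁ : PairedBy m₁ S) (h₂ : PairedBy m₂ S)
    {h : HalfEdge} (hh : h ∈ S) (i : ℕ) : (dstep m₁ m₂)^[i] h ∈ loopSet m₁ m₂ h := by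
  rw [← Function.iterate_mod_minimalPeriod_eq]
  exact mem_loopSet.2 ⟨_, Nat.mod_lt _ (minimalPeriod_pos_of_mem h₁ h₂ hh), .inl rfl⟩

lemma PairedBy.mono {m : HalfEdge → HalfEdge} {S U : Finset HalfEdge} (h : PairedBy m S)
    (hU : U ⊆ S) (hm : ∀ g ∈ U, m g ∈ U) : PairedBy m U :=
  ⟨hm, fun g hg => h.ne g (hU hg), fun g hg => h.inv g (hU hg)⟩

lemma loopSet_paired_fst {S : Finset HalfEdge} (h₁ : PairedBy m₁ S) (h₂ : PairedBy m₂ S)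
    {h : HalfEdge} (hh : h ∈ S) : PairedBy m₁ (loopSet m₁ m₂ h) := by
  refine h₁.mono (loopSet_subset h₁ h₂ hh) fun g hg => ?_
  obtain ⟨i, hi, rfl | rfl⟩ := mem_loopSet.1 hg
  · exact mem_loopSet.2 ⟨i, hi, .inr rfl⟩
  · rw [h₁.inv _ (iterate_mem h₁ h₂ hh i)]
    exact mem_loopSet.2 ⟨i, hi, .inl rfl⟩

lemma loopSet_paired_snd {S : Finset HalfEdge} (h₁ : PairedBy m₁ S) (h₂ : PairedBy m₂ S)
    {h : HalfEdge} (hh : h ∈ S) : PairedBy m₂ (loopSet m₁ m₂ h) := by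
  refine h₂.mono (loopSet_subset h₁ h₂ hh) fun g hg => ?_
  have hp := minimalPeriod_pos_of_mem h₁ h₂ hh
  have main : ∀ i, m₂ ((dstep m₁ m₂)^[i + 1] h) ∈ loopSet m₁ m₂ h := by
    intro i
    have hi := iterate_mem h₁ h₂ hh i
    have : m₂ ((dstep m₁ m₂)^[i + 1] h) = m₁ ((dstep m₁ m₂)^[i] h) := by
      rw [Function.iterate_succ_apply']
      exact h₂.inv _ (h₁.mem _ hi)
    rw [this]
    exact (loopSet_paired_fst h₁ h₂ hh).mem _ (iterate_mem_loopSet h₁ h₂ hh i)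
  obtain ⟨i, hi, rfl | rfl⟩ := mem_loopSet.1 hg
  · cases i with
    | zero =>
      have := main (Function.minimalPeriod (dstep m₁ m₂) h - 1)
      rwa [Nat.sub_add_cancel hp, Function.iterate_minimalPeriod] at this
    | succ i => exact main i
  · have := iterate_mem_loopSet h₁ h₂ hh (i + 1)
    rwa [Function.iterate_succ_apply'] at this

lemma loopSet_eq_of_mem {S : Finset HalfEdge} (h₁ : PairedBy m₁ S) (h₂ : PairedBy m₂ S)
    {g h : HalfEdge} (hh : h ∈ S) (hg : g ∈ loopSet m₁ m₂ h) :
    loopSet m₁ m₂ g = loopSet m₁ m₂ h := by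
  have hgS := loopSet_subset h₁ h₂ hh hg
  refine subset_antisymm (loopSet_subset (loopSet_paired_fst h₁ h₂ hh)
    (loopSet_paired_snd h₁ h₂ hh) hg) ?_
  refine loopSet_subset (loopSet_paired_fst h₁ h₂ hgS) (loopSet_paired_snd h₁ h₂ hgS) ?_
  have hback : ∀ i < Function.minimalPeriod (dstep m₁ m₂) h, ∀ x ∈ S,
      (dstep m₁ m₂)^[i] h ∈ loopSet m₁ m₂ x → h ∈ loopSet m₁ m₂ x := by
    intro i hi x hx hm
    have := iterate_mem (loopSet_paired_fst h₁ h₂ hx) (loopSet_paired_snd h₁ h₂ hx) hm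
      (Function.minimalPeriod (dstep m₁ m₂) h - i)
    rwa [← Function.iterate_add_apply, Nat.sub_add_cancel hi.le,
      Function.iterate_minimalPeriod] at this
  obtain ⟨i, hi, rfl | rfl⟩ := mem_loopSet.1 hg
  · exact hback i hi _ hgS (self_mem_loopSet h₁ h₂ hgS)
  · refine hback i hi _ hgS ?_
    have := (loopSet_paired_fst h₁ h₂ hgS).mem _ (self_mem_loopSet h₁ h₂ hgS)
    rwa [h₁.inv _ (iterate_mem h₁ h₂ hh i)] at this

/-- The steps are listed as consecutive chords of `m₁`; since these do not cross, only the
comparison inside each chord survives. -/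
lemma listSign_steps {S : Finset HalfEdge} (hnc : NonCrossing m₁ S)
    {p : ℕ} {h : HalfEdge} (hmem : ∀ i < p, (dstep m₁ m₂)^[i] h ∈ S)
    (hnd : (steps m₁ m₂ p h).Nodup) : listSign (steps m₁ m₂ p h) =
      ∏ i ∈ Finset.range p, orient ((dstep m₁ m₂)^[i] h) (m₁ ((dstep m₁ m₂)^[i] h)) := by
  have hpair : ∀ (a : HalfEdge), a ∈ S → ∀ (p : ℕ) (h : HalfEdge),
      (∀ i < p, (dstep m₁ m₂)^[i] h ∈ S) → a ∉ steps m₁ m₂ p h → m₁ a ∉ steps m₁ m₂ p h →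
      ((steps m₁ m₂ p h).map (orient a)).prod * ((steps m₁ m₂ p h).map (orient (m₁ a))).prod =
        1 := by
    intro a ha p
    induction p with
    | zero => intro h _ _ _; simp [steps]
    | succ p ih =>
      intro h hS n1 n2
      rw [steps_succ, List.mem_cons, List.mem_cons, not_or, not_or] at n1 n2
      have e1 := ih (dstep m₁ m₂ h) (fun i hi => hS (i + 1) (by omega)) n1.2.2 n2.2.2
      have e2 := hnc a ha h (hS 0 (by omega)) (Ne.symm n1.1) (Ne.symm n2.1)
      rw [steps_succ]
      simp only [List.map_cons, List.prod_cons]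
      linear_combination (orient a h * orient a (m₁ h) *
        (orient (m₁ a) h * orient (m₁ a) (m₁ h))) * e1 + e2
  induction p generalizing h with
  | zero => rfl
  | succ p ih =>
    rw [steps_succ, List.nodup_cons, List.nodup_cons, List.mem_cons, not_or] at hnd
    have hm' : ∀ i < p, (dstep m₁ m₂)^[i] (dstep m₁ m₂ h) ∈ S := fun i hi =>
      hmem (i + 1) (by omega)
    have e1 := hpair h (hmem 0 (by omega)) p (dstep m₁ m₂ h) hm' hnd.1.2 hnd.2.1
    rw [Finset.prod_range_succ', steps_succ, listSign, listSign, ih hm' hnd.2.2, List.map_cons,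
      List.prod_cons]
    simp only [Function.iterate_succ_apply, Function.iterate_zero, id_eq]
    linear_combination (orient h (m₁ h) * ∏ i ∈ Finset.range p,
      orient ((dstep m₁ m₂)^[i] (dstep m₁ m₂ h))
        (m₁ ((dstep m₁ m₂)^[i] (dstep m₁ m₂ h)))) * e1

/-- The sign of a loop. -/
theorem matchSign_loopSet {S : Finset HalfEdge} {B : HalfEdge → ℝ} (hnc : NonCrossing m₁ S)
    (h₁ : PairedBy m₁ S) (h₂ : PairedBy m₂ S) (hB : ∀ h ∈ S, B (m₂ h) = -B h) {h : HalfEdge}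
    (hh : h ∈ S) : matchSign m₂ B (loopSet m₁ m₂ h) =
      -∏ i ∈ Finset.range (Function.minimalPeriod (dstep m₁ m₂) h),
        (orient ((dstep m₁ m₂)^[i] h) (m₁ ((dstep m₁ m₂)^[i] h)) *
          B (m₁ ((dstep m₁ m₂)^[i] h))) := by
  set p := Function.minimalPeriod (dstep m₁ m₂) h with hp
  have hpos : 0 < p := minimalPeriod_pos_of_mem h₁ h₂ hh
  have hper : (dstep m₁ m₂)^[p] h = h := Function.iterate_minimalPeriod
  have hnd : (steps m₁ m₂ p h).Nodup := nodup_steps_minimalPeriod h₁ h₂ hh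
  have hc := cons_stepChords (m₁ := m₁) (m₂ := m₂) p h
  rw [hper] at hc
  have hlen := length_steps (m₁ := m₁) (m₂ := m₂) p h
  obtain ⟨M, hM⟩ : ∃ M, steps m₁ m₂ p h = h :: M := by
    obtain ⟨q, hq⟩ := Nat.exists_eq_succ_of_ne_zero hpos.ne'
    exact ⟨_, by rw [hq]; rfl⟩
  have hMlen : M.length = 2 * (p - 1) + 1 := by
    rw [hM, List.length_cons] at hlen
    omega
  have hflat : flatPairs (stepChords m₁ m₂ p h) = M ++ [h] := by
    rw [hM, List.cons_append] at hc
    exact (List.cons.inj hc).2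
  -- Passing from `m₁`-chords to `m₂`-chords moves the first entry past the other 2p - 1, an odd
  -- number. This is the source of the minus sign of every loop.
  have hsgn : listSign (steps m₁ m₂ p h) = -listSign (flatPairs (stepChords m₁ m₂ p h)) := by
    have := listSign_move_cons h M []
    rw [List.append_nil] at this
    rw [hM, this, hflat, hMlen, pow_succ, pow_mul]
    norm_num
  have hperm : (flatPairs (stepChords m₁ m₂ p h)).Perm (loopSet m₁ m₂ h).toList := by
    rw [hflat]
    refine (List.perm_append_singleton h M).trans ?_
    rw [← hM]
    exact (List.toFinset_toList hnd).symm
  rw [← chordSign_eq_matchSign (loopSet_paired_snd h₁ h₂ hh)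
    (fun g hg => hB g (loopSet_subset h₁ h₂ hh hg)) (stepChords_snd p h) hperm, chordSign,
    stepChords_prod, Finset.prod_mul_distrib,
    ← listSign_steps hnc (fun i _ => iterate_mem h₁ h₂ hh i) hnd, hsgn]
  ring

/-- The sign of a matching is the product of the signs of the loops. -/
theorem prod_matchSign_loops {S : Finset HalfEdge} {B : HalfEdge → ℝ} (hnc : NonCrossing m₁ S)
    (hB : ∀ h ∈ S, B (m₂ h) = -B h) (U : Finset HalfEdge) (hUS : U ⊆ S) (h₁ : PairedBy m₁ U)
    (h₂ : PairedBy m₂ U) :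
    ∏ K ∈ U.image (loopSet m₁ m₂), matchSign m₂ B K = matchSign m₂ B U := by
  induction U using Finset.strongInduction with
  | H U ih =>
    rcases U.eq_empty_or_nonempty with rfl | ⟨h, hh⟩
    · simp [matchSign, chordList, chordSign, flatPairs, listSign]
    set K := loopSet m₁ m₂ h with hK
    have hKU : K ⊆ U := loopSet_subset h₁ h₂ hh
    have hhK : h ∈ K := self_mem_loopSet h₁ h₂ hh
    have hK₁ := loopSet_paired_fst h₁ h₂ hh
    have hK₂ := loopSet_paired_snd h₁ h₂ hh
    have hd₁ : PairedBy m₁ (U \ K) := h₁.mono Finset.sdiff_subset fun g hg => by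
      rw [Finset.mem_sdiff] at hg ⊢
      refine ⟨h₁.mem g hg.1, fun e => hg.2 ?_⟩
      rw [← h₁.inv g hg.1]
      exact hK₁.mem _ e
    have hd₂ : PairedBy m₂ (U \ K) := h₂.mono Finset.sdiff_subset fun g hg => by
      rw [Finset.mem_sdiff] at hg ⊢
      refine ⟨h₂.mem g hg.1, fun e => hg.2 ?_⟩
      rw [← h₂.inv g hg.1]
      exact hK₂.mem _ e
    have himg : U.image (loopSet m₁ m₂) = insert K ((U \ K).image (loopSet m₁ m₂)) := by
      ext L
      simp only [Finset.mem_image, Finset.mem_insert, Finset.mem_sdiff]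
      constructor
      · rintro ⟨g, hg, rfl⟩
        by_cases hgK : g ∈ K
        · exact .inl (loopSet_eq_of_mem h₁ h₂ hh hgK)
        · exact .inr ⟨g, ⟨hg, hgK⟩, rfl⟩
      · rintro (rfl | ⟨g, hg, rfl⟩)
        · exact ⟨h, hh, rfl⟩
        · exact ⟨g, hg.1, rfl⟩
    have hnot : K ∉ (U \ K).image (loopSet m₁ m₂) := by
      intro e
      obtain ⟨g, hg, e⟩ := Finset.mem_image.1 e
      have := self_mem_loopSet hd₁ hd₂ hg
      rw [e] at this
      exact (Finset.mem_sdiff.1 hg).2 this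
    have hss : U \ K ⊂ U := by
      refine Finset.ssubset_iff_subset_ne.2 ⟨Finset.sdiff_subset, fun e => ?_⟩
      rw [← e] at hh
      exact (Finset.mem_sdiff.1 hh).2 hhK
    rw [himg, Finset.prod_insert hnot, ih _ hss (Finset.sdiff_subset.trans hUS) hd₁ hd₂,
      ← matchSign_union hnc (hKU.trans hUS) (Finset.sdiff_subset.trans hUS) hK₁ hK₂ hd₁ hd₂ hB
        Finset.disjoint_sdiff, Finset.union_sdiff_of_subset hKU]

end Orbits

end Ising
end

noncomputable section

namespace Ising

/-! ### Phases and the joining of half-edges at vertices -/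

/-- The phase `exp(-i w / 2)` of a winding `w` given in units of `π / 2`. -/
def windPhase (m : ℤ) : ℂ := Complex.exp (-(Complex.I / 2) * ((m : ℂ) * (Real.pi / 2)))

lemma windPhase_add (m k : ℤ) : windPhase (m + k) = windPhase m * windPhase k := by
  rw [windPhase, windPhase, windPhase, ← Complex.exp_add]
  push_cast
  ring_nf

lemma windPhase_zero : windPhase 0 = 1 := by simp [windPhase]

lemma windPhase_two : windPhase 2 = -Complex.I := by
  rw [windPhase, ← Complex.exp_neg_pi_div_two_mul_I]
  congr 1
  push_cast
  ring

lemma windPhase_four : windPhase 4 = -1 := by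
  rw [show (4 : ℤ) = 2 + 2 from rfl, windPhase_add, windPhase_two]
  linear_combination Complex.I_mul_I

lemma windPhase_neg_two : windPhase (-2) = Complex.I := by
  have h := windPhase_add 2 (-2)
  rw [add_neg_cancel, windPhase_zero, windPhase_two] at h
  linear_combination (-Complex.I) * h + windPhase (-2) * Complex.I_mul_I

lemma windPhase_eight_mul (k : ℤ) : windPhase (8 * k) = 1 := by
  rw [windPhase, Complex.exp_eq_one_iff]
  refine ⟨-k, ?_⟩
  push_cast
  ring

lemma windPhase_eq_of_dvd {m k : ℤ} (h : (8 : ℤ) ∣ m - k) : windPhase m = windPhase k := by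
  obtain ⟨c, hc⟩ := h
  rw [show m = 8 * c + k by omega, windPhase_add, windPhase_eight_mul, one_mul]

lemma windPhase_eq_one_iff {m : ℤ} : windPhase m = 1 ↔ (8 : ℤ) ∣ m := by
  constructor
  · intro h
    rw [windPhase, Complex.exp_eq_one_iff] at h
    obtain ⟨k, hk⟩ := h
    refine ⟨-k, ?_⟩
    have hpi : (Real.pi : ℂ) ≠ 0 := by exact_mod_cast Real.pi_ne_zero
    have h2 : (m : ℂ) = 8 * -k := by
      have : Complex.I * Real.pi * ((m : ℂ) - 8 * -k) = 0 := by
        linear_combination (-4) * hk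
      rcases mul_eq_zero.1 this with h | h
      · exact absurd h (mul_ne_zero Complex.I_ne_zero hpi)
      · exact sub_eq_zero.1 h
    exact_mod_cast h2
  · rintro ⟨k, rfl⟩
    exact windPhase_eight_mul k

lemma windPhase_ne_zero (m : ℤ) : windPhase m ≠ 0 := Complex.exp_ne_zero _

lemma turn_mod : ∀ d d' : Dir, d ≠ d' →
    (8 : ℤ) ∣ turn d d' - (-2 + (if dirOrient d d' = 1 then 0 else 4) +
      ((rank d' : ℤ) - rank d)) ∧ (dirOrient d d' = 1 ∨ dirOrient d d' = -1) := by
  decide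

/-- Key link between winding and order: apart from a factor i and a difference of ranks, which
telescopes along a trail, the half-angle phase of a turn is the comparison of its two directions. -/
lemma windPhase_turn {d d' : Dir} (h : d ≠ d') : windPhase (turn d d') =
    Complex.I * (dirOrient d d' : ℂ) * windPhase ((rank d' : ℤ) - rank d) := by
  obtain ⟨h1, h2⟩ := turn_mod d d' h
  rw [windPhase_eq_of_dvd h1, windPhase_add, windPhase_add, windPhase_neg_two]
  rcases h2 with h2 | h2
  · simp [h2, windPhase_zero]
  · simp [h2, windPhase_four]

/-- The pairing of the directions in `D` at a vertex, see `Joined`. -/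
def DirJoined (D : Finset Dir) (b : Bool) (d d' : Dir) : Prop :=
  d ≠ d' ∧ d ∈ D ∧ d' ∈ D ∧ ((∀ c : Dir, c ∈ D) →
    if b then d.val / 2 = d'.val / 2 else (d + 1).val / 2 = (d' + 1).val / 2)

instance (D : Finset Dir) (b : Bool) (d d' : Dir) : Decidable (DirJoined D b d d') := by
  unfold DirJoined
  infer_instance

lemma exists_dirJoined : ∀ D : Finset Dir, Even D.card → ∀ b, ∀ d ∈ D, ∃ d', DirJoined D b d d' := by
  decide

lemma dirJoined_unique : ∀ D : Finset Dir, Even D.card → ∀ b d d', DirJoined D b d d' →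
    ∀ c, DirJoined D b d c → c = d' := by
  decide +kernel

/-- The two admissible pairings at a vertex of degree four join cyclic neighbours; non-crossing does
not depend on where the cyclic order is cut. -/
lemma dirJoined_noncrossing : ∀ D : Finset Dir, Even D.card → ∀ b d d', DirJoined D b d d' →
    ∀ c c', DirJoined D b c c' → c ≠ d → c ≠ d' →
      dirOrient d c * dirOrient d c' * (dirOrient d' c * dirOrient d' c') = 1 := by
  decide +kernel

lemma DirJoined.symm {D : Finset Dir} {b : Bool} {d d' : Dir} (h : DirJoined D b d d') :
    DirJoined D b d' d :=
  ⟨h.1.symm, h.2.2.1, h.2.1, fun hc => by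
    have := h.2.2.2 hc
    split_ifs at this ⊢ <;> exact this.symm⟩

/-- The directions of the half-edges of `S` at `v`. -/
def dirs (S : Finset HalfEdge) (v : ℤ × ℤ) : Finset Dir := Finset.univ.filter fun d => (v, d) ∈ S

lemma joined_iff {S : Finset HalfEdge} {ρ : ℤ × ℤ → Bool} {v : ℤ × ℤ} {d d' : Dir} :
    Joined S ρ v d d' ↔ DirJoined (dirs S v) (ρ v) d d' := by
  simp [Joined, DirJoined, dirs]

/-- All vertices have even degree in `S`. -/
def EvenDegrees (S : Finset HalfEdge) : Prop := ∀ v, Even (S.filter fun h => h.1 = v).card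

open Classical in
/-- The half-edge that is joined to `h`. -/
def joinOf (S : Finset HalfEdge) (ρ : ℤ × ℤ → Bool) (h : HalfEdge) : HalfEdge :=
  if e : ∃ d', Joined S ρ h.1 h.2 d' then (h.1, e.choose) else h

section

variable {S : Finset HalfEdge} {ρ : ℤ × ℤ → Bool}

lemma EvenDegrees.dirs (hS : EvenDegrees S) (v : ℤ × ℤ) : Even (dirs S v).card := by
  rw [Ising.dirs, ← DiscreteDomain.card_filter_vertex]
  exact hS v

lemma joinOf_eq (hS : EvenDegrees S) {v : ℤ × ℤ} {d d' : Dir} (h : Joined S ρ v d d') :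
    joinOf S ρ (v, d) = (v, d') := by
  have e : ∃ d', Joined S ρ (v, d).1 (v, d).2 d' := ⟨d', h⟩
  rw [joinOf, dif_pos e]
  exact congrArg _ (dirJoined_unique _ (hS.dirs v) _ _ _ (joined_iff.1 h) _
    (joined_iff.1 e.choose_spec))

lemma exists_joined (hS : EvenDegrees S) {h : HalfEdge} (hh : h ∈ S) :
    ∃ d', Joined S ρ h.1 h.2 d' ∧ joinOf S ρ h = (h.1, d') := by
  obtain ⟨d', hd⟩ := exists_dirJoined (Ising.dirs S h.1) (hS.dirs h.1) (ρ h.1) h.2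
    (by simpa [Ising.dirs] using hh)
  exact ⟨d', joined_iff.2 hd, joinOf_eq hS (joined_iff.2 hd)⟩

lemma pairedBy_joinOf (hS : EvenDegrees S) : PairedBy (joinOf S ρ) S := by
  refine ⟨fun h hh => ?_, fun h hh => ?_, fun h hh => ?_⟩ <;>
    obtain ⟨d', hd, e⟩ := exists_joined (ρ := ρ) hS hh <;> rw [e]
  · exact hd.2.2.1
  · exact fun e => hd.1 (congrArg Prod.snd e).symm
  · exact joinOf_eq hS (joined_iff.2 (joined_iff.1 hd).symm)

/-- At one vertex this is the local check; for different vertices both ends of a chord compare alike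
with any half-edge elsewhere, so the comparisons square to one. -/
lemma nonCrossing_joinOf (hS : EvenDegrees S) : NonCrossing (joinOf S ρ) S := by
  rintro ⟨v, d⟩ ha ⟨u, c⟩ hb hne hne'
  obtain ⟨d', hd, e⟩ := exists_joined (ρ := ρ) hS ha
  obtain ⟨c', hc, e'⟩ := exists_joined (ρ := ρ) hS hb
  rw [e, e']
  rw [e] at hne'
  dsimp only at hd hc ⊢
  by_cases huv : u = v
  · subst huv
    simp only [orient_same_vertex]
    have := dirJoined_noncrossing _ (hS.dirs u) _ _ _ (joined_iff.1 hd) _ _ (joined_iff.1 hc)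
      (fun e => hne (by rw [e])) (fun e => hne' (by rw [e]))
    exact_mod_cast this
  · rw [orient_vertex_indep (b := (u, c)) huv d' d, orient_vertex_indep (b := (u, c')) huv d' d]
    have h1 := orient_mul_self (g := (v, d)) (h := (u, c)) (fun e => huv (Prod.mk.inj e).1.symm)
    have h2 := orient_mul_self (g := (v, d)) (h := (u, c')) (fun e => huv (Prod.mk.inj e).1.symm)
    linear_combination orient (v, d) (u, c') * orient (v, d) (u, c') * h1 + h2

end

end Ising
end

noncomputable section

namespace Ising

namespace DoubleCover

variable {Ω : DiscreteDomain} {C : DoubleCover Ω}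

/-! ### Trails in the superposition of two matchings -/

/-- Signs that describe the continuation of trails through interior edges and along arcs: the
half-edge `next h` follows `h`, with a winding encoded by `phase` and a change of sheets encoded by
`sign`. -/
structure Transport (C : DoubleCover Ω) (J : C.HEdge → ℤ → C.HEdge → Prop) where
  sheet : C.Vert → ℝ
  sheet_mul_self : ∀ w, sheet w * sheet w = 1
  sheet_inj : ∀ w w', C.proj w = C.proj w' → sheet w = sheet w' → w = w'
  next : HalfEdge → HalfEdge
  Cont : HalfEdge → Prop
  phase : HalfEdge → ℝ
  sign : HalfEdge → ℝ
  cont_edge : ∀ h ∈ Ω.E, Cont h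
  next_edge : ∀ h ∈ Ω.E, next h = opp h
  phase_edge : ∀ h ∈ Ω.E, phase h = DiscreteDomain.edgeOrient h
  sign_edge : ∀ w d, (C.proj w, d) ∈ Ω.E → sheet (C.nbr w d) = sign (C.proj w, d) * sheet w
  cont_jump : ∀ y k x, J y k x → Cont (C.down y)
  next_jump : ∀ y k x, J y k x → C.down x = next (C.down y)
  phase_jump : ∀ y k x, J y k x →
    Complex.I * windPhase (k + (rank y.2 - rank x.2)) = (phase (C.down y) : ℂ)
  sign_jump : ∀ y k x, J y k x → sheet x.1 = sign (C.down y) * sheet y.1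
  exists_jump : ∀ y, Cont (C.down y) → C.down y ∉ Ω.E → ∃ k x, J y k x
  phase_mul_self : ∀ h, phase h * phase h = 1
  sign_mul_self : ∀ h, sign h * sign h = 1
  phase_next : ∀ h, Cont h → phase (next h) = -phase h
  sign_next : ∀ h, Cont h → sign (next h) = sign h
  next_next : ∀ h, Cont h → next (next h) = h
  cont_next : ∀ h, Cont h → Cont (next h)

/-- Crossing an edge does not turn, but the rank jumps by ±2 as one half is replaced by the other.
The factor i makes the resulting phase a real sign. -/
lemma windPhase_edge (d : Dir) (h : HalfEdge) (hd : h.2 = d) :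
    Complex.I * windPhase (0 + ((rank d : ℤ) - rank (d + 2))) = (DiscreteDomain.edgeOrient h : ℂ) := by
  have : ∀ d : Dir, ((rank d : ℤ) - rank (d + 2) = 2 ∧ (d = 0 ∨ d = 1)) ∨
      ((rank d : ℤ) - rank (d + 2) = -2 ∧ ¬ (d = 0 ∨ d = 1)) := by
    decide
  rcases this d with ⟨h1, h2⟩ | ⟨h1, h2⟩
  · rw [h1, zero_add, windPhase_two, DiscreteDomain.edgeOrient, if_pos (by rwa [Primary, hd])]
    rw [mul_neg, Complex.I_mul_I]
    norm_num
  · rw [h1, zero_add, windPhase_neg_two, DiscreteDomain.edgeOrient, if_neg (by rwa [Primary, hd]),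
      Complex.I_mul_I]
    norm_num

section

variable {J : C.HEdge → ℤ → C.HEdge → Prop} (T : Transport C J) {S : Finset HalfEdge}
  {ρ : ℤ × ℤ → Bool}

variable (S ρ) in
/-- A double step along a trail. -/
def Transport.step : HalfEdge → HalfEdge := dstep (joinOf S ρ) T.next

variable (S ρ) in
/-- The sign of the winding of `p` double steps. -/
def Transport.windSign (p : ℕ) (h : HalfEdge) : ℝ :=
  ∏ i ∈ Finset.range p, (orient ((T.step S ρ)^[i] h) (joinOf S ρ ((T.step S ρ)^[i] h)) *
    T.phase (joinOf S ρ ((T.step S ρ)^[i] h)))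

variable (S ρ) in
/-- The change of sheets in `p` double steps. -/
def Transport.liftSign (p : ℕ) (h : HalfEdge) : ℝ :=
  ∏ i ∈ Finset.range p, T.sign (joinOf S ρ ((T.step S ρ)^[i] h))

variable (S ρ) in
/-- It is possible to make `p` double steps from `h`. -/
def Transport.CanStep (p : ℕ) (h : HalfEdge) : Prop :=
  ∀ i < p, (T.step S ρ)^[i] h ∈ S ∧ T.Cont (joinOf S ρ ((T.step S ρ)^[i] h))

variable (S ρ) in
/-- `p` double steps lead from `x` to `y`, with winding `m`. -/
structure Transport.Full (p : ℕ) (x : C.HEdge) (m : ℤ) (y : C.HEdge) : Prop where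
  can : T.CanStep S ρ p (C.down x)
  down_eq : C.down y = (T.step S ρ)^[p] (C.down x)
  wind : windPhase m =
    windPhase ((rank y.2 : ℤ) - rank x.2) * (T.windSign S ρ p (C.down x) : ℂ)
  sheet : T.sheet y.1 = T.liftSign S ρ p (C.down x) * T.sheet x.1

variable (S ρ) in
/-- `p` double steps and a passage through a vertex lead from `x` to `y`, with winding `m`. -/
structure Transport.Half (p : ℕ) (x : C.HEdge) (m : ℤ) (y : C.HEdge) : Prop where
  can : T.CanStep S ρ p (C.down x)
  mem : (T.step S ρ)^[p] (C.down x) ∈ S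
  down_eq : C.down y = joinOf S ρ ((T.step S ρ)^[p] (C.down x))
  wind : windPhase m = Complex.I * windPhase ((rank y.2 : ℤ) - rank x.2) *
    ((T.windSign S ρ p (C.down x) * orient ((T.step S ρ)^[p] (C.down x))
      (joinOf S ρ ((T.step S ρ)^[p] (C.down x))) : ℝ) : ℂ)
  sheet : T.sheet y.1 = T.liftSign S ρ p (C.down x) * T.sheet x.1

variable {T}

lemma Transport.windSign_succ (p : ℕ) (h : HalfEdge) : T.windSign S ρ (p + 1) h =
    orient h (joinOf S ρ h) * T.phase (joinOf S ρ h) * T.windSign S ρ p (T.step S ρ h) := by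
  rw [windSign, Finset.prod_range_succ', mul_comm]
  rfl

lemma Transport.liftSign_succ (p : ℕ) (h : HalfEdge) : T.liftSign S ρ (p + 1) h =
    T.sign (joinOf S ρ h) * T.liftSign S ρ p (T.step S ρ h) := by
  rw [liftSign, Finset.prod_range_succ', mul_comm]
  rfl

lemma Transport.canStep_succ (p : ℕ) (h : HalfEdge) : T.CanStep S ρ (p + 1) h ↔
    (h ∈ S ∧ T.Cont (joinOf S ρ h)) ∧ T.CanStep S ρ p (T.step S ρ h) := by
  constructor
  · exact fun hc => ⟨hc 0 (by omega), fun i hi => hc (i + 1) (by omega)⟩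
  · rintro ⟨h0, h1⟩ i hi
    cases i with
    | zero => exact h0
    | succ i => exact h1 i (by omega)

variable (T) in
/-- The continuation of a trail from `y` to `x` with winding `k`. -/
structure Transport.Link (y : C.HEdge) (k : ℤ) (x : C.HEdge) : Prop where
  cont : T.Cont (C.down y)
  down_eq : C.down x = T.next (C.down y)
  phase : Complex.I * windPhase (k + (rank y.2 - rank x.2)) = (T.phase (C.down y) : ℂ)
  sheet : T.sheet x.1 = T.sign (C.down y) * T.sheet y.1

lemma down_nbr {w : C.Vert} {d : Dir} (he : (C.proj w, d) ∈ Ω.E) :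
    C.down (C.nbr w d, d + 2) = opp (C.proj w, d) := by
  rw [down, opp, C.proj_nbr w d he]

lemma Transport.link_edge {w : C.Vert} {d : Dir} (he : (C.proj w, d) ∈ Ω.E) :
    T.Link (w, d) 0 (C.nbr w d, d + 2) :=
  ⟨T.cont_edge _ he, by rw [down_nbr he]; exact (T.next_edge _ he).symm, by
    rw [show C.down (w, d) = (C.proj w, d) from rfl, T.phase_edge _ he]
    exact windPhase_edge d _ rfl, T.sign_edge w d he⟩

lemma Transport.link_jump {y : C.HEdge} {k : ℤ} {x : C.HEdge} (h : J y k x) : T.Link y k x :=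
  ⟨T.cont_jump y k x h, T.next_jump y k x h, T.phase_jump y k x h, T.sign_jump y k x h⟩

/-- The factor i from the turn joins the phase of the edge or arc, so a double step has a real sign
apart from the telescoping difference of ranks. -/
lemma windPhase_step {w : C.Vert} {d d' : Dir} {k : ℤ} {x : C.HEdge}
    (hj : Joined S ρ (C.proj w) d d') (hl : T.Link (w, d') k x) :
    windPhase (turn d d' + k) = windPhase ((rank x.2 : ℤ) - rank d) *
      ((orient (C.proj w, d) (C.proj w, d') * T.phase (C.proj w, d') : ℝ) : ℂ) := by
  have h1 := hl.phase
  rw [show C.down (w, d') = (C.proj w, d') from rfl] at h1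
  push_cast
  rw [windPhase_add, windPhase_turn hj.1, orient_same_vertex, ← h1,
    show k = (k + ((rank d' : ℤ) - rank x.2)) + ((rank x.2 : ℤ) - rank d') by ring, windPhase_add,
    show (rank x.2 : ℤ) - rank d = ((rank x.2 : ℤ) - rank d') + ((rank d' : ℤ) - rank d) by ring,
    windPhase_add (rank x.2 - rank d')]
  push_cast
  ring_nf

lemma full_succ (hS : EvenDegrees S) {w : C.Vert} {d d' : Dir} {k : ℤ} {x y : C.HEdge} {m : ℤ}
    {p : ℕ} (hj : Joined S ρ (C.proj w) d d') (hl : T.Link (w, d') k x)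
    (hf : T.Full S ρ p x m y) : T.Full S ρ (p + 1) (w, d) (turn d d' + k + m) y := by
  have hm : joinOf S ρ (C.down (w, d)) = (C.proj w, d') := joinOf_eq hS hj
  have hst : T.step S ρ (C.down (w, d)) = C.down x := by
    rw [Transport.step, dstep, hm]
    exact hl.down_eq.symm
  refine ⟨?_, ?_, ?_, ?_⟩
  · rw [Transport.canStep_succ, hm, hst]
    exact ⟨⟨hj.2.1, hl.cont⟩, hf.can⟩
  · rw [Function.iterate_succ_apply, hst]
    exact hf.down_eq
  · rw [windPhase_add, windPhase_step hj hl, hf.wind, Transport.windSign_succ, hm, hst,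
      show (rank y.2 : ℤ) - rank d = ((rank x.2 : ℤ) - rank d) + ((rank y.2 : ℤ) - rank x.2) by
        ring, windPhase_add (rank x.2 - rank d)]
    push_cast
    rw [show C.down (w, d) = (C.proj w, d) from rfl]
    ring
  · rw [hf.sheet, hl.sheet, Transport.liftSign_succ, hm, hst]
    change _ * (T.sign (C.proj w, d') * _) = _
    ring

lemma half_succ (hS : EvenDegrees S) {w : C.Vert} {d d' : Dir} {k : ℤ} {x y : C.HEdge} {m : ℤ}
    {p : ℕ} (hj : Joined S ρ (C.proj w) d d') (hl : T.Link (w, d') k x)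
    (hf : T.Half S ρ p x m y) : T.Half S ρ (p + 1) (w, d) (turn d d' + k + m) y := by
  have hm : joinOf S ρ (C.down (w, d)) = (C.proj w, d') := joinOf_eq hS hj
  have hst : T.step S ρ (C.down (w, d)) = C.down x := by
    rw [Transport.step, dstep, hm]
    exact hl.down_eq.symm
  have hit : (T.step S ρ)^[p + 1] (C.down (w, d)) = (T.step S ρ)^[p] (C.down x) := by
    rw [Function.iterate_succ_apply, hst]
  refine ⟨?_, ?_, ?_, ?_, ?_⟩
  · rw [Transport.canStep_succ, hm, hst]
    exact ⟨⟨hj.2.1, hl.cont⟩, hf.can⟩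
  · rw [hit]
    exact hf.mem
  · rw [hit]
    exact hf.down_eq
  · rw [windPhase_add, windPhase_step hj hl, hf.wind, Transport.windSign_succ, hm, hst, hit,
      show (rank y.2 : ℤ) - rank d = ((rank x.2 : ℤ) - rank d) + ((rank y.2 : ℤ) - rank x.2) by
        ring, windPhase_add (rank x.2 - rank d)]
    push_cast
    rw [show C.down (w, d) = (C.proj w, d) from rfl]
    ring
  · rw [hf.sheet, hl.sheet, Transport.liftSign_succ, hm, hst]
    change _ * (T.sign (C.proj w, d') * _) = _
    ring

lemma full_zero (x : C.HEdge) : T.Full S ρ 0 x 0 x :=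
  ⟨fun i hi => absurd hi (Nat.not_lt_zero i), rfl, by
    simp [windPhase_zero, Transport.windSign], by simp [Transport.liftSign]⟩

lemma half_zero (hS : EvenDegrees S) {w : C.Vert} {d d' : Dir}
    (hj : Joined S ρ (C.proj w) d d') : T.Half S ρ 0 (w, d) (turn d d') (w, d') := by
  have hm : joinOf S ρ (C.down (w, d)) = (C.proj w, d') := joinOf_eq hS hj
  refine ⟨fun i hi => absurd hi (Nat.not_lt_zero i), hj.2.1, hm.symm, ?_, by
    simp [Transport.liftSign]⟩
  rw [windPhase_turn hj.1]
  simp only [Transport.windSign, Finset.range_zero, Finset.prod_empty, one_mul,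
    Function.iterate_zero, id_eq, hm]
  rw [show C.down (w, d) = (C.proj w, d) from rfl, orient_same_vertex]
  push_cast
  ring

/-- Every trail consists of double steps, possibly followed by a passage through a vertex. -/
theorem Trail.full_or_half (hS : EvenDegrees S) {x y : C.HEdge} {L : List HalfEdge} {m : ℤ}
    (ht : C.Trail S ρ J x L m y) :
    (∃ p, L = steps (joinOf S ρ) T.next p (C.down x) ∧ T.Full S ρ p x m y) ∨
    (∃ p, L = steps (joinOf S ρ) T.next (p + 1) (C.down x) ∧ T.Half S ρ p x m y) := by
  have hsteps : ∀ {w : C.Vert} {d d' : Dir} {k : ℤ} {x : C.HEdge} (p : ℕ),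
      Joined S ρ (C.proj w) d d' → T.Link (w, d') k x →
      (C.proj w, d) :: (C.proj w, d') :: steps (joinOf S ρ) T.next p (C.down x) =
        steps (joinOf S ρ) T.next (p + 1) (C.down (w, d)) := by
    intro w d d' k x p hj hl
    have hm : joinOf S ρ (C.proj w, d) = (C.proj w, d') := joinOf_eq hS hj
    rw [steps_succ, dstep, show C.down (w, d) = (C.proj w, d) from rfl, hm, hl.down_eq]
    rfl
  induction ht with
  | nil x => exact .inl ⟨0, rfl, full_zero x⟩
  | @last w d d' hj =>
    refine .inr ⟨0, ?_, half_zero hS hj⟩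
    have hm : joinOf S ρ (C.proj w, d) = (C.proj w, d') := joinOf_eq hS hj
    rw [steps_succ, show C.down (w, d) = (C.proj w, d) from rfl, hm]
    rfl
  | @edge w d d' y L m hj he ht ih =>
    have hl : T.Link (w, d') 0 (C.nbr w d', d' + 2) := Transport.link_edge he
    rcases ih with ⟨p, rfl, hf⟩ | ⟨p, rfl, hf⟩
    · refine .inl ⟨p + 1, hsteps p hj hl, ?_⟩
      have := full_succ hS hj hl hf
      rwa [add_zero] at this
    · refine .inr ⟨p + 1, hsteps (p + 1) hj hl, ?_⟩
      have := half_succ hS hj hl hf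
      rwa [add_zero] at this
  | @arc w d d' k x y L m hj ha ht ih =>
    have hl : T.Link (w, d') k x := Transport.link_jump ha
    rcases ih with ⟨p, rfl, hf⟩ | ⟨p, rfl, hf⟩
    · exact .inl ⟨p + 1, hsteps p hj hl, full_succ hS hj hl hf⟩
    · exact .inr ⟨p + 1, hsteps (p + 1) hj hl, half_succ hS hj hl hf⟩

lemma exists_trail_step (hS : EvenDegrees S) {x : C.HEdge} (hx : C.down x ∈ S)
    (hc : T.Cont (joinOf S ρ (C.down x))) :
    ∃ k x', C.down x' = T.step S ρ (C.down x) ∧ ∀ L m y, C.Trail S ρ J x' L m y →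
      C.Trail S ρ J x (C.down x :: joinOf S ρ (C.down x) :: L) (k + m) y := by
  obtain ⟨w, d⟩ := x
  obtain ⟨d', hj, hm⟩ := exists_joined (ρ := ρ) hS hx
  change Joined S ρ (C.proj w) d d' at hj
  change _ = (C.proj w, d') at hm
  rw [Transport.step, dstep, hm]
  rw [hm] at hc
  by_cases he : (C.proj w, d') ∈ Ω.E
  · refine ⟨turn d d', (C.nbr w d', d' + 2), ?_, fun L m y ht => Trail.edge hj he ht⟩
    rw [down_nbr he, T.next_edge _ he]
  · obtain ⟨k, x', hJ⟩ := T.exists_jump (w, d') hc he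
    exact ⟨turn d d' + k, x', T.next_jump _ _ _ hJ, fun L m y ht => Trail.arc hj hJ ht⟩

theorem exists_trail_full (hS : EvenDegrees S) (p : ℕ) (x : C.HEdge)
    (hc : T.CanStep S ρ p (C.down x)) :
    ∃ m y, C.Trail S ρ J x (steps (joinOf S ρ) T.next p (C.down x)) m y ∧
      C.down y = (T.step S ρ)^[p] (C.down x) := by
  induction p generalizing x with
  | zero => exact ⟨0, x, Trail.nil x, rfl⟩
  | succ p ih =>
    rw [Transport.canStep_succ] at hc
    obtain ⟨k, x', hx', hstep⟩ := exists_trail_step hS hc.1.1 hc.1.2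
    obtain ⟨m, y, ht, hy⟩ := ih x' (by rw [hx']; exact hc.2)
    rw [hx'] at ht hy
    exact ⟨k + m, y, hstep _ _ _ ht, hy⟩

theorem exists_trail_half (hS : EvenDegrees S) (p : ℕ) (x : C.HEdge)
    (hc : T.CanStep S ρ p (C.down x)) (hm : (T.step S ρ)^[p] (C.down x) ∈ S) :
    ∃ L m y, C.Trail S ρ J x L m y ∧ C.down y = joinOf S ρ ((T.step S ρ)^[p] (C.down x)) := by
  induction p generalizing x with
  | zero =>
    obtain ⟨w, d⟩ := x
    obtain ⟨d', hj, hm⟩ := exists_joined (ρ := ρ) hS hm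
    exact ⟨_, _, (w, d'), Trail.last hj, hm.symm⟩
  | succ p ih =>
    rw [Transport.canStep_succ] at hc
    obtain ⟨k, x', hx', hstep⟩ := exists_trail_step hS hc.1.1 hc.1.2
    obtain ⟨L, m, y, ht, hy⟩ := ih x' (by rw [hx']; exact hc.2) (by rw [hx']; exact hm)
    rw [hx'] at hy
    exact ⟨_, k + m, y, hstep _ _ _ ht, hy⟩

end

end DoubleCover
end Ising
end

noncomputable section

namespace Ising

namespace DoubleCover

variable {Ω : DiscreteDomain} {C : DoubleCover Ω}

/-! ### The loops of a configuration -/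

lemma exists_proj_eq {v : ℤ × ℤ} (hv : v ∈ Ω.V) : ∃ w, C.proj w = v := by
  by_contra! h
  have h2 := C.two_sheets v hv
  rw [show {w | C.proj w = v} = ∅ from Set.eq_empty_of_forall_notMem h] at h2
  simp at h2

/-- The matching `m` of `S` follows the transport, except for the half-edges in `P`, from which the
trails in `S` cannot be continued. -/
structure Closing {J : C.HEdge → ℤ → C.HEdge → Prop} (T : Transport C J) (S P : Finset HalfEdge)
    (m : HalfEdge → HalfEdge) : Prop where
  even : EvenDegrees S
  vertex_mem : ∀ h ∈ S, h.1 ∈ Ω.V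
  paired : PairedBy m S
  mem_iff : ∀ h ∈ S, m h ∈ P ↔ h ∈ P
  regular : ∀ h ∈ S, h ∉ P → m h = T.next h ∧ T.Cont h
  special : ∀ h ∈ P, T.Cont h → T.next h ∉ S

lemma _root_.Ising.NonCrossing.mono {m : HalfEdge → HalfEdge} {S U : Finset HalfEdge}
    (h : NonCrossing m S) (hU : U ⊆ S) : NonCrossing m U :=
  fun a ha b hb => h a (hU ha) b (hU hb)

lemma _root_.Ising.steps_congr {m₁ m₂ m₂' : HalfEdge → HalfEdge} {p : ℕ} {h : HalfEdge}
    (hi : ∀ i ≤ p, (dstep m₁ m₂)^[i] h = (dstep m₁ m₂')^[i] h) :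
    steps m₁ m₂ p h = steps m₁ m₂' p h := by
  induction p generalizing h with
  | zero => rfl
  | succ p ih =>
    have h1 : dstep m₁ m₂ h = dstep m₁ m₂' h := hi 1 (by omega)
    rw [steps_succ, steps_succ, ih, h1]
    intro i hip
    have := hi (i + 1) (by omega)
    rwa [Function.iterate_succ_apply, Function.iterate_succ_apply, ← h1] at this

lemma _root_.Ising.prod_eq_neg_one_pow {ι : Type*} (s : Finset ι) (f : ι → ℝ)
    (hf : ∀ i ∈ s, f i * f i = 1) : ∏ i ∈ s, f i = (-1) ^ {i | i ∈ s ∧ f i = -1}.ncard := by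
  classical
  have : {i | i ∈ s ∧ f i = -1} = ((s.filter fun i => f i = -1 : Finset ι) : Set ι) := by
    ext; simp
  rw [this, Set.ncard_coe_finset, ← Finset.prod_filter_mul_prod_filter_not s (fun i => f i = -1),
    Finset.prod_congr rfl (g := fun _ => (-1 : ℝ)) fun i hi => (Finset.mem_filter.1 hi).2,
    Finset.prod_const, Finset.prod_eq_one, mul_one]
  intro i hi
  rw [Finset.mem_filter] at hi
  exact (mul_self_eq_one_iff.1 (hf i hi.1)).resolve_right hi.2

section

variable {J : C.HEdge → ℤ → C.HEdge → Prop} {T : Transport C J} {S P : Finset HalfEdge}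
  {ρ : ℤ × ℤ → Bool} {m₂ : HalfEdge → HalfEdge}

lemma Transport.windSign_mul_self (hS : EvenDegrees S) {p : ℕ} {h : HalfEdge}
    (hc : ∀ i < p, (T.step S ρ)^[i] h ∈ S) :
    T.windSign S ρ p h * T.windSign S ρ p h = 1 := by
  rw [windSign, ← Finset.prod_mul_distrib]
  refine Finset.prod_eq_one fun i hi => ?_
  have h1 := (pairedBy_joinOf (ρ := ρ) hS).ne _ (hc i (Finset.mem_range.1 hi))
  have h2 := orient_mul_self h1.symm
  have h3 := T.phase_mul_self (joinOf S ρ ((T.step S ρ)^[i] h))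
  rw [mul_mul_mul_comm, h2, h3, one_mul]

lemma Transport.liftSign_mul_self (p : ℕ) (h : HalfEdge) :
    T.liftSign S ρ p h * T.liftSign S ρ p h = 1 := by
  rw [liftSign, ← Finset.prod_mul_distrib]
  exact Finset.prod_eq_one fun i _ => T.sign_mul_self _

/-- The sign of an edge or arc in a loop. -/
def Transport.twist (T : Transport C J) (h : HalfEdge) : ℝ := T.phase h * T.sign h

lemma Closing.step_eq (hC : Closing T S P m₂) {p : ℕ} {h : HalfEdge} (hh : h ∈ S)
    (hp : ∀ i < p, joinOf S ρ ((dstep (joinOf S ρ) m₂)^[i] h) ∉ P) :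
    ∀ i ≤ p, (T.step S ρ)^[i] h = (dstep (joinOf S ρ) m₂)^[i] h := by
  have h1 := pairedBy_joinOf (ρ := ρ) hC.even
  intro i hi
  induction i with
  | zero => rfl
  | succ i ih =>
    rw [Function.iterate_succ_apply', Function.iterate_succ_apply', ih (by omega), Transport.step,
      dstep, dstep, (hC.regular _ (h1.mem _ (iterate_mem h1 hC.paired hh i)) (hp i hi)).1]

lemma Closing.canStep (hC : Closing T S P m₂) {p : ℕ} {h : HalfEdge} (hh : h ∈ S)
    (hp : ∀ i < p, joinOf S ρ ((dstep (joinOf S ρ) m₂)^[i] h) ∉ P) : T.CanStep S ρ p h := by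
  have h1 := pairedBy_joinOf (ρ := ρ) hC.even
  intro i hi
  rw [hC.step_eq hh hp i hi.le]
  have := iterate_mem h1 hC.paired hh i
  exact ⟨this, (hC.regular _ (h1.mem _ this) (hp i hi)).2⟩

/-- A trail does not pass through `P` before its last step. -/
lemma Closing.notMem_of_canStep (hC : Closing T S P m₂) {p : ℕ} {h : HalfEdge}
    (hc : T.CanStep S ρ p h) (hl : (T.step S ρ)^[p] h ∈ S) :
    ∀ i < p, joinOf S ρ ((dstep (joinOf S ρ) m₂)^[i] h) ∉ P := by
  have key : ∀ i < p, joinOf S ρ ((T.step S ρ)^[i] h) ∉ P := by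
    intro i hi hm
    refine hC.special _ hm (hc i hi).2 ?_
    have : T.next (joinOf S ρ ((T.step S ρ)^[i] h)) = (T.step S ρ)^[i + 1] h := by
      rw [Function.iterate_succ_apply']; rfl
    rw [this]
    rcases Nat.lt_or_ge (i + 1) p with h1 | h1
    · exact (hc (i + 1) h1).1
    · rwa [show i + 1 = p by omega]
  intro i
  induction i using Nat.strong_induction_on with
  | _ i ih =>
    intro hi
    have hh : h ∈ S := by
      exact (hc 0 (by omega)).1
    rw [← hC.step_eq hh (p := i) (fun j hj => ih j hj (by omega)) i le_rfl]
    exact key i hi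

/-- `P` is closed under `m₂`, and each entry of the loop reached by a double step is the
`m₂`-partner of the preceding one, so it suffices to test the half-edges along which vertices are
left. -/
lemma Closing.disjoint_iff (hC : Closing T S P m₂) {h : HalfEdge} (hh : h ∈ S) :
    Disjoint (loopSet (joinOf S ρ) m₂ h) P ↔
      ∀ i < Function.minimalPeriod (dstep (joinOf S ρ) m₂) h,
        joinOf S ρ ((dstep (joinOf S ρ) m₂)^[i] h) ∉ P := by
  have h1 := pairedBy_joinOf (ρ := ρ) hC.even
  have hpos := minimalPeriod_pos_of_mem h1 hC.paired hh
  rw [Finset.disjoint_left]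
  constructor
  · exact fun hd i hi => hd (mem_loopSet.2 ⟨i, hi, .inr rfl⟩)
  · intro hd g hg
    obtain ⟨i, hi, rfl | rfl⟩ := mem_loopSet.1 hg
    · have main : ∀ j < Function.minimalPeriod (dstep (joinOf S ρ) m₂) h,
          (dstep (joinOf S ρ) m₂)^[j + 1] h ∉ P := by
        intro j hj
        rw [Function.iterate_succ_apply']
        exact fun e => hd j hj ((hC.mem_iff _ (h1.mem _ (iterate_mem h1 hC.paired hh j))).1 e)
      cases i with
      | zero =>
        have := main _ (Nat.sub_lt hpos one_pos)
        rwa [Nat.sub_one_add_one hpos.ne', Function.iterate_minimalPeriod] at this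
      | succ i => exact main i (by omega)
    · exact hd i hi

/-- Absence of repetitions forces a closed trail to be exactly one tour of an orbit of double steps;
thus the loops of the definition are the loop sets that avoid `P`. -/
lemma IsLoop.full (hC : Closing T S P m₂) {K : Finset HalfEdge} {m : ℤ} {x y : C.HEdge}
    (hl : C.IsLoop S ρ J K m x y) : C.down x ∈ S ∧ C.down y = C.down x ∧
      Disjoint (loopSet (joinOf S ρ) m₂ (C.down x)) P ∧
      K = loopSet (joinOf S ρ) m₂ (C.down x) ∧
      T.Full S ρ (Function.minimalPeriod (dstep (joinOf S ρ) m₂) (C.down x)) x m y := by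
  obtain ⟨L, ht, hne, hnd, hxy, hK⟩ := hl
  have h1 := pairedBy_joinOf (ρ := ρ) hC.even
  rcases ht.full_or_half (T := T) hC.even with ⟨p, rfl, hf⟩ | ⟨p, rfl, hf⟩
  · have hp : 0 < p := by
      rcases Nat.eq_zero_or_pos p with rfl | hp
      · exact absurd rfl hne
      · exact hp
    have hxS : C.down x ∈ S := (hf.can 0 hp).1
    have hper : (T.step S ρ)^[p] (C.down x) = C.down x := by rw [← hf.down_eq, hxy]
    have hnot := hC.notMem_of_canStep hf.can (by rwa [hper])
    have hst := hC.step_eq hxS hnot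
    have hper2 : Function.IsPeriodicPt (dstep (joinOf S ρ) m₂) p (C.down x) := by
      rw [Function.IsPeriodicPt, Function.IsFixedPt, ← hst p le_rfl, hper]
    have hqpos := minimalPeriod_pos_of_mem h1 hC.paired hxS
    have hq : Function.minimalPeriod (dstep (joinOf S ρ) m₂) (C.down x) = p := by
      refine le_antisymm (hper2.minimalPeriod_le hp) (not_lt.1 fun hlt => ?_)
      have he : (T.step S ρ)^[Function.minimalPeriod (dstep (joinOf S ρ) m₂) (C.down x)]
          (C.down x) = C.down x := by
        rw [hst _ hlt.le, Function.iterate_minimalPeriod]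
      obtain ⟨q, hq⟩ := Nat.exists_eq_add_of_le' hqpos
      rw [hq] at he hlt
      obtain ⟨r, rfl⟩ := Nat.exists_eq_add_of_le' hp
      rw [steps_succ, List.nodup_cons] at hnd
      exact hnd.1 (List.mem_cons_of_mem _ (mem_steps.2 ⟨q, by omega, .inl he.symm⟩))
    refine ⟨hxS, hxy.symm, (hC.disjoint_iff hxS).2 (by rwa [hq]), ?_, by rwa [hq]⟩
    rw [← hK, loopSet, hq, steps_congr (m₂' := m₂) hst]
  -- A trail that stops after passing a vertex ends on the last half-edge it lists; if this were the
  -- start, the start would occur twice.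
  · exfalso
    rw [steps_succ, List.nodup_cons] at hnd
    have he : joinOf S ρ ((T.step S ρ)^[p] (C.down x)) = C.down x := by rw [← hf.down_eq, hxy]
    refine hnd.1 ?_
    cases p with
    | zero => exact List.mem_cons.2 (.inl he.symm)
    | succ p => exact List.mem_cons_of_mem _ (mem_steps.2 ⟨p, by omega, .inr he.symm⟩)

lemma exists_isLoop (hC : Closing T S P m₂) {x : C.HEdge} (hx : C.down x ∈ S)
    (hd : Disjoint (loopSet (joinOf S ρ) m₂ (C.down x)) P) :
    ∃ m y, C.IsLoop S ρ J (loopSet (joinOf S ρ) m₂ (C.down x)) m x y := by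
  have h1 := pairedBy_joinOf (ρ := ρ) hC.even
  have hnot := (hC.disjoint_iff hx).1 hd
  have hpos := minimalPeriod_pos_of_mem h1 hC.paired hx
  obtain ⟨m, y, ht, hy⟩ := exists_trail_full hC.even _ x (hC.canStep hx hnot)
  have hst := hC.step_eq hx hnot
  have hst' : steps (joinOf S ρ) T.next _ (C.down x) = steps (joinOf S ρ) m₂ _ (C.down x) :=
    steps_congr hst
  rw [hst'] at ht
  refine ⟨m, y, _, ht, ?_, nodup_steps_minimalPeriod h1 hC.paired hx, ?_, rfl⟩
  · obtain ⟨q, hq⟩ := Nat.exists_eq_add_of_le' hpos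
    rw [hq, steps_succ]
    exact List.cons_ne_nil _ _
  · rw [hy, hst _ le_rfl, Function.iterate_minimalPeriod]

lemma Transport.Full.sign_eq {p : ℕ} {x y : C.HEdge} {m : ℤ} (hf : T.Full S ρ p x m y)
    (hxy : C.down y = C.down x) : x ≠ y ↔ T.liftSign S ρ p (C.down x) = -1 := by
  have hs := hf.sheet
  have h1 := T.sheet_mul_self x.1
  have hp : (C.down y).1 = (C.down x).1 := by rw [hxy]
  have h2 : (C.down y).2 = (C.down x).2 := by rw [hxy]
  have h3 := mul_self_eq_one_iff.1 (T.liftSign_mul_self (S := S) (ρ := ρ) p (C.down x))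
  constructor
  · intro hne
    refine h3.resolve_left fun e => hne ?_
    rw [e, one_mul] at hs
    exact (Prod.ext (T.sheet_inj _ _ hp hs) h2).symm
  · rintro hl rfl
    rw [hl] at hs
    have h0 : T.sheet x.1 = 0 := by linarith
    rw [h0] at h1
    norm_num at h1

open Classical in
/-- The half-edges in the loops of the decomposition. -/
def loopPart (S P : Finset HalfEdge) (ρ : ℤ × ℤ → Bool) (m₂ : HalfEdge → HalfEdge) :
    Finset HalfEdge :=
  S.filter fun h => Disjoint (loopSet (joinOf S ρ) m₂ h) P

lemma Closing.loopPart_paired (hC : Closing T S P m₂) :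
    PairedBy (joinOf S ρ) (loopPart S P ρ m₂) ∧ PairedBy m₂ (loopPart S P ρ m₂) := by
  have h1 := pairedBy_joinOf (ρ := ρ) hC.even
  constructor
  · refine h1.mono (Finset.filter_subset _ _) fun h hh => ?_
    rw [loopPart, Finset.mem_filter] at hh ⊢
    refine ⟨h1.mem h hh.1, ?_⟩
    rw [loopSet_eq_of_mem h1 hC.paired hh.1]
    · exact hh.2
    · exact (loopSet_paired_fst h1 hC.paired hh.1).mem _ (self_mem_loopSet h1 hC.paired hh.1)
  · refine hC.paired.mono (Finset.filter_subset _ _) fun h hh => ?_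
    rw [loopPart, Finset.mem_filter] at hh ⊢
    refine ⟨hC.paired.mem h hh.1, ?_⟩
    rw [loopSet_eq_of_mem h1 hC.paired hh.1]
    · exact hh.2
    · exact (loopSet_paired_snd h1 hC.paired hh.1).mem _ (self_mem_loopSet h1 hC.paired hh.1)

lemma Closing.notMem_loopPart (hC : Closing T S P m₂) {h : HalfEdge}
    (hh : h ∈ loopPart S P ρ m₂) : h ∈ S ∧ h ∉ P := by
  rw [loopPart, Finset.mem_filter] at hh
  exact ⟨hh.1, Finset.disjoint_left.1 hh.2
    (self_mem_loopSet (pairedBy_joinOf hC.even) hC.paired hh.1)⟩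

/-- The decoration `T.phase` records the winding alone and `T.twist` winding and sheets together;
comparing the two separates the loops counted by I from those counted by l. -/
lemma Closing.matchSign_loop (hC : Closing T S P m₂) {h : HalfEdge} (hh : h ∈ S)
    (hd : Disjoint (loopSet (joinOf S ρ) m₂ h) P) :
    matchSign m₂ T.phase (loopSet (joinOf S ρ) m₂ h) =
      -T.windSign S ρ (Function.minimalPeriod (dstep (joinOf S ρ) m₂) h) h ∧
    matchSign m₂ T.twist (loopSet (joinOf S ρ) m₂ h) =
      -(T.windSign S ρ (Function.minimalPeriod (dstep (joinOf S ρ) m₂) h) h *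
        T.liftSign S ρ (Function.minimalPeriod (dstep (joinOf S ρ) m₂) h) h) := by
  have h1 := pairedBy_joinOf (ρ := ρ) hC.even
  have hsub := loopSet_subset h1 hC.paired hh
  have h11 := loopSet_paired_fst h1 hC.paired hh
  have h12 := loopSet_paired_snd h1 hC.paired hh
  have hst := hC.step_eq hh ((hC.disjoint_iff hh).1 hd)
  have hnc : NonCrossing (joinOf S ρ) (loopSet (joinOf S ρ) m₂ h) :=
    (nonCrossing_joinOf hC.even).mono hsub
  have hreg : ∀ g ∈ loopSet (joinOf S ρ) m₂ h, m₂ g = T.next g ∧ T.Cont g := fun g hg =>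
    hC.regular g (hsub hg) (Finset.disjoint_left.1 hd hg)
  have hself := self_mem_loopSet h1 hC.paired hh
  constructor
  · rw [matchSign_loopSet hnc h11 h12 (fun g hg => by
      rw [(hreg g hg).1, T.phase_next _ (hreg g hg).2]) hself, Transport.windSign]
    refine congrArg _ (Finset.prod_congr rfl fun i hi => ?_)
    rw [hst i (Finset.mem_range.1 hi).le]
  · rw [matchSign_loopSet hnc h11 h12 (fun g hg => by
      rw [(hreg g hg).1, Transport.twist, T.phase_next _ (hreg g hg).2,
        T.sign_next _ (hreg g hg).2, Transport.twist]; ring) hself, Transport.windSign,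
      Transport.liftSign, ← Finset.prod_mul_distrib]
    refine congrArg _ (Finset.prod_congr rfl fun i hi => ?_)
    rw [hst i (Finset.mem_range.1 hi).le, Transport.twist]
    ring

/-- The winding signs square to one in the product of the two decorated signs, which leaves the
change of sheets around the loop. -/
lemma Closing.numNontrivial_set (hC : Closing T S P m₂) :
    {K | ∃ m x y, C.IsLoop S ρ J K m x y ∧ x ≠ y} =
      {K | K ∈ (loopPart S P ρ m₂).image (loopSet (joinOf S ρ) m₂) ∧
        matchSign m₂ T.phase K * matchSign m₂ T.twist K = -1} := by
  have h1 := pairedBy_joinOf (ρ := ρ) hC.even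
  have hval : ∀ h ∈ S, Disjoint (loopSet (joinOf S ρ) m₂ h) P →
      matchSign m₂ T.phase (loopSet (joinOf S ρ) m₂ h) *
        matchSign m₂ T.twist (loopSet (joinOf S ρ) m₂ h) =
        T.liftSign S ρ (Function.minimalPeriod (dstep (joinOf S ρ) m₂) h) h := by
    intro h hh hd
    have hw := T.windSign_mul_self (ρ := ρ) hC.even
      fun i hi => ((hC.canStep hh ((hC.disjoint_iff hh).1 hd)) i hi).1
    rw [(hC.matchSign_loop hh hd).1, (hC.matchSign_loop hh hd).2]
    linear_combination T.liftSign S ρ (Function.minimalPeriod (dstep (joinOf S ρ) m₂) h) h * hw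
  ext K
  simp only [Set.mem_ofPred_eq, Finset.mem_image, loopPart, Finset.mem_filter]
  constructor
  · rintro ⟨m, x, y, hl, hne⟩
    obtain ⟨hx, hxy, hd, rfl, hf⟩ := hl.full hC
    refine ⟨⟨C.down x, ⟨hx, hd⟩, rfl⟩, ?_⟩
    rw [hval _ hx hd]
    exact (hf.sign_eq hxy).1 hne
  · rintro ⟨⟨h, ⟨hh, hd⟩, rfl⟩, he⟩
    obtain ⟨w, hw⟩ := exists_proj_eq (C := C) (hC.vertex_mem h hh)
    have hx : C.down (w, h.2) = h := by rw [down, hw]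
    rw [← hx] at hh hd he
    obtain ⟨m, y, hl⟩ := exists_isLoop hC hh hd
    obtain ⟨-, hxy, -, -, hf⟩ := hl.full hC
    rw [hval _ hh hd] at he
    rw [hx] at hl
    exact ⟨m, _, y, hl, (hf.sign_eq hxy).2 he⟩

/-- Around a loop the ranks telescope to zero, so exp(-i wind/2) is the winding sign; it is 1
exactly for winding zero modulo 4π, and the sign of the loop is its negative. -/
lemma Closing.numZeroWinding_set (hC : Closing T S P m₂) :
    {K | ∃ m x y, C.IsLoop S ρ J K m x y ∧ (8 : ℤ) ∣ m} =
      {K | K ∈ (loopPart S P ρ m₂).image (loopSet (joinOf S ρ) m₂) ∧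
        matchSign m₂ T.phase K = -1} := by
  have hval : ∀ (x y : C.HEdge) (m : ℤ), C.down x ∈ S → C.down y = C.down x →
      Disjoint (loopSet (joinOf S ρ) m₂ (C.down x)) P →
      T.Full S ρ (Function.minimalPeriod (dstep (joinOf S ρ) m₂) (C.down x)) x m y →
      ((8 : ℤ) ∣ m ↔ matchSign m₂ T.phase (loopSet (joinOf S ρ) m₂ (C.down x)) = -1) := by
    intro x y m hx hxy hd hf
    have hr : (C.down y).2 = (C.down x).2 := by rw [hxy]
    change y.2 = x.2 at hr
    rw [(hC.matchSign_loop hx hd).1, neg_inj, ← windPhase_eq_one_iff, hf.wind, hr, sub_self,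
      windPhase_zero, one_mul]
    norm_cast
  ext K
  simp only [Set.mem_ofPred_eq, Finset.mem_image, loopPart, Finset.mem_filter]
  constructor
  · rintro ⟨m, x, y, hl, hne⟩
    obtain ⟨hx, hxy, hd, rfl, hf⟩ := hl.full hC
    exact ⟨⟨C.down x, ⟨hx, hd⟩, rfl⟩, (hval x y m hx hxy hd hf).1 hne⟩
  · rintro ⟨⟨h, ⟨hh, hd⟩, rfl⟩, he⟩
    obtain ⟨w, hw⟩ := exists_proj_eq (C := C) (hC.vertex_mem h hh)
    have hx : C.down (w, h.2) = h := by rw [down, hw]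
    rw [← hx] at hh hd he
    obtain ⟨m, y, hl⟩ := exists_isLoop hC hh hd
    obtain ⟨-, hxy, -, -, hf⟩ := hl.full hC
    rw [hx] at hl
    exact ⟨m, _, y, hl, (hval _ y m hh hxy hd hf).2 he⟩

/-- The loops contribute the sign of the matching. -/
theorem Closing.loop_sign (hC : Closing T S P m₂) :
    (-1 : ℝ) ^ C.numNontrivial S ρ J * (-1) ^ C.numZeroWinding S ρ J =
      matchSign m₂ T.twist (loopPart S P ρ m₂) := by
  have h1 := pairedBy_joinOf (ρ := ρ) hC.even
  have hsq : ∀ K ∈ (loopPart S P ρ m₂).image (loopSet (joinOf S ρ) m₂),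
      matchSign m₂ T.phase K * matchSign m₂ T.phase K = 1 ∧
      matchSign m₂ T.twist K * matchSign m₂ T.twist K = 1 := by
    intro K hK
    obtain ⟨h, hh, rfl⟩ := Finset.mem_image.1 hK
    rw [loopPart, Finset.mem_filter] at hh
    have hw := T.windSign_mul_self (ρ := ρ) hC.even
      fun i hi => ((hC.canStep hh.1 ((hC.disjoint_iff hh.1).1 hh.2)) i hi).1
    have hl := T.liftSign_mul_self (S := S) (ρ := ρ)
      (Function.minimalPeriod (dstep (joinOf S ρ) m₂) h) h
    rw [(hC.matchSign_loop hh.1 hh.2).1, (hC.matchSign_loop hh.1 hh.2).2]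
    constructor
    · linear_combination hw
    · linear_combination T.liftSign S ρ (Function.minimalPeriod (dstep (joinOf S ρ) m₂) h) h *
        T.liftSign S ρ (Function.minimalPeriod (dstep (joinOf S ρ) m₂) h) h * hw + hl
  rw [numNontrivial, numZeroWinding, hC.numNontrivial_set, hC.numZeroWinding_set,
    ← prod_eq_neg_one_pow _ _ fun K hK => (hsq K hK).1,
    ← prod_eq_neg_one_pow _ _ (fun K hK => by
      linear_combination matchSign m₂ T.twist K * matchSign m₂ T.twist K * (hsq K hK).1 +
        (hsq K hK).2), ← Finset.prod_mul_distrib,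
    ← prod_matchSign_loops (S := loopPart S P ρ m₂)
      ((nonCrossing_joinOf hC.even).mono (Finset.filter_subset _ _)) (B := T.twist)
      (fun h hh => ?_) _ subset_rfl hC.loopPart_paired.1 hC.loopPart_paired.2]
  · exact Finset.prod_congr rfl fun K hK => by
      linear_combination matchSign m₂ T.twist K * (hsq K hK).1
  · obtain ⟨h3, h4⟩ := hC.regular h (hC.notMem_loopPart hh).1 (hC.notMem_loopPart hh).2
    rw [h3, Transport.twist, T.phase_next _ h4, T.sign_next _ h4, Transport.twist]
    ring

end

end DoubleCover

end Ising
end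

noncomputable section

namespace Ising

lemma matchSign_congr {m : HalfEdge → HalfEdge} {B B' : HalfEdge → ℝ} {U : Finset HalfEdge}
    (h : ∀ g ∈ U, B g = B' g) : matchSign m B U = matchSign m B' U := by
  rw [matchSign, matchSign, chordSign, chordSign]
  refine congrArg _ (congrArg _ (List.map_congr_left fun p hp => h _ ?_))
  obtain ⟨g, hg, rfl⟩ := List.mem_map.1 hp
  exact (Finset.mem_filter.1 (Finset.mem_toList.1 hg)).1

namespace DoubleCover

variable {Ω : DiscreteDomain} {C : DoubleCover Ω}

/-! ### The path of a configuration -/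

section

variable {J : C.HEdge → ℤ → C.HEdge → Prop} {T : Transport C J} {S P : Finset HalfEdge}
  {ρ : ℤ × ℤ → Bool} {m₂ : HalfEdge → HalfEdge}

lemma phase_eq {a z : C.HEdge} {V : ℂ} (hex : ∃ W, C.IsPhase S ρ J a z W)
    (hall : ∀ W, C.IsPhase S ρ J a z W → W = V) : C.phase S ρ J a z = V := by
  rw [phase, dif_pos hex]
  exact hall _ hex.choose_spec

variable (T) in
/-- The sign of the sheet of `z`, transported to the half-edge `b` that names the same point. -/
def Transport.sheetAt (b : HalfEdge) (z : C.HEdge) : ℝ :=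
  if b = C.down z then T.sheet z.1 else T.sign b * T.sheet z.1

-- On a two-point fibre, equality of sheets is a product of sheet numbers. If the trail ends on the
-- other half of the edge of `z`, the sheet of `z` is first carried across that edge.
open Classical in
lemma Transport.samePoint_sign {y z : C.HEdge} (h : Ω.SamePoint (C.down y) (C.down z)) :
    (if C.SamePoint y z then (1 : ℝ) else -1) =
      T.sheet y.1 * T.sheetAt (C.down y) z := by
  have hyy := T.sheet_mul_self y.1
  have hzz := T.sheet_mul_self z.1
  rcases h with h | ⟨hE, h⟩
  · rw [sheetAt, if_pos h]
    have hp : (C.down y).1 = (C.down z).1 := by rw [h]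
    have hd : (C.down y).2 = (C.down z).2 := by rw [h]
    by_cases hs : T.sheet y.1 = T.sheet z.1
    · have : y = z := Prod.ext (T.sheet_inj _ _ hp hs) hd
      rw [if_pos (.inl this), hs, hzz]
    · have hneg : T.sheet y.1 = -T.sheet z.1 := by
        rw [← hzz] at hyy
        exact (mul_self_eq_mul_self_iff.1 hyy).resolve_left hs
      rw [if_neg, hneg]
      · linear_combination hzz
      · rintro (e | ⟨he, e⟩)
        · exact hs (by rw [e])
        · have : C.down y = opp (C.down z) := by
            rw [e]
            exact down_nbr he
          exact opp_ne_self _ (this.symm.trans h)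
  · have hopp := T.sign_next _ (T.cont_edge _ hE)
    rw [T.next_edge _ hE, ← h] at hopp
    have hat : T.sheetAt (C.down y) z = T.sign (C.down z) * T.sheet z.1 := by
      rw [sheetAt, if_neg (by rw [h]; exact opp_ne_self _), hopp]
    rw [hat]
    have hn := T.sign_edge z.1 z.2 hE
    have hss := T.sign_mul_self (C.down z)
    change T.sheet (C.nbr z.1 z.2) = T.sign (C.down z) * _ at hn
    have hp : (C.down y).1 = (C.down (C.nbr z.1 z.2, z.2 + 2)).1 := by rw [h, down_nbr hE]; rfl
    have hd : (C.down y).2 = (C.down (C.nbr z.1 z.2, z.2 + 2)).2 := by rw [h, down_nbr hE]; rfl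
    by_cases hs : T.sheet y.1 = T.sheet (C.nbr z.1 z.2)
    · rw [if_pos (.inr ⟨hE, Prod.ext (T.sheet_inj _ _ hp hs) hd⟩), hs, hn]
      linear_combination -(T.sign (C.down z) * T.sign (C.down z)) * hzz - hss
    · have hnn := T.sheet_mul_self (C.nbr z.1 z.2)
      have hneg : T.sheet y.1 = -T.sheet (C.nbr z.1 z.2) := by
        rw [← hnn] at hyy
        exact (mul_self_eq_mul_self_iff.1 hyy).resolve_left hs
      rw [if_neg, hneg, hn]
      · linear_combination T.sign (C.down z) * T.sign (C.down z) * hzz + hss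
      · rintro (e | ⟨-, e⟩)
        · rw [e] at h
          exact opp_ne_self _ h.symm
        · exact hs (by rw [e])

/-- The orientation of the chords of a matching, if the path is closed by a chord from its last
half-edge `b` to its first half-edge `a`. -/
def Transport.closedTwist (T : Transport C J) (a b : HalfEdge) (h : HalfEdge) : ℝ :=
  if h = b then 1 else if h = a then -1 else T.twist h

/-- The matching that is closed by the chord from the last half-edge `b` of the path to the first
half-edge `a`. -/
structure PathClosing (T : Transport C J) (S : Finset HalfEdge) (m₂ : HalfEdge → HalfEdge)
    (a b : HalfEdge) : Prop extends Closing T S {a, b} m₂ where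
  start_mem : a ∈ S
  start_eq : m₂ a = b

variable {a b : HalfEdge}

lemma PathClosing.end_eq (hC : PathClosing T S m₂ a b) : m₂ b = a := by
  rw [← hC.start_eq]
  exact hC.paired.inv a hC.start_mem

lemma PathClosing.end_mem (hC : PathClosing T S m₂ a b) : b ∈ S := by
  rw [← hC.start_eq]
  exact hC.paired.mem a hC.start_mem

lemma PathClosing.end_ne (hC : PathClosing T S m₂ a b) : b ≠ a := by
  rw [← hC.start_eq]
  exact hC.paired.ne a hC.start_mem

lemma PathClosing.closedTwist_eq (hC : PathClosing T S m₂ a b) {h : HalfEdge} (hh : h ∈ S) :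
    T.closedTwist a b (m₂ h) = -T.closedTwist a b h := by
  have hne := hC.end_ne
  by_cases h1 : h = b
  · rw [h1, hC.end_eq, Transport.closedTwist, Transport.closedTwist, if_neg hne.symm, if_pos rfl,
      if_pos rfl]
  by_cases h2 : h = a
  · rw [h2, hC.start_eq, Transport.closedTwist, Transport.closedTwist, if_pos rfl,
      if_neg hne.symm, if_pos rfl]
    norm_num
  have hP : h ∉ ({a, b} : Finset HalfEdge) := by simp [h1, h2]
  have hP' := mt (hC.mem_iff h hh).1 hP
  obtain ⟨h3, h4⟩ := hC.regular h hh hP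
  simp only [Finset.mem_insert, Finset.mem_singleton, not_or] at hP'
  rw [Transport.closedTwist, Transport.closedTwist, if_neg hP'.2, if_neg hP'.1, if_neg h1,
    if_neg h2, h3, Transport.twist, Transport.twist, T.phase_next _ h4, T.sign_next _ h4]
  ring

variable (T S ρ m₂) in
/-- The number of edges and arcs of the path from `a`. -/
def pathLength (a : HalfEdge) : ℕ := Function.minimalPeriod (dstep (joinOf S ρ) m₂) a - 1

lemma PathClosing.pathLength_add_one (hC : PathClosing T S m₂ a b) :
    pathLength S ρ m₂ a + 1 = Function.minimalPeriod (dstep (joinOf S ρ) m₂) a :=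
  Nat.sub_add_cancel (minimalPeriod_pos_of_mem (pairedBy_joinOf hC.even) hC.paired hC.start_mem)

lemma PathClosing.join_last (hC : PathClosing T S m₂ a b) :
    joinOf S ρ ((dstep (joinOf S ρ) m₂)^[pathLength S ρ m₂ a] a) = b := by
  have h1 := pairedBy_joinOf (ρ := ρ) hC.even
  have h2 : m₂ (joinOf S ρ ((dstep (joinOf S ρ) m₂)^[pathLength S ρ m₂ a] a)) = a := by
    have : (dstep (joinOf S ρ) m₂)^[pathLength S ρ m₂ a + 1] a = a := by
      rw [hC.pathLength_add_one, Function.iterate_minimalPeriod]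
    rwa [Function.iterate_succ_apply'] at this
  rw [← hC.paired.inv _ (h1.mem _ (iterate_mem h1 hC.paired hC.start_mem _)), h2, hC.start_eq]

lemma PathClosing.notMem (hC : PathClosing T S m₂ a b) :
    ∀ i < pathLength S ρ m₂ a,
      joinOf S ρ ((dstep (joinOf S ρ) m₂)^[i] a) ∉ ({a, b} : Finset HalfEdge) := by
  have h1 := pairedBy_joinOf (ρ := ρ) hC.even
  intro i hi hm
  rcases Finset.mem_insert.1 hm with e | e
  · exact iterate_ne_partner_iterate h1 hC.paired hC.start_mem 0 i e.symm
  · rw [Finset.mem_singleton] at e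
    have h2 : (dstep (joinOf S ρ) m₂)^[i + 1] a = a := by
      rw [Function.iterate_succ_apply', dstep, e, hC.end_eq]
    have h3 := Function.IsPeriodicPt.minimalPeriod_le (Nat.succ_pos i) h2
    have h4 := hC.pathLength_add_one (ρ := ρ)
    omega

lemma PathClosing.step_eq (hC : PathClosing T S m₂ a b) :
    ∀ i ≤ pathLength S ρ m₂ a, (T.step S ρ)^[i] a = (dstep (joinOf S ρ) m₂)^[i] a :=
  hC.toClosing.step_eq hC.start_mem hC.notMem

lemma PathClosing.step_last (hC : PathClosing T S m₂ a b) :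
    (T.step S ρ)^[pathLength S ρ m₂ a + 1] a = T.next b := by
  rw [Function.iterate_succ_apply', hC.step_eq _ le_rfl, Transport.step, dstep, hC.join_last]

/-- The closing chord has both ends in one orbit, so the path is the only component that meets `{a,
b}`. -/
lemma PathClosing.loopPart_eq (hC : PathClosing T S m₂ a b) :
    loopPart S {a, b} ρ m₂ = S \ loopSet (joinOf S ρ) m₂ a := by
  have h1 := pairedBy_joinOf (ρ := ρ) hC.even
  ext h
  rw [loopPart, Finset.mem_filter, Finset.mem_sdiff]
  refine and_congr_right fun hh => ⟨fun hd e => ?_, fun hn => ?_⟩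
  · rw [loopSet_eq_of_mem h1 hC.paired hC.start_mem e] at hd
    exact Finset.disjoint_left.1 hd (self_mem_loopSet h1 hC.paired hC.start_mem) (by simp)
  · rw [Finset.disjoint_right]
    intro g hg e
    refine hn ?_
    have ha : a ∈ loopSet (joinOf S ρ) m₂ h := by
      rcases Finset.mem_insert.1 hg with rfl | hg
      · exact e
      · rw [Finset.mem_singleton] at hg
        rw [← hC.end_eq, ← hg]
        exact (loopSet_paired_snd h1 hC.paired hh).mem _ e
    rw [loopSet_eq_of_mem h1 hC.paired hh ha]
    exact self_mem_loopSet h1 hC.paired hh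

/-- The signs of the path and of the loops combine to the sign of the matching. -/
theorem PathClosing.path_sign (hC : PathClosing T S m₂ a b) :
    T.windSign S ρ (pathLength S ρ m₂ a) a *
        orient ((T.step S ρ)^[pathLength S ρ m₂ a] a) b *
        T.liftSign S ρ (pathLength S ρ m₂ a) a *
        ((-1 : ℝ) ^ C.numNontrivial S ρ J * (-1) ^ C.numZeroWinding S ρ J) =
      -matchSign m₂ (T.closedTwist a b) S := by
  have h1 := pairedBy_joinOf (ρ := ρ) hC.even
  have hsub := loopSet_subset h1 hC.paired hC.start_mem
  have h11 := loopSet_paired_fst h1 hC.paired hC.start_mem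
  have h12 := loopSet_paired_snd h1 hC.paired hC.start_mem
  have hnc := nonCrossing_joinOf (ρ := ρ) hC.even
  have hpart := hC.loopPart_paired (ρ := ρ)
  have hmem := fun h (hh : h ∈ loopPart S {a, b} ρ m₂) => hC.notMem_loopPart hh
  have hloop := matchSign_loopSet (B := T.closedTwist a b) hnc h1 hC.paired
    (fun h hh => hC.closedTwist_eq hh) hC.start_mem
  -- The orbit of `a` is the path followed by the closing chord; the chord has decoration one,
  -- leaving only the comparison at the last vertex.
  rw [← hC.pathLength_add_one, Finset.prod_range_succ, hC.join_last,
    show T.closedTwist a b b = 1 from if_pos rfl, mul_one] at hloop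
  have hprod : ∏ i ∈ Finset.range (pathLength S ρ m₂ a),
      (orient ((dstep (joinOf S ρ) m₂)^[i] a) (joinOf S ρ ((dstep (joinOf S ρ) m₂)^[i] a)) *
        T.closedTwist a b (joinOf S ρ ((dstep (joinOf S ρ) m₂)^[i] a))) =
      T.windSign S ρ (pathLength S ρ m₂ a) a * T.liftSign S ρ (pathLength S ρ m₂ a) a := by
    rw [Transport.windSign, Transport.liftSign, ← Finset.prod_mul_distrib]
    refine Finset.prod_congr rfl fun i hi => ?_
    have hi := Finset.mem_range.1 hi
    have hn := hC.notMem (ρ := ρ) i hi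
    simp only [Finset.mem_insert, Finset.mem_singleton, not_or] at hn
    rw [hC.step_eq i hi.le, Transport.closedTwist, if_neg hn.2, if_neg hn.1, Transport.twist]
    ring
  rw [hprod] at hloop
  rw [hC.loop_sign, hC.step_eq _ le_rfl]
  have hcongr : matchSign m₂ T.twist (loopPart S {a, b} ρ m₂) =
      matchSign m₂ (T.closedTwist a b) (loopPart S {a, b} ρ m₂) := by
    refine matchSign_congr fun g hg => ?_
    have := (hmem g hg).2
    simp only [Finset.mem_insert, Finset.mem_singleton, not_or] at this
    rw [Transport.closedTwist, if_neg this.2, if_neg this.1]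
  have hunion := matchSign_union (B := T.closedTwist a b) hnc hsub Finset.sdiff_subset h11 h12
    (W := S \ loopSet (joinOf S ρ) m₂ a) (by rw [← hC.loopPart_eq]; exact hpart.1)
    (by rw [← hC.loopPart_eq]; exact hpart.2) (fun h hh => hC.closedTwist_eq hh)
    Finset.disjoint_sdiff
  rw [Finset.union_sdiff_of_subset hsub] at hunion
  rw [hcongr, hunion, hC.loopPart_eq, hloop]
  ring

/-- A trail from `a` either stays among the other half-edges of `S`, or is the whole path. -/
lemma PathClosing.trail_cases (hC : PathClosing T S m₂ a b) {x y : C.HEdge} {m : ℤ}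
    {L : List HalfEdge} (hx : C.down x = a) (ht : C.Trail S ρ J x L m y) :
    (C.down y ∈ S ∧ C.down y ≠ b) ∨
    (C.down y = b ∧ windPhase m = Complex.I * windPhase ((rank y.2 : ℤ) - rank x.2) *
      ((T.windSign S ρ (pathLength S ρ m₂ a) a *
        orient ((T.step S ρ)^[pathLength S ρ m₂ a] a) b : ℝ) : ℂ) ∧
      T.sheet y.1 = T.liftSign S ρ (pathLength S ρ m₂ a) a * T.sheet x.1) ∨
    (T.Cont b ∧ C.down y = T.next b ∧ windPhase m = windPhase ((rank y.2 : ℤ) - rank x.2) *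
      ((T.windSign S ρ (pathLength S ρ m₂ a) a *
        orient ((T.step S ρ)^[pathLength S ρ m₂ a] a) b * T.phase b : ℝ) : ℂ) ∧
      T.sheet y.1 = T.liftSign S ρ (pathLength S ρ m₂ a) a * T.sign b * T.sheet x.1) := by
  have h1 := pairedBy_joinOf (ρ := ρ) hC.even
  have hit := fun i => iterate_mem h1 hC.paired hC.start_mem i
  have hjl : joinOf S ρ ((T.step S ρ)^[pathLength S ρ m₂ a] a) = b := by
    rw [hC.step_eq _ le_rfl, hC.join_last]
  have hlong : ∀ p, T.CanStep S ρ p a → pathLength S ρ m₂ a < p → T.Cont b ∧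
      p = pathLength S ρ m₂ a + 1 := by
    intro p hc hp
    have hb := (hc _ hp).2
    rw [hjl] at hb
    refine ⟨hb, le_antisymm (not_lt.1 fun hlt => ?_) hp⟩
    have := (hc _ hlt).1
    rw [hC.step_last] at this
    exact hC.special b (by simp) hb this
  rcases ht.full_or_half (T := T) hC.even with ⟨p, -, hf⟩ | ⟨p, -, hf⟩
  · obtain ⟨hc, hd, hw, hs⟩ := hf
    rw [hx] at hc hd hw hs
    rcases Nat.lt_or_ge (pathLength S ρ m₂ a) p with hp | hp
    · obtain ⟨hb, rfl⟩ := hlong p hc hp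
      refine .inr (.inr ⟨hb, by rw [hd, hC.step_last], ?_, ?_⟩)
      · rw [hw, Transport.windSign, Finset.prod_range_succ, hjl, ← Transport.windSign, mul_assoc]
      · rw [hs, Transport.liftSign, Finset.prod_range_succ, hjl, ← Transport.liftSign]
    · refine .inl ?_
      rw [hd, hC.step_eq p hp]
      refine ⟨hit p, fun e => ?_⟩
      rw [← hC.join_last (ρ := ρ)] at e
      exact iterate_ne_partner_iterate h1 hC.paired hC.start_mem _ _ e
  · obtain ⟨hc, hmem, hd, hw, hs⟩ := hf
    rw [hx] at hc hmem hd hw hs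
    rcases Nat.lt_trichotomy p (pathLength S ρ m₂ a) with hp | rfl | hp
    · refine .inl ?_
      rw [hd, hC.step_eq p hp.le]
      refine ⟨h1.mem _ (hit p), fun e => hC.notMem p hp ?_⟩
      rw [e]
      simp
    · rw [hjl] at hd hw
      exact .inr (.inl ⟨hd, hw, hs⟩)
    · obtain ⟨hb, rfl⟩ := hlong p hc hp
      rw [hC.step_last] at hmem
      exact absurd hmem (hC.special b (by simp) hb)

lemma PathClosing.exists_trail_end (hC : PathClosing T S m₂ a b) {x : C.HEdge}
    (hx : C.down x = a) : ∃ L m y, C.Trail S ρ J x L m y ∧ C.down y = b := by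
  have h1 := pairedBy_joinOf (ρ := ρ) hC.even
  have hcan := hC.canStep hC.start_mem (hC.notMem (ρ := ρ))
  rw [← hx] at hcan
  obtain ⟨L, m, y, ht, hy⟩ := exists_trail_half hC.even _ x hcan (by
    rw [hx, hC.step_eq _ le_rfl]
    exact iterate_mem h1 hC.paired hC.start_mem _)
  refine ⟨L, m, y, ht, ?_⟩
  rw [hy, hx, hC.step_eq _ le_rfl, hC.join_last]

lemma PathClosing.exists_trail_next (hC : PathClosing T S m₂ a b) (hb : T.Cont b) {x : C.HEdge}
    (hx : C.down x = a) : ∃ L m y, C.Trail S ρ J x L m y ∧ C.down y = T.next b := by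
  have h1 := pairedBy_joinOf (ρ := ρ) hC.even
  have hcan : T.CanStep S ρ (pathLength S ρ m₂ a + 1) a := by
    intro i hi
    rcases Nat.lt_succ_iff_lt_or_eq.1 hi with hi | rfl
    · exact hC.canStep hC.start_mem (hC.notMem (ρ := ρ)) i hi
    · rw [hC.step_eq _ le_rfl, hC.join_last]
      exact ⟨iterate_mem h1 hC.paired hC.start_mem _, hb⟩
  rw [← hx] at hcan
  obtain ⟨m, y, ht, hy⟩ := exists_trail_full hC.even _ x hcan
  refine ⟨_, m, y, ht, ?_⟩
  rw [hy, hx, hC.step_last]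

/-- The complex phase of a configuration whose path ends at a half-edge of `S`. -/
theorem PathClosing.phase_end (hC : PathClosing T S m₂ a b) {x z : C.HEdge} (hx : C.down x = a)
    (hbz : Ω.SamePoint b (C.down z)) (hz : ∀ g ∈ S, Ω.SamePoint g (C.down z) → g = b)
    (hb : T.Cont b → b ∈ Ω.E) :
    C.phase S ρ J x z * (-1) ^ C.numZeroWinding S ρ J =
      -Complex.I * windPhase ((rank b.2 : ℤ) - rank x.2) *
        ((T.sheet x.1 * T.sheetAt b z * matchSign m₂ (T.closedTwist a b) S : ℝ) : ℂ) := by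
  classical
  have hval : C.phase S ρ J x z = Complex.I * windPhase ((rank b.2 : ℤ) - rank x.2) *
      ((T.windSign S ρ (pathLength S ρ m₂ a) a *
        orient ((T.step S ρ)^[pathLength S ρ m₂ a] a) b *
        T.liftSign S ρ (pathLength S ρ m₂ a) a * (-1) ^ C.numNontrivial S ρ J *
        T.sheet x.1 * T.sheetAt b z : ℝ) : ℂ) := by
    refine phase_eq ?_ ?_
    · obtain ⟨L, m, y, ht, hy⟩ := hC.exists_trail_end (ρ := ρ) hx
      exact ⟨_, L, m, y, ht, by rwa [hy], rfl⟩
    · rintro W ⟨L, m, y, ht, hyz, rfl⟩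
      have hsp := T.samePoint_sign hyz
      rw [show (if C.SamePoint y z then (1 : ℂ) else -1) =
        ((if C.SamePoint y z then (1 : ℝ) else -1 : ℝ) : ℂ) by split_ifs <;> simp, hsp]
      change windPhase m * _ * _ = _
      rcases hC.trail_cases hx ht with ⟨h1, h2⟩ | ⟨h1, h2, h3⟩ | ⟨h0, h1, h2, h3⟩
      · exact absurd (hz _ h1 hyz) h2
      · have hr : y.2 = b.2 := by rw [← h1]; rfl
        rw [h2, h3, h1, hr]
        push_cast
        ring
      -- The trail may also run across the last edge to its other half. The phase of the edge and
      -- the transported sheet compensate, so the value does not depend on which trail is taken.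
      · have hbE := hb h0
        have hopp := T.sign_next _ h0
        have hph := windPhase_edge b.2 b rfl
        rw [T.next_edge _ hbE] at h1 hopp
        have hr : y.2 = b.2 + 2 := by
          have : (C.down y).2 = (opp b).2 := by rw [h1]
          exact this
        have hat : T.sheetAt (opp b) z = T.sign b * T.sheetAt b z := by
          rcases hbz with e | ⟨hE, e⟩
          · rw [Transport.sheetAt, Transport.sheetAt, if_pos e, if_neg (by rw [e]; exact opp_ne_self _),
              hopp]
          · have : opp b = C.down z := by rw [e, opp_opp]
            rw [Transport.sheetAt, Transport.sheetAt, if_pos this,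
              if_neg (by rw [← this]; exact (opp_ne_self b).symm)]
            linear_combination -T.sheet z.1 * T.sign_mul_self b
        rw [h2, h3, h1, hr, hat, T.phase_edge _ hbE,
          show (rank b.2 : ℤ) - rank x.2 = (0 + ((rank b.2 : ℤ) - rank (b.2 + 2))) +
            (rank (b.2 + 2) - rank x.2) by ring, windPhase_add _ (rank (b.2 + 2) - rank x.2 : ℤ)]
        have hss : (T.sign b : ℂ) * T.sign b = 1 := by exact_mod_cast T.sign_mul_self b
        push_cast
        linear_combination windPhase (rank (b.2 + 2) - rank x.2) *
          T.windSign S ρ (pathLength S ρ m₂ a) a *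
          orient ((T.step S ρ)^[pathLength S ρ m₂ a] a) b * DiscreteDomain.edgeOrient b *
          T.liftSign S ρ (pathLength S ρ m₂ a) a * (-1) ^ C.numNontrivial S ρ J *
          T.sheet x.1 * T.sheetAt b z * hss - windPhase (rank (b.2 + 2) - rank x.2) *
          T.windSign S ρ (pathLength S ρ m₂ a) a *
          orient ((T.step S ρ)^[pathLength S ρ m₂ a] a) b *
          T.liftSign S ρ (pathLength S ρ m₂ a) a * (-1) ^ C.numNontrivial S ρ J *
          T.sheet x.1 * T.sheetAt b z * hph
  have hp := hC.path_sign (ρ := ρ)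
  have hp' := congrArg (Complex.ofReal) hp
  rw [hval]
  push_cast at hp' ⊢
  linear_combination Complex.I * windPhase ((rank b.2 : ℤ) - rank x.2) * T.sheet x.1 *
    T.sheetAt b z * hp'

/-- The complex phase of a configuration whose path ends with an arc that leads out of `S`. -/
theorem PathClosing.phase_next (hC : PathClosing T S m₂ a b) {x z : C.HEdge} (hx : C.down x = a)
    (hb : T.Cont b) (hz : T.next b = C.down z) (hE : C.down z ∉ Ω.E) (hS : C.down z ∉ S) :
    C.phase S ρ J x z * (-1) ^ C.numZeroWinding S ρ J =
      -windPhase ((rank z.2 : ℤ) - rank x.2) *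
        ((T.sheet x.1 * T.sheet z.1 * T.twist b * matchSign m₂ (T.closedTwist a b) S : ℝ) : ℂ) := by
  classical
  have hval : C.phase S ρ J x z = windPhase ((rank z.2 : ℤ) - rank x.2) *
      ((T.windSign S ρ (pathLength S ρ m₂ a) a *
        orient ((T.step S ρ)^[pathLength S ρ m₂ a] a) b *
        T.liftSign S ρ (pathLength S ρ m₂ a) a * (-1) ^ C.numNontrivial S ρ J *
        T.sheet x.1 * T.sheet z.1 * T.twist b : ℝ) : ℂ) := by
    refine phase_eq ?_ ?_
    · obtain ⟨L, m, y, ht, hy⟩ := hC.exists_trail_next (ρ := ρ) hb hx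
      exact ⟨_, L, m, y, ht, .inl (by rw [hy, hz]), rfl⟩
    · rintro W ⟨L, m, y, ht, hyz, rfl⟩
      have hsp := T.samePoint_sign hyz
      rw [show (if C.SamePoint y z then (1 : ℂ) else -1) =
        ((if C.SamePoint y z then (1 : ℝ) else -1 : ℝ) : ℂ) by split_ifs <;> simp, hsp]
      have hy : C.down y = C.down z := hyz.resolve_right fun h => hE h.1
      change windPhase m * _ * _ = _
      rcases hC.trail_cases hx ht with ⟨h1, h2⟩ | ⟨h1, h2, h3⟩ | ⟨h0, h1, h2, h3⟩
      · exact absurd (hy ▸ h1) hS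
      · exact absurd (hy ▸ h1 ▸ hC.end_mem) hS
      · have hr : (C.down y).2 = (C.down z).2 := by rw [hy]
        change y.2 = z.2 at hr
        rw [h2, h3, hr, Transport.sheetAt, if_pos hy, Transport.twist]
        push_cast
        ring
  have hp := hC.path_sign (ρ := ρ)
  have hp' := congrArg (Complex.ofReal) hp
  rw [hval]
  push_cast at hp' ⊢
  linear_combination windPhase ((rank z.2 : ℤ) - rank x.2) * T.sheet x.1 *
    T.sheet z.1 * T.twist b * hp'

/-- The complex phase of a configuration with a trivial path. -/
theorem Closing.phase_nil (hC : Closing T S ∅ m₂) {x z : C.HEdge} (hx : C.down x ∉ S)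
    (hz : C.down z = C.down x) (hE : C.down z ∉ Ω.E) :
    C.phase S ρ J x z * (-1) ^ C.numZeroWinding S ρ J =
      ((T.sheet x.1 * T.sheet z.1 * matchSign m₂ T.twist S : ℝ) : ℂ) := by
  classical
  have hval : C.phase S ρ J x z =
      (((-1) ^ C.numNontrivial S ρ J * T.sheet x.1 * T.sheet z.1 : ℝ) : ℂ) := by
    refine phase_eq ⟨_, _, _, _, Trail.nil x, .inl hz.symm, rfl⟩ ?_
    rintro W ⟨L, m, y, ht, hyz, rfl⟩
    have hsp := T.samePoint_sign hyz
    rw [show (if C.SamePoint y z then (1 : ℂ) else -1) =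
      ((if C.SamePoint y z then (1 : ℝ) else -1 : ℝ) : ℂ) by split_ifs <;> simp, hsp]
    have hy : C.down y = C.down z := hyz.resolve_right fun h => hE h.1
    change windPhase m * _ * _ = _
    rcases ht.full_or_half (T := T) hC.even with ⟨p, -, hf⟩ | ⟨p, -, hf⟩
    · cases p with
      | succ p => exact absurd (hf.can 0 (by omega)).1 hx
      | zero =>
        have hr : (C.down y).2 = (C.down x).2 := by rw [hy, hz]
        change y.2 = x.2 at hr
        rw [hf.wind, hf.sheet, hr, Transport.sheetAt, if_pos hy]
        simp only [sub_self, windPhase_zero, Transport.windSign, Transport.liftSign,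
          Finset.range_zero, Finset.prod_empty]
        push_cast
        ring
    · cases p with
      | succ p => exact absurd (hf.can 0 (by omega)).1 hx
      | zero => exact absurd hf.mem hx
  have hp := congrArg (Complex.ofReal) (hC.loop_sign (ρ := ρ))
  have hpart : loopPart S ∅ ρ m₂ = S := by
    rw [loopPart]
    exact Finset.filter_true_of_mem fun h _ => Finset.disjoint_empty_right _
  rw [hpart] at hp
  rw [hval]
  push_cast at hp ⊢
  linear_combination T.sheet x.1 * T.sheet z.1 * hp

end

end DoubleCover

end Ising
end

/-! ### Observables as partition functions, and the resulting Pfaffian formula. -/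

noncomputable section

namespace Ising

namespace DoubleCover

variable {Ω : DiscreteDomain} (C : DoubleCover Ω)

/-! ### Sheets and arcs -/

/-- A lift of each vertex. -/
def base (v : Ω.V) : C.Vert := (exists_proj_eq (C := C) v.2).choose

lemma proj_base (v : Ω.V) : C.proj (C.base v) = v.1 := (exists_proj_eq (C := C) v.2).choose_spec

open Classical in
/-- The number of the sheet. -/
def sheet (w : C.Vert) : ℝ := if w = C.base ⟨C.proj w, C.proj_mem w⟩ then 1 else -1

variable {C}

lemma sheet_mul_self (w : C.Vert) : C.sheet w * C.sheet w = 1 := by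
  unfold sheet
  split_ifs <;> norm_num

lemma sheet_inj (w w' : C.Vert) (hp : C.proj w = C.proj w') (hs : C.sheet w = C.sheet w') :
    w = w' := by
  have hb : C.base ⟨C.proj w, C.proj_mem w⟩ = C.base ⟨C.proj w', C.proj_mem w'⟩ := by
    congr 1
    exact Subtype.ext hp
  obtain ⟨x, y, -, hxy⟩ := Set.ncard_eq_two.1 (C.two_sheets _ (C.proj_mem w'))
  have h1 : w ∈ ({x, y} : Set C.Vert) := hxy ▸ hp
  have h2 : w' ∈ ({x, y} : Set C.Vert) := by rw [← hxy]; rfl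
  have h3 : C.base ⟨C.proj w', C.proj_mem w'⟩ ∈ ({x, y} : Set C.Vert) := by
    rw [← hxy]
    exact C.proj_base _
  unfold sheet at hs
  rw [hb] at hs
  simp only [Set.mem_insert_iff, Set.mem_singleton_iff] at h1 h2 h3
  split_ifs at hs with h4 h5 h5
  · rw [h4, ← h5]
  · norm_num at hs
  · norm_num at hs
  · rcases h1 with h1 | h1 <;> rcases h2 with h2 | h2 <;> rcases h3 with h3 | h3 <;>
      rw [h3] at h4 h5 <;> first | exact absurd h1 h4 | exact absurd h2 h5 | rw [h1, h2]

lemma sheet_eq_neg {w w' : C.Vert} (hp : C.proj w = C.proj w') (hne : w ≠ w') :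
    C.sheet w = -C.sheet w' := by
  have h := sheet_mul_self w
  rw [← sheet_mul_self w'] at h
  exact (mul_self_eq_mul_self_iff.1 h).resolve_left fun e => hne (sheet_inj w w' hp e)

lemma sheet_mul_eq {w w' u u' : C.Vert} (hw : C.proj w = C.proj w') (hu : C.proj u = C.proj u')
    (h : w = w' ↔ u = u') : C.sheet u * C.sheet w = C.sheet u' * C.sheet w' := by
  by_cases e : w = w'
  · rw [e, h.1 e]
  · rw [sheet_eq_neg hw e, sheet_eq_neg hu (mt h.2 e)]
    ring

variable (C) in
open Classical in
/-- The change of the sheet along an edge. -/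
def edgeSign (h : HalfEdge) : ℝ :=
  if hv : h.1 ∈ Ω.V then C.sheet (C.nbr (C.base ⟨h.1, hv⟩) h.2) * C.sheet (C.base ⟨h.1, hv⟩) else 1

lemma edgeSign_mul_self (h : HalfEdge) : C.edgeSign h * C.edgeSign h = 1 := by
  unfold edgeSign
  split_ifs with hv
  · rw [mul_mul_mul_comm, sheet_mul_self, sheet_mul_self, one_mul]
  · norm_num

/-- The sign was defined from a chosen lift; crossing an edge is a bijection of two-point fibres, so
the other lift gives the same sign. -/
lemma edgeSign_eq {w : C.Vert} {d : Dir} (he : (C.proj w, d) ∈ Ω.E) :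
    C.edgeSign (C.proj w, d) = C.sheet (C.nbr w d) * C.sheet w := by
  have hb := C.proj_base ⟨C.proj w, C.proj_mem w⟩
  have he' : (C.proj (C.base ⟨C.proj w, C.proj_mem w⟩), d) ∈ Ω.E := by rwa [hb]
  rw [edgeSign, dif_pos (C.proj_mem w)]
  refine sheet_mul_eq hb ?_ ⟨fun e => by rw [e], fun e => ?_⟩
  · rw [C.proj_nbr _ _ he', C.proj_nbr _ _ he, hb]
  · have h := C.nbr_nbr _ _ he'
    rw [show C.nbr (C.base ⟨C.proj w, C.proj_mem w⟩) d = C.nbr w d from e, C.nbr_nbr _ _ he] at h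
    exact h.symm

lemma edgeSign_opp {h : HalfEdge} (hh : h ∈ Ω.E) : C.edgeSign (opp h) = C.edgeSign h := by
  obtain ⟨v, d⟩ := h
  obtain ⟨w, rfl⟩ := exists_proj_eq (C := C) (Ω.vertex_mem _ hh)
  have h1 := Ω.opp_mem _ hh
  rw [edgeSign_eq hh]
  have h2 : opp (C.proj w, d) = (C.proj (C.nbr w d), d + 2) := (down_nbr hh).symm
  rw [h2] at h1 ⊢
  rw [edgeSign_eq h1, C.nbr_nbr _ _ hh, mul_comm]

open Classical in
/-- A function on half-edges, given on the sources and targets of the arcs, and elsewhere. -/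
def arcCases {X : Type*} {n : ℕ} (c c' : Fin n → HalfEdge) (f f' : Fin n → X) (e : HalfEdge → X)
    (h : HalfEdge) : X :=
  if hs : ∃ s, h = c s then f hs.choose else if ht : ∃ s, h = c' s then f' ht.choose else e h

section ArcCases

variable {X : Type*} {n : ℕ} {c c' : Fin n → HalfEdge} (f f' : Fin n → X) (e : HalfEdge → X)

lemma arcCases_src (hc : Function.Injective c) (s : Fin n) : arcCases c c' f f' e (c s) = f s := by
  have h : ∃ s', c s = c s' := ⟨s, rfl⟩
  rw [arcCases, dif_pos h, ← hc h.choose_spec]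

lemma arcCases_tgt (hc' : Function.Injective c') (hd : ∀ s s', c' s ≠ c s') (s : Fin n) :
    arcCases c c' f f' e (c' s) = f' s := by
  have h : ∃ s', c' s = c' s' := ⟨s, rfl⟩
  rw [arcCases, dif_neg (fun ⟨s', hs⟩ => hd s s' hs), dif_pos h, ← hc' h.choose_spec]

lemma arcCases_of_ne {h : HalfEdge} (h1 : ∀ s, h ≠ c s) (h2 : ∀ s, h ≠ c' s) :
    arcCases c c' f f' e h = e h := by
  rw [arcCases, dif_neg (fun ⟨s, hs⟩ => h1 s hs), dif_neg (fun ⟨s, hs⟩ => h2 s hs)]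

end ArcCases

variable {n : ℕ} {a : Fin (2 * n + 1) → C.HEdge}

/-- The half-edge at the source of an arc. -/
def srcEdge (a : Fin (2 * n + 1) → C.HEdge) (s : Fin n) : HalfEdge := C.down (a (arcSrc s))

/-- The half-edge at the target of an arc. -/
def tgtEdge (a : Fin (2 * n + 1) → C.HEdge) (s : Fin n) : HalfEdge := C.down (a (arcTgt s))

namespace Arcs

variable (ν : C.Arcs a)

open Classical in
/-- The sign of the winding of an arc, compared to the directions of its ends. -/
def windSign (s : Fin n) : ℝ :=
  if (8 : ℤ) ∣ ν.wind s + (rank (a (arcSrc s)).2 - rank (a (arcTgt s)).2) - 2 then 1 else -1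

/-- The change of the sheet along an arc. -/
def liftSign (s : Fin n) : ℝ :=
  C.sheet (ν.lift s ⟨(a (arcSrc s)).1, rfl⟩).1 * C.sheet (a (arcSrc s)).1

lemma windSign_mul_self (s : Fin n) : ν.windSign s * ν.windSign s = 1 := by
  unfold windSign
  split_ifs <;> norm_num

lemma liftSign_mul_self (s : Fin n) : ν.liftSign s * ν.liftSign s = 1 := by
  rw [liftSign, mul_mul_mul_comm, sheet_mul_self, sheet_mul_self, one_mul]

lemma sheet_lift (s : Fin n) (u : {w // C.proj w = C.proj (a (arcSrc s)).1}) :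
    C.sheet (ν.lift s u).1 = ν.liftSign s * C.sheet u.1 := by
  have h : ν.liftSign s = C.sheet (ν.lift s u).1 * C.sheet u.1 := by
    refine sheet_mul_eq u.2.symm ?_ ⟨fun e => ?_, fun e => ?_⟩
    · rw [(ν.lift s _).2, (ν.lift s _).2]
    · rw [show (⟨(a (arcSrc s)).1, rfl⟩ : {w // C.proj w = C.proj (a (arcSrc s)).1}) = u from
        Subtype.ext e]
    · exact congrArg Subtype.val ((ν.lift s).injective (Subtype.ext e))
  rw [h]
  linear_combination -C.sheet (ν.lift s u).1 * sheet_mul_self u.1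

lemma rank_mod : ∀ d d' e : Dir, e = d' + 2 - d → ((4 : ℤ) ∣ (e.val : ℤ) + (rank d - rank d') - 2) := by
  decide

/-- The directions at its ends fix the winding of an arc modulo 2π. Hence the exponent is 2 or -2
modulo 8, and the phase with its factor i is a sign, just as for an edge. -/
lemma windPhase_windSign (s : Fin n) :
    Complex.I * windPhase (ν.wind s + (rank (a (arcSrc s)).2 - rank (a (arcTgt s)).2)) =
      (ν.windSign s : ℂ) := by
  have h1 := rank_mod (a (arcSrc s)).2 (a (arcTgt s)).2 (ν.wind s : Dir) (ν.wind_mod s)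
  have h2 : ((ν.wind s : Dir).val : ℤ) = ν.wind s % 4 := ZMod.val_intCast _
  rw [windSign]
  split_ifs with h
  · rw [windPhase_eq_of_dvd h, windPhase_two, mul_neg, Complex.I_mul_I]
    norm_num
  · rw [windPhase_eq_of_dvd (k := -2) (by omega), windPhase_neg_two, Complex.I_mul_I]
    norm_num

lemma windPhase_windSign_neg (s : Fin n) :
    Complex.I * windPhase (-ν.wind s + (rank (a (arcTgt s)).2 - rank (a (arcSrc s)).2)) =
      ((-ν.windSign s : ℝ) : ℂ) := by
  have h1 := ν.windPhase_windSign s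
  have h2 := windPhase_add (ν.wind s + (rank (a (arcSrc s)).2 - rank (a (arcTgt s)).2))
    (-ν.wind s + (rank (a (arcTgt s)).2 - rank (a (arcSrc s)).2))
  rw [show (ν.wind s + ((rank (a (arcSrc s)).2 : ℤ) - rank (a (arcTgt s)).2)) +
    (-ν.wind s + (rank (a (arcTgt s)).2 - rank (a (arcSrc s)).2)) = 0 by ring,
    windPhase_zero] at h2
  have h3 : (ν.windSign s : ℂ) * ν.windSign s = 1 := by exact_mod_cast ν.windSign_mul_self s
  push_cast
  set A := windPhase (ν.wind s + (rank (a (arcSrc s)).2 - rank (a (arcTgt s)).2))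
  set B := windPhase (-ν.wind s + (rank (a (arcTgt s)).2 - rank (a (arcSrc s)).2))
  linear_combination -Complex.I * B * h3 + Complex.I * B * ν.windSign s * (- h1) +
    ν.windSign s * Complex.I * Complex.I * (-h2) + ν.windSign s * Complex.I_mul_I

end Arcs

lemma srcEdge_injective (ha : Function.Injective fun k => C.down (a k)) :
    Function.Injective (srcEdge a) := by
  intro s s' h
  have := congrArg Fin.val (ha h)
  simp only [arcSrc] at this
  exact Fin.ext (by omega)

lemma tgtEdge_injective (ha : Function.Injective fun k => C.down (a k)) :
    Function.Injective (tgtEdge a) := by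
  intro s s' h
  have := congrArg Fin.val (ha h)
  simp only [arcTgt] at this
  exact Fin.ext (by omega)

lemma tgtEdge_ne_srcEdge (ha : Function.Injective fun k => C.down (a k)) (s s' : Fin n) :
    tgtEdge a s ≠ srcEdge a s' := by
  intro h
  have := congrArg Fin.val (ha h)
  simp only [arcSrc, arcTgt] at this
  omega

namespace Arcs

variable (ν : C.Arcs a)

/-- The half-edge that follows `h` along an edge or arc. -/
def next (_ : C.Arcs a) : HalfEdge → HalfEdge :=
  arcCases (srcEdge a) (tgtEdge a) (tgtEdge a) (srcEdge a) opp

/-- Trails can be continued from `h` along an edge or arc. -/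
def Cont (_ : C.Arcs a) (h : HalfEdge) : Prop :=
  h ∈ Ω.E ∨ (∃ s, h = srcEdge a s) ∨ ∃ s, h = tgtEdge a s

/-- The signs of the windings of edges and arcs. -/
def phaseSign : HalfEdge → ℝ :=
  arcCases (srcEdge a) (tgtEdge a) ν.windSign (fun s => -ν.windSign s) DiscreteDomain.edgeOrient

/-- The changes of the sheet along edges and arcs. -/
def sheetSign : HalfEdge → ℝ :=
  arcCases (srcEdge a) (tgtEdge a) ν.liftSign ν.liftSign C.edgeSign

lemma arcCases_edge {X : Type*} (f f' : Fin n → X) (e : HalfEdge → X)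
    (ha_bd : ∀ k, C.down (a k) ∈ Ω.boundary) {h : HalfEdge} (hh : h ∈ Ω.E) :
    arcCases (srcEdge a) (tgtEdge a) f f' e h = e h :=
  arcCases_of_ne f f' e
    (fun s e => (DiscreteDomain.mem_boundary.1 (ha_bd (arcSrc s))).2 (by rw [srcEdge] at e; rwa [← e]))
    (fun s e => (DiscreteDomain.mem_boundary.1 (ha_bd (arcTgt s))).2 (by rw [tgtEdge] at e; rwa [← e]))

/-- The transport along edges and arcs. -/
def transport (ha_bd : ∀ k, C.down (a k) ∈ Ω.boundary)
    (ha : Function.Injective fun k => C.down (a k)) : Transport C ν.Jump where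
  sheet := C.sheet
  sheet_mul_self := sheet_mul_self
  sheet_inj := sheet_inj
  next := ν.next
  Cont := ν.Cont
  phase := ν.phaseSign
  sign := ν.sheetSign
  cont_edge h hh := .inl hh
  next_edge h hh := arcCases_edge _ _ _ ha_bd hh
  phase_edge h hh := arcCases_edge _ _ _ ha_bd hh
  sign_edge w d hh := by
    rw [show ν.sheetSign (C.proj w, d) = _ from arcCases_edge _ _ _ ha_bd hh, edgeSign_eq hh]
    linear_combination -C.sheet (C.nbr w d) * sheet_mul_self w
  cont_jump := by
    rintro y k x ⟨s, u, ⟨rfl, rfl, rfl⟩ | ⟨rfl, rfl, rfl⟩⟩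
    · exact .inr (.inl ⟨s, by rw [srcEdge, down, down, u.2]⟩)
    · exact .inr (.inr ⟨s, by rw [tgtEdge, down, down, (ν.lift s u).2]⟩)
  next_jump := by
    rintro y k x ⟨s, u, ⟨rfl, rfl, rfl⟩ | ⟨rfl, rfl, rfl⟩⟩
    · rw [show C.down (u.1, (a (arcSrc s)).2) = srcEdge a s by rw [srcEdge, down, down, u.2],
        next, arcCases_src _ _ _ (srcEdge_injective ha), tgtEdge, down, down, (ν.lift s u).2]
    · rw [show C.down ((ν.lift s u).1, (a (arcTgt s)).2) = tgtEdge a s by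
          rw [tgtEdge, down, down, (ν.lift s u).2],
        next, arcCases_tgt _ _ _ (tgtEdge_injective ha) (tgtEdge_ne_srcEdge ha), srcEdge, down,
        down, u.2]
  phase_jump := by
    rintro y k x ⟨s, u, ⟨rfl, rfl, rfl⟩ | ⟨rfl, rfl, rfl⟩⟩
    · rw [show C.down (u.1, (a (arcSrc s)).2) = srcEdge a s by rw [srcEdge, down, down, u.2],
        phaseSign, arcCases_src _ _ _ (srcEdge_injective ha)]
      exact ν.windPhase_windSign s
    · rw [show C.down ((ν.lift s u).1, (a (arcTgt s)).2) = tgtEdge a s by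
          rw [tgtEdge, down, down, (ν.lift s u).2],
        phaseSign, arcCases_tgt _ _ _ (tgtEdge_injective ha) (tgtEdge_ne_srcEdge ha)]
      exact ν.windPhase_windSign_neg s
  sign_jump := by
    rintro y k x ⟨s, u, ⟨rfl, rfl, rfl⟩ | ⟨rfl, rfl, rfl⟩⟩
    · rw [show C.down (u.1, (a (arcSrc s)).2) = srcEdge a s by rw [srcEdge, down, down, u.2],
        sheetSign, arcCases_src _ _ _ (srcEdge_injective ha)]
      exact ν.sheet_lift s u
    · rw [show C.down ((ν.lift s u).1, (a (arcTgt s)).2) = tgtEdge a s by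
          rw [tgtEdge, down, down, (ν.lift s u).2],
        sheetSign, arcCases_tgt _ _ _ (tgtEdge_injective ha) (tgtEdge_ne_srcEdge ha)]
      dsimp only
      rw [ν.sheet_lift s u]
      linear_combination -C.sheet u.1 * ν.liftSign_mul_self s
  exists_jump := by
    rintro ⟨w, d⟩ (h | ⟨s, h⟩ | ⟨s, h⟩) hE
    · exact absurd h hE
    · have h1 : C.proj w = C.proj (a (arcSrc s)).1 := congrArg Prod.fst h
      have h2 : d = (a (arcSrc s)).2 := congrArg Prod.snd h
      exact ⟨_, _, s, ⟨w, h1⟩, .inl ⟨by rw [h2], rfl, rfl⟩⟩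
    · have h1 : C.proj w = C.proj (a (arcTgt s)).1 := congrArg Prod.fst h
      have h2 : d = (a (arcTgt s)).2 := congrArg Prod.snd h
      exact ⟨_, _, s, (ν.lift s).symm ⟨w, h1⟩, .inr ⟨by rw [h2, Equiv.apply_symm_apply], rfl, rfl⟩⟩
  phase_mul_self h := by
    unfold phaseSign arcCases
    split_ifs
    · exact ν.windSign_mul_self _
    · rw [neg_mul_neg]
      exact ν.windSign_mul_self _
    · exact DiscreteDomain.edgeOrient_mul_self h
  sign_mul_self h := by
    unfold sheetSign arcCases
    split_ifs
    · exact ν.liftSign_mul_self _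
    · exact ν.liftSign_mul_self _
    · exact edgeSign_mul_self h
  phase_next := by
    rintro h (hE | ⟨s, rfl⟩ | ⟨s, rfl⟩)
    · rw [next, arcCases_edge _ _ _ ha_bd hE, phaseSign, arcCases_edge _ _ _ ha_bd hE,
        arcCases_edge _ _ _ ha_bd (Ω.opp_mem _ hE), DiscreteDomain.edgeOrient_opp]
    · rw [next, arcCases_src _ _ _ (srcEdge_injective ha), phaseSign,
        arcCases_src _ _ _ (srcEdge_injective ha),
        arcCases_tgt _ _ _ (tgtEdge_injective ha) (tgtEdge_ne_srcEdge ha)]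
    · rw [next, arcCases_tgt _ _ _ (tgtEdge_injective ha) (tgtEdge_ne_srcEdge ha), phaseSign,
        arcCases_src _ _ _ (srcEdge_injective ha),
        arcCases_tgt _ _ _ (tgtEdge_injective ha) (tgtEdge_ne_srcEdge ha), neg_neg]
  sign_next := by
    rintro h (hE | ⟨s, rfl⟩ | ⟨s, rfl⟩)
    · rw [next, arcCases_edge _ _ _ ha_bd hE, sheetSign, arcCases_edge _ _ _ ha_bd hE,
        arcCases_edge _ _ _ ha_bd (Ω.opp_mem _ hE), edgeSign_opp hE]
    · rw [next, arcCases_src _ _ _ (srcEdge_injective ha), sheetSign,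
        arcCases_src _ _ _ (srcEdge_injective ha),
        arcCases_tgt _ _ _ (tgtEdge_injective ha) (tgtEdge_ne_srcEdge ha)]
    · rw [next, arcCases_tgt _ _ _ (tgtEdge_injective ha) (tgtEdge_ne_srcEdge ha), sheetSign,
        arcCases_src _ _ _ (srcEdge_injective ha),
        arcCases_tgt _ _ _ (tgtEdge_injective ha) (tgtEdge_ne_srcEdge ha)]
  next_next := by
    rintro h (hE | ⟨s, rfl⟩ | ⟨s, rfl⟩)
    · rw [next, arcCases_edge _ _ _ ha_bd hE, arcCases_edge _ _ _ ha_bd (Ω.opp_mem _ hE), opp_opp]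
    · rw [next, arcCases_src _ _ _ (srcEdge_injective ha),
        arcCases_tgt _ _ _ (tgtEdge_injective ha) (tgtEdge_ne_srcEdge ha)]
    · rw [next, arcCases_tgt _ _ _ (tgtEdge_injective ha) (tgtEdge_ne_srcEdge ha),
        arcCases_src _ _ _ (srcEdge_injective ha)]
  cont_next := by
    rintro h (hE | ⟨s, rfl⟩ | ⟨s, rfl⟩)
    · rw [next, arcCases_edge _ _ _ ha_bd hE]
      exact .inl (Ω.opp_mem _ hE)
    · rw [next, arcCases_src _ _ _ (srcEdge_injective ha)]
      exact .inr (.inr ⟨s, rfl⟩)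
    · rw [next, arcCases_tgt _ _ _ (tgtEdge_injective ha) (tgtEdge_ne_srcEdge ha)]
      exact .inr (.inl ⟨s, rfl⟩)

end Arcs

end DoubleCover

end Ising
end

noncomputable section

namespace Ising

namespace DoubleCover

variable {Ω : DiscreteDomain} {C : DoubleCover Ω}

/-! ### The phases of configurations as signs of lists -/

lemma evenDegrees_of_mem_confGen {S : Finset HalfEdge} (hS : S ∈ Ω.confGen) :
    EvenDegrees S ∧ ∀ h ∈ S, h.1 ∈ Ω.V := by
  rw [DiscreteDomain.mem_confGen] at hS
  have hV : ∀ h ∈ S, h.1 ∈ Ω.V := fun h hh => DiscreteDomain.mem_halfEdges.1 (hS.1 hh)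
  refine ⟨fun v => ?_, hV⟩
  by_cases hv : v ∈ Ω.V
  · exact hS.2 v hv
  · have : (S.filter fun h => h.1 = v) = ∅ :=
      Finset.filter_false_of_mem fun h hh e => hv (by rw [← e]; exact hV h hh)
    rw [this]
    exact ⟨0, rfl⟩

section

variable {J : C.HEdge → ℤ → C.HEdge → Prop} (T : Transport C J) {S : Finset HalfEdge}

/-- The continuation of trails, if the end `b` of the path is joined to its beginning `a`. -/
def Transport.closeNext (a b h : HalfEdge) : HalfEdge :=
  if h = a then b else if h = b then a else T.next h

variable {T}

/-- The phase changes sign along an edge or arc but is ±1, which excludes fixed points. -/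
lemma Transport.next_ne {h : HalfEdge} (hh : T.Cont h) : T.next h ≠ h := fun e => by
  have h1 := T.phase_next h hh
  have h2 := T.phase_mul_self h
  rw [e] at h1
  have h3 : T.phase h = 0 := by linarith
  rw [h3] at h2
  norm_num at h2

lemma closing_next (hS : S ∈ Ω.confGen) (hreg : ∀ h ∈ S, T.Cont h ∧ T.next h ∈ S) :
    Closing T S ∅ T.next where
  even := (evenDegrees_of_mem_confGen hS).1
  vertex_mem := (evenDegrees_of_mem_confGen hS).2
  paired := ⟨fun h hh => (hreg h hh).2, fun h hh => Transport.next_ne (hreg h hh).1,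
    fun h hh => T.next_next h (hreg h hh).1⟩
  mem_iff h hh := by simp
  regular h hh _ := ⟨rfl, (hreg h hh).1⟩
  special h hh := by simp at hh

/-- No other half-edge of `S` is led by `next` to `a` or `b`: `a` has no continuation, and the
continuation of `b`, if any, lies outside `S`. So the chord between `a` and `b` completes a perfect
matching. -/
lemma pathClosing_closeNext {a b : HalfEdge} (hS : S ∈ Ω.confGen) (ha : a ∈ S) (hb : b ∈ S)
    (hne : b ≠ a) (hca : ¬ T.Cont a) (hcb : T.Cont b → T.next b ∉ S)
    (hreg : ∀ h ∈ S, h ≠ a → h ≠ b → T.Cont h ∧ T.next h ∈ S) :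
    PathClosing T S (T.closeNext a b) a b := by
  have hma : T.closeNext a b a = b := if_pos rfl
  have hmb : T.closeNext a b b = a := by rw [Transport.closeNext, if_neg hne, if_pos rfl]
  have hmm : ∀ h, h ≠ a → h ≠ b → T.closeNext a b h = T.next h := fun h h1 h2 => by
    rw [Transport.closeNext, if_neg h1, if_neg h2]
  have hna : ∀ h, T.Cont h → T.next h ≠ a := fun h hh e => hca (e ▸ T.cont_next h hh)
  have hnb : ∀ h ∈ S, T.Cont h → T.next h ≠ b := fun h hh hc e => by
    have h1 := T.cont_next h hc
    have h2 := T.next_next h hc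
    rw [e] at h1 h2
    exact hcb h1 (by rwa [h2])
  refine ⟨⟨(evenDegrees_of_mem_confGen hS).1, (evenDegrees_of_mem_confGen hS).2, ?_, ?_, ?_, ?_⟩,
    ha, hma⟩
  · refine ⟨fun h hh => ?_, fun h hh => ?_, fun h hh => ?_⟩ <;> by_cases h1 : h = a
    · rwa [h1, hma]
    · by_cases h2 : h = b
      · rwa [h2, hmb]
      · rw [hmm h h1 h2]
        exact (hreg h hh h1 h2).2
    · rwa [h1, hma]
    · by_cases h2 : h = b
      · rw [h2, hmb]
        exact hne.symm
      · rw [hmm h h1 h2]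
        exact Transport.next_ne (hreg h hh h1 h2).1
    · rw [h1, hma, hmb]
    · by_cases h2 : h = b
      · rw [h2, hmb, hma]
      · have hc := (hreg h hh h1 h2).1
        rw [hmm h h1 h2, hmm _ (hna h hc) (hnb h hh hc), T.next_next h hc]
  · intro h hh
    by_cases h1 : h = a
    · simp [h1, hma]
    by_cases h2 : h = b
    · simp [h2, hmb]
    have hc := (hreg h hh h1 h2).1
    simp [hmm h h1 h2, h1, h2, hna h hc, hnb h hh hc]
  · intro h hh hn
    simp only [Finset.mem_insert, Finset.mem_singleton, not_or] at hn
    exact ⟨hmm h hn.1 hn.2, (hreg h hh hn.1 hn.2).1⟩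
  · intro h hh hc
    rcases Finset.mem_insert.1 hh with rfl | hh
    · exact absurd hc hca
    · rw [Finset.mem_singleton] at hh
      subst hh
      exact hcb hc

end

variable {n : ℕ} {a : Fin (2 * n + 1) → C.HEdge}

/-- The pairs of ends of the arcs in a list. -/
def arcPairs (a : Fin (2 * n + 1) → C.HEdge) (L : List (Fin n)) : List (HalfEdge × HalfEdge) :=
  L.map fun s => (srcEdge a s, tgtEdge a s)

/-- The numbering of the sources already lists the two ends of each arc consecutively, source before
target. -/
lemma ofFn_eq_arcPairs (a : Fin (2 * n + 1) → C.HEdge) : (List.ofFn fun k => C.down (a k)) =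
    C.down (a 0) :: flatPairs (arcPairs a (List.finRange n)) := by
  rw [List.ofFn_succ]
  congr 1
  rw [List.ofFn_mul', List.ofFn_eq_map, flatPairs, arcPairs, List.flatMap_map, List.flatMap_def]
  refine congrArg _ (List.map_congr_left fun s _ => ?_)
  rw [List.ofFn_succ, List.ofFn_succ, List.ofFn_zero]
  rfl

namespace Arcs

variable (ν : C.Arcs a) (ha_bd : ∀ k, C.down (a k) ∈ Ω.boundary)
  (ha : Function.Injective fun k => C.down (a k))

/-- The product of the signs of the arcs. -/
def arcSign : ℝ := ∏ s, ν.windSign s * ν.liftSign s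

lemma next_src (s : Fin n) : (ν.transport ha_bd ha).next (srcEdge a s) = tgtEdge a s :=
  arcCases_src _ _ _ (srcEdge_injective ha) s

lemma next_tgt (s : Fin n) : (ν.transport ha_bd ha).next (tgtEdge a s) = srcEdge a s :=
  arcCases_tgt _ _ _ (tgtEdge_injective ha) (tgtEdge_ne_srcEdge ha) s

lemma twist_src (s : Fin n) : (ν.transport ha_bd ha).twist (srcEdge a s) =
    ν.windSign s * ν.liftSign s := by
  have h1 : ν.phaseSign (srcEdge a s) = _ := arcCases_src _ _ _ (srcEdge_injective ha) s
  have h2 : ν.sheetSign (srcEdge a s) = _ := arcCases_src _ _ _ (srcEdge_injective ha) s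
  rw [Transport.twist, ← h1, ← h2]
  rfl

lemma twist_tgt (s : Fin n) : (ν.transport ha_bd ha).twist (tgtEdge a s) =
    -(ν.windSign s * ν.liftSign s) := by
  have h1 : ν.phaseSign (tgtEdge a s) = _ :=
    arcCases_tgt _ _ _ (tgtEdge_injective ha) (tgtEdge_ne_srcEdge ha) s
  have h2 : ν.sheetSign (tgtEdge a s) = _ :=
    arcCases_tgt _ _ _ (tgtEdge_injective ha) (tgtEdge_ne_srcEdge ha) s
  rw [Transport.twist, ← neg_mul, ← h1, ← h2]
  rfl

lemma twist_edge {h : HalfEdge} (hE : h ∈ Ω.E) (hp : Primary h) :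
    (ν.transport ha_bd ha).twist h = C.edgeSign h := by
  have h1 : ν.phaseSign h = _ := arcCases_edge _ _ _ ha_bd hE
  have h2 : ν.sheetSign h = _ := arcCases_edge _ _ _ ha_bd hE
  rw [DiscreteDomain.edgeOrient, if_pos hp] at h1
  rw [Transport.twist, ← h2, ← one_mul (ν.sheetSign h), ← h1]
  rfl

lemma prod_twist (L : List (Fin n)) (S : Finset HalfEdge) :
    ((arcPairs a L ++ Ω.edgePairs S).map fun p => (ν.transport ha_bd ha).twist p.1).prod =
      (L.map fun s => ν.windSign s * ν.liftSign s).prod * Ω.weight C.edgeSign S := by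
  rw [List.map_append, List.prod_append, arcPairs, List.map_map, DiscreteDomain.edgePairs,
    List.map_map, DiscreteDomain.weight, ← Finset.prod_map_toList]
  congr 2
  · exact List.map_congr_left fun s _ => ν.twist_src ha_bd ha s
  · refine List.map_congr_left fun h hh => ?_
    rw [Finset.mem_toList, DiscreteDomain.mem_edgeSet] at hh
    exact ν.twist_edge ha_bd ha hh.2.2.1 hh.2.1

lemma snd_eq_next (L : List (Fin n)) (S : Finset HalfEdge) :
    ∀ p ∈ arcPairs a L ++ Ω.edgePairs S, p.2 = (ν.transport ha_bd ha).next p.1 := by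
  intro p hp
  rcases List.mem_append.1 hp with hp | hp
  · obtain ⟨s, -, rfl⟩ := List.mem_map.1 hp
    exact (ν.next_src ha_bd ha s).symm
  · obtain ⟨h, hh, rfl⟩ := List.mem_map.1 hp
    rw [Finset.mem_toList, DiscreteDomain.mem_edgeSet] at hh
    exact ((ν.transport ha_bd ha).next_edge _ hh.2.2.1).symm

lemma matchSign_next {S : Finset HalfEdge}
    (hC : Closing (ν.transport ha_bd ha) S ∅ (ν.transport ha_bd ha).next) (L : List (Fin n))
    (hperm : (flatPairs (arcPairs a L ++ Ω.edgePairs S)).Perm S.toList) :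
    matchSign (ν.transport ha_bd ha).next (ν.transport ha_bd ha).twist S =
      listSign (flatPairs (arcPairs a L ++ Ω.edgePairs S)) *
        ((L.map fun s => ν.windSign s * ν.liftSign s).prod * Ω.weight C.edgeSign S) := by
  rw [← chordSign_eq_matchSign hC.paired ?_ (ν.snd_eq_next ha_bd ha L S) hperm, chordSign,
    prod_twist]
  intro h hh
  have hc := (hC.regular h hh (by simp)).2
  rw [Transport.twist, Transport.twist, Transport.phase_next _ _ hc, Transport.sign_next _ _ hc]
  ring

lemma matchSign_closeNext {S : Finset HalfEdge} {a₀ b : HalfEdge}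
    (hC : PathClosing (ν.transport ha_bd ha) S ((ν.transport ha_bd ha).closeNext a₀ b) a₀ b)
    (L : List (Fin n))
    (hperm : (flatPairs ((b, a₀) :: (arcPairs a L ++ Ω.edgePairs S))).Perm S.toList) :
    matchSign ((ν.transport ha_bd ha).closeNext a₀ b) ((ν.transport ha_bd ha).closedTwist a₀ b) S =
      listSign (flatPairs ((b, a₀) :: (arcPairs a L ++ Ω.edgePairs S))) *
        ((L.map fun s => ν.windSign s * ν.liftSign s).prod * Ω.weight C.edgeSign S) := by
  have hnd := hperm.nodup_iff.2 (Finset.nodup_toList S)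
  rw [flatPairs_cons, List.nodup_cons, List.nodup_cons, List.mem_cons, not_or] at hnd
  have hmem : ∀ p ∈ arcPairs a L ++ Ω.edgePairs S,
      p.1 ∈ flatPairs (arcPairs a L ++ Ω.edgePairs S) := fun p hp => by
    rw [flatPairs, List.mem_flatMap]
    exact ⟨p, hp, by simp⟩
  have hne : ∀ p ∈ arcPairs a L ++ Ω.edgePairs S, p.1 ≠ a₀ ∧ p.1 ≠ b := fun p hp =>
    ⟨fun e => hnd.2.1 (e ▸ hmem p hp), fun e => hnd.1.2 (e ▸ hmem p hp)⟩
  rw [← chordSign_eq_matchSign hC.paired (fun h hh => hC.closedTwist_eq hh) (P :=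
    (b, a₀) :: (arcPairs a L ++ Ω.edgePairs S)) ?_ hperm, chordSign, List.map_cons, List.prod_cons,
    ← ν.prod_twist ha_bd ha, show (ν.transport ha_bd ha).closedTwist a₀ b b = 1 from if_pos rfl,
    one_mul]
  · congr 2
    refine List.map_congr_left fun p hp => ?_
    rw [Transport.closedTwist, if_neg (hne p hp).2, if_neg (hne p hp).1]
  · intro p hp
    rcases List.mem_cons.1 hp with rfl | hp
    · exact hC.end_eq.symm
    · rw [Transport.closeNext, if_neg (hne p hp).1, if_neg (hne p hp).2]
      exact ν.snd_eq_next ha_bd ha L S p hp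

end Arcs

end DoubleCover

end Ising
end

noncomputable section

namespace Ising

namespace DoubleCover

variable {Ω : DiscreteDomain} {C : DoubleCover Ω} {n : ℕ} {a : Fin (2 * n + 1) → C.HEdge}

/-! ### The phases in terms of the sources -/

lemma eq_zero_or_arc (k : Fin (2 * n + 1)) : k = 0 ∨ ∃ s : Fin n, k = arcSrc s ∨ k = arcTgt s := by
  rcases Nat.eq_zero_or_pos k.val with h | h
  · exact .inl (Fin.ext h)
  · have := k.2
    rcases Nat.even_or_odd' k.val with ⟨m, hm | hm⟩
    · exact .inr ⟨⟨m - 1, by omega⟩, .inr (Fin.ext (by simp only [arcTgt]; omega))⟩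
    · exact .inr ⟨⟨m, by omega⟩, .inl (Fin.ext (by simp only [arcSrc]; omega))⟩

namespace Arcs

variable (ν : C.Arcs a) (ha_bd : ∀ k, C.down (a k) ∈ Ω.boundary)
  (ha : Function.Injective fun k => C.down (a k))

lemma arcSign_eq : ν.arcSign =
    ((List.finRange n).map fun s => ν.windSign s * ν.liftSign s).prod := by
  rw [← List.ofFn_eq_map, List.prod_ofFn, arcSign]

lemma not_cont_zero : ¬ (ν.transport ha_bd ha).Cont (C.down (a 0)) := by
  rintro (h | ⟨s, h⟩ | ⟨s, h⟩)
  · exact (DiscreteDomain.mem_boundary.1 (ha_bd 0)).2 h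
  · have := congrArg Fin.val (ha h)
    simp [arcSrc] at this
  · have := congrArg Fin.val (ha h)
    simp [arcTgt] at this

lemma mem_edge_of_cont {h : HalfEdge} (hh : ∀ k, h ≠ C.down (a k))
    (hc : (ν.transport ha_bd ha).Cont h) : h ∈ Ω.E := by
  rcases hc with h1 | ⟨s, h1⟩ | ⟨s, h1⟩
  · exact h1
  · exact absurd h1 (hh _)
  · exact absurd h1 (hh _)

/-- The partner of a marked half-edge. -/
lemma exists_partner {k : Fin (2 * n + 1)} (hk : k ≠ 0) : ∃ j : Fin (2 * n + 1), j ≠ 0 ∧ j ≠ k ∧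
    (ν.transport ha_bd ha).Cont (C.down (a k)) ∧
    (ν.transport ha_bd ha).next (C.down (a k)) = C.down (a j) := by
  obtain ⟨s, rfl | rfl⟩ := (eq_zero_or_arc k).resolve_left hk
  · refine ⟨arcTgt s, ?_, ?_, .inr (.inl ⟨s, rfl⟩), ν.next_src ha_bd ha s⟩ <;>
      simp [Fin.ext_iff, arcSrc, arcTgt]
  · refine ⟨arcSrc s, ?_, ?_, .inr (.inr ⟨s, rfl⟩), ν.next_tgt ha_bd ha s⟩ <;>
      simp [Fin.ext_iff, arcSrc, arcTgt]

lemma cont_of_notMem_ends {S : Finset HalfEdge} {h : HalfEdge} (hh : h ∈ S) (he : h ∉ Ω.ends S) :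
    h ∈ Ω.E ∧ opp h ∈ S := by
  rw [DiscreteDomain.mem_ends] at he
  by_contra hn
  exact he ⟨hh, hn⟩

lemma pathClosing_generic {S : Finset HalfEdge} (hS : S ∈ Ω.confGen) {b : HalfEdge}
    (hends : Ω.ends S = (b :: List.ofFn fun k => C.down (a k)).toFinset)
    (hb : ∀ k, b ≠ C.down (a k)) : PathClosing (ν.transport ha_bd ha) S
      ((ν.transport ha_bd ha).closeNext (C.down (a 0)) b) (C.down (a 0)) b := by
  have hmem : ∀ h, h ∈ Ω.ends S ↔ h = b ∨ ∃ k, C.down (a k) = h := fun h => by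
    rw [hends, List.mem_toFinset, List.mem_cons, List.mem_ofFn]
  have hbe := DiscreteDomain.mem_ends.1 ((hmem b).2 (.inl rfl))
  have hak : ∀ k, C.down (a k) ∈ S := fun k =>
    (DiscreteDomain.mem_ends.1 ((hmem _).2 (.inr ⟨k, rfl⟩))).1
  refine pathClosing_closeNext hS (hak 0) hbe.1 (hb 0) (ν.not_cont_zero ha_bd ha) (fun hc h => ?_)
    fun h hh h1 h2 => ?_
  · have hE := ν.mem_edge_of_cont ha_bd ha hb hc
    rw [(ν.transport ha_bd ha).next_edge _ hE] at h
    exact hbe.2 ⟨hE, h⟩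
  · by_cases he : h ∈ Ω.ends S
    · obtain ⟨k, rfl⟩ := ((hmem h).1 he).resolve_left h2
      obtain ⟨j, -, -, h3, h4⟩ := ν.exists_partner ha_bd ha (k := k) (fun e => h1 (by rw [e]))
      exact ⟨h3, by rw [h4]; exact hak j⟩
    · obtain ⟨h3, h4⟩ := cont_of_notMem_ends hh he
      exact ⟨.inl h3, by rwa [(ν.transport ha_bd ha).next_edge _ h3]⟩

/-- The signs of the loops and the path form the sign of one matching, whose chords do not involve
`ρ`. This is why the observable is independent of the decompositions. -/
theorem phase_generic {S : Finset HalfEdge} (hS : S ∈ Ω.confGen) (ρ : ℤ × ℤ → Bool) {b : HalfEdge}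
    (hends : Ω.ends S = (b :: List.ofFn fun k => C.down (a k)).toFinset)
    (hb : ∀ k, b ≠ C.down (a k)) {z : C.HEdge} (hbz : Ω.SamePoint b (C.down z)) :
    C.phase S ρ ν.Jump (a 0) z * (-1) ^ C.numZeroWinding S ρ ν.Jump =
      -Complex.I * windPhase ((rank b.2 : ℤ) - rank (a 0).2) *
        ((C.sheet (a 0).1 * (ν.transport ha_bd ha).sheetAt b z *
          (listSign ((b :: List.ofFn fun k => C.down (a k)) ++ Ω.edgeFlat S) *
            (ν.arcSign * Ω.weight C.edgeSign S)) : ℝ) : ℂ) := by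
  have hbe : b ∈ Ω.ends S := by
    rw [hends]
    simp
  have hbo : b ∈ Ω.E → opp b ∉ S := fun h1 h2 => (DiscreteDomain.mem_ends.1 hbe).2 ⟨h1, h2⟩
  have hcb := fun hc => ν.mem_edge_of_cont ha_bd ha hb hc
  have hC := ν.pathClosing_generic ha_bd ha hS hends hb
  -- With the closing chord first and the arcs next, the flattened chords are exactly the list in
  -- the definition of `partition`.
  have hflat : flatPairs ((b, C.down (a 0)) :: (arcPairs a (List.finRange n) ++ Ω.edgePairs S)) =
      (b :: List.ofFn fun k => C.down (a k)) ++ Ω.edgeFlat S := by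
    rw [flatPairs_cons, flatPairs_append, ofFn_eq_arcPairs]
    rfl
  have hnd : (b :: List.ofFn fun k => C.down (a k)).Nodup := by
    rw [List.nodup_cons, List.mem_ofFn]
    exact ⟨fun ⟨k, hk⟩ => hb k hk.symm, List.nodup_ofFn.2 ha⟩
  rw [hC.phase_end rfl hbz ?_ hcb, ν.matchSign_closeNext ha_bd ha hC (List.finRange n) (by
    rw [hflat]
    exact DiscreteDomain.perm_toList hnd hends), hflat, arcSign_eq]
  · rfl
  · intro g hg hgz
    by_contra hne
    have : b ∈ Ω.E ∧ g = opp b := by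
      rcases hbz with h1 | ⟨h1, h2⟩ <;> rcases hgz with h3 | ⟨h3, h4⟩
      · exact absurd (h3.trans h1.symm) hne
      · rw [h1]
        exact ⟨h3, h4⟩
      · rw [h2, opp_opp]
        exact ⟨Ω.opp_mem _ h1, h3⟩
      · exact absurd (h4.trans h2.symm) hne
    exact hbo this.1 (this.2 ▸ hg)

lemma prod_orient_ne_zero {h : HalfEdge} {M : List HalfEdge} (hM : h ∉ M) :
    (M.map (orient h)).prod ≠ 0 := by
  refine List.prod_ne_zero fun hz => ?_
  obtain ⟨g, hg, e⟩ := List.mem_map.1 hz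
  have := orient_mul_self (g := h) (h := g) (fun e => hM (e ▸ hg))
  rw [e] at this
  norm_num at this

lemma perm_ofFn_succAbove {m : ℕ} {t : Fin (m + 1) → HalfEdge} (ht : Function.Injective t)
    (l : Fin (m + 1)) : (t l :: List.ofFn (t ∘ l.succAbove)).Perm (List.ofFn t) := by
  refine (List.perm_ext_iff_of_nodup ?_ (List.nodup_ofFn.2 ht)).2 fun x => ?_
  · rw [List.nodup_cons, List.mem_ofFn]
    exact ⟨fun ⟨k, hk⟩ => Fin.succAbove_ne l k (ht hk),
      List.nodup_ofFn.2 (ht.comp Fin.succAbove_right_injective)⟩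
  · rw [List.mem_cons, List.mem_ofFn, List.mem_ofFn]
    constructor
    · rintro (rfl | ⟨k, rfl⟩)
      · exact ⟨l, rfl⟩
      · exact ⟨_, rfl⟩
    · rintro ⟨k, rfl⟩
      rcases Fin.eq_self_or_eq_succAbove l k with rfl | ⟨j, rfl⟩
      · exact .inl rfl
      · exact .inr ⟨j, rfl⟩

/-- At a marked point the source `a l` drops out of the configuration. For `l = 0` the path is
trivial; otherwise it reaches the partner of `a l` and uses the arc to arrive. -/
theorem phase_marked (ha_bd : ∀ k, C.down (a k) ∈ Ω.boundary)
    (ha : Function.Injective fun k => C.down (a k)) {S : Finset HalfEdge} (hS : S ∈ Ω.confGen) (ρ : ℤ × ℤ → Bool)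
    (l : Fin (2 * n + 1))
    (hends : Ω.ends S = (List.ofFn ((fun k => C.down (a k)) ∘ l.succAbove)).toFinset)
    {z : C.HEdge} (hz : C.down z = C.down (a l)) :
    C.phase S ρ ν.Jump (a 0) z * (-1) ^ C.numZeroWinding S ρ ν.Jump =
      windPhase ((rank z.2 : ℤ) - rank (a 0).2) *
        ((C.sheet (a 0).1 * C.sheet z.1 * ((-1) ^ (l : ℕ) *
          listSign (List.ofFn ((fun k => C.down (a k)) ∘ l.succAbove) ++ Ω.edgeFlat S) *
            (ν.arcSign * Ω.weight C.edgeSign S)) : ℝ) : ℂ) := by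
  set t : Fin (2 * n + 1) → HalfEdge := fun k => C.down (a k) with ht
  have hmem : ∀ h, h ∈ Ω.ends S ↔ ∃ k, k ≠ l ∧ t k = h := fun h => by
    rw [hends, List.mem_toFinset, List.mem_ofFn]
    constructor
    · rintro ⟨k, rfl⟩
      exact ⟨_, Fin.succAbove_ne l k, rfl⟩
    · rintro ⟨k, hk, rfl⟩
      obtain ⟨j, rfl⟩ := (Fin.eq_self_or_eq_succAbove l k).resolve_left hk
      exact ⟨j, rfl⟩
  have hak : ∀ k, k ≠ l → t k ∈ S := fun k hk =>
    (DiscreteDomain.mem_ends.1 ((hmem _).2 ⟨k, hk, rfl⟩)).1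
  have hE : ∀ k, t k ∉ Ω.E := fun k => (DiscreteDomain.mem_boundary.1 (ha_bd k)).2
  have hal : t l ∉ S := fun h => by
    obtain ⟨k, hk, e⟩ := (hmem _).1 (DiscreteDomain.mem_ends.2 ⟨h, fun h2 => hE l h2.1⟩)
    exact hk (ha e)
  have hnd : (List.ofFn (t ∘ l.succAbove)).Nodup :=
    List.nodup_ofFn.2 (ha.comp Fin.succAbove_right_injective)
  have hperm := DiscreteDomain.perm_toList hnd hends
  have hedge : ∀ h ∈ S, h ∉ Ω.ends S →
      (ν.transport ha_bd ha).Cont h ∧ (ν.transport ha_bd ha).next h ∈ S := fun h hh he => by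
    obtain ⟨h3, h4⟩ := cont_of_notMem_ends hh he
    exact ⟨.inl h3, by rwa [(ν.transport ha_bd ha).next_edge _ h3]⟩
  have hzr : (C.down z).2 = (C.down (a l)).2 := by rw [hz]
  change z.2 = (a l).2 at hzr
  by_cases hl : l = 0
  · subst hl
    have hflat : flatPairs (arcPairs a (List.finRange n) ++ Ω.edgePairs S) =
        List.ofFn (t ∘ Fin.succAbove 0) ++ Ω.edgeFlat S := by
      rw [flatPairs_append]
      refine congrArg (· ++ _) ?_
      have := ofFn_eq_arcPairs a
      rw [List.ofFn_succ, List.cons.injEq] at this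
      exact this.2.symm
    have hC := closing_next (T := ν.transport ha_bd ha) hS fun h hh => by
      by_cases he : h ∈ Ω.ends S
      · obtain ⟨k, hk, rfl⟩ := (hmem h).1 he
        obtain ⟨j, h1, -, h3, h4⟩ := ν.exists_partner ha_bd ha hk
        exact ⟨h3, by rw [h4]; exact hak j h1⟩
      · exact hedge h hh he
    rw [hC.phase_nil hal hz (by rw [hz]; exact hE 0), ν.matchSign_next ha_bd ha hC
      (List.finRange n) (by rwa [hflat]), hflat, ← arcSign_eq, hzr, sub_self,
      windPhase_zero]
    simp only [Fin.val_zero, pow_zero, one_mul]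
    rfl
  · obtain ⟨s, hs⟩ := (eq_zero_or_arc l).resolve_left hl
    -- The partner is the target or the source of the arc, and `ε` is 1 or -1 accordingly. It enters
    -- both the twist of the last arc and the reordering of the list, and therefore cancels.
    obtain ⟨j, ε, hj0, hjl, hnext, hcont, htw, hε, hsign⟩ : ∃ (j : Fin (2 * n + 1)) (ε : ℝ),
        j ≠ 0 ∧ j ≠ l ∧ (ν.transport ha_bd ha).next (t j) = t l ∧
        (ν.transport ha_bd ha).Cont (t j) ∧
        (ν.transport ha_bd ha).twist (t j) = -ε * (ν.windSign s * ν.liftSign s) ∧ ε * ε = 1 ∧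
        ∀ W, listSign (t l :: t j :: t 0 :: flatPairs W) =
          ε * listSign (t 0 :: flatPairs ((srcEdge a s, tgtEdge a s) :: W)) := by
      rcases hs with rfl | rfl
      · refine ⟨arcTgt s, 1, ?_, ?_, ν.next_tgt ha_bd ha s, .inr (.inr ⟨s, rfl⟩), ?_, by norm_num,
          fun W => ?_⟩
        · simp [Fin.ext_iff, arcTgt]
        · simp [Fin.ext_iff, arcSrc, arcTgt]
        · rw [neg_one_mul]
          exact ν.twist_tgt ha_bd ha s
        · rw [flatPairs_cons, one_mul]
          exact (listSign_move [] (t 0) [t (arcSrc s), t (arcTgt s)] (flatPairs W)).symm ▸ by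
            simp [ht]
      · refine ⟨arcSrc s, -1, ?_, ?_, ν.next_src ha_bd ha s, .inr (.inl ⟨s, rfl⟩), ?_, by norm_num,
          fun W => ?_⟩
        · simp [Fin.ext_iff, arcSrc]
        · simp [Fin.ext_iff, arcSrc, arcTgt]
        · rw [neg_neg, one_mul]
          exact ν.twist_src ha_bd ha s
        · rw [flatPairs_cons]
          have h1 := listSign_move [] (t 0) [t (arcSrc s), t (arcTgt s)] (flatPairs W)
          have h2 := listSign_swap [] (t (arcSrc s)) (t (arcTgt s)) (t 0 :: flatPairs W)
          simp only [List.nil_append, List.cons_append, List.length_cons, List.length_nil] at h1 h2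
          change _ = -1 * listSign (t 0 :: t (arcSrc s) :: t (arcTgt s) :: flatPairs W)
          rw [h1, h2]
          norm_num
    have hb0 : t j ≠ t 0 := fun e => hj0 (ha e)
    have hC := pathClosing_closeNext (T := ν.transport ha_bd ha) (a := t 0) (b := t j) hS
      (hak 0 (Ne.symm hl)) (hak j hjl) hb0 (ν.not_cont_zero ha_bd ha) (fun _ => by rwa [hnext])
      (fun h hh h1 h2 => by
        by_cases he : h ∈ Ω.ends S
        · obtain ⟨k, hk, rfl⟩ := (hmem h).1 he
          obtain ⟨i, -, -, h3, h4⟩ := ν.exists_partner ha_bd ha (k := k) (fun e => h1 (by rw [e]))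
          rw [h4]
          refine ⟨h3, hak i fun e => h2 ?_⟩
          have h5 := (ν.transport ha_bd ha).next_next _ h3
          have h6 := (ν.transport ha_bd ha).next_next _ hcont
          rw [h4, e] at h5
          rw [hnext] at h6
          exact h5.symm.trans h6
        · exact hedge h hh he)
    set L := (List.finRange n).erase s with hL
    set W := arcPairs a L ++ Ω.edgePairs S with hW
    have hpermL : (List.finRange n).Perm (s :: L) := List.perm_cons_erase (List.mem_finRange s)
    have hpermW : (arcPairs a (List.finRange n) ++ Ω.edgePairs S).Perm
        ((srcEdge a s, tgtEdge a s) :: W) := (hpermL.map _).append_right _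
    have hall : List.ofFn t ++ Ω.edgeFlat S =
        [t 0] ++ flatPairs (arcPairs a (List.finRange n) ++ Ω.edgePairs S) := by
      rw [flatPairs_append, ht, ofFn_eq_arcPairs]
      rfl
    -- The two lists become comparable after the missing source `t l` is put back in front; its
    -- nonzero comparisons with the rest are cancelled afterwards.
    have hlist : listSign (t l :: t j :: t 0 :: flatPairs W) = ε * ((-1) ^ (l : ℕ) *
        listSign (t l :: (List.ofFn (t ∘ l.succAbove) ++ Ω.edgeFlat S))) := by
      rw [hsign, ← listSign_ofFn_succAbove, hall]
      exact congrArg _ (listSign_append_flatPairs_perm [t 0] hpermW).symm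
    have hperm1 : (t j :: t 0 :: flatPairs W).Perm
        (List.ofFn (t ∘ l.succAbove) ++ Ω.edgeFlat S) := by
      refine (List.perm_cons (t l)).1 ?_
      have h1 : (t l :: (List.ofFn (t ∘ l.succAbove) ++ Ω.edgeFlat S)).Perm
          (List.ofFn t ++ Ω.edgeFlat S) := (perm_ofFn_succAbove ha l).append_right _
      refine List.Perm.trans ?_ h1.symm
      rw [hall]
      refine List.Perm.trans ?_ ((flatPairs_perm hpermW).append_left [t 0]).symm
      rw [flatPairs_cons]
      rcases hs with rfl | rfl
      · have : j = arcTgt s := by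
          have h1 := ν.next_src ha_bd ha s
          have h6 := (ν.transport ha_bd ha).next_next _ hcont
          rw [hnext] at h6
          exact ha (h6.symm.trans h1)
        subst this
        exact (List.perm_middle (a := t 0) (l₁ := [t (arcSrc s), t (arcTgt s)]))
      · have : j = arcSrc s := by
          have h1 := ν.next_tgt ha_bd ha s
          have h6 := (ν.transport ha_bd ha).next_next _ hcont
          rw [hnext] at h6
          exact ha (h6.symm.trans h1)
        subst this
        exact (List.Perm.swap _ _ _).trans
          (List.perm_middle (a := t 0) (l₁ := [t (arcSrc s), t (arcTgt s)]))
    have hnot : t l ∉ t j :: t 0 :: flatPairs W := fun h =>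
      hal (Finset.mem_toList.1 (hperm.subset (hperm1.subset h)))
    have hlist' : listSign (t j :: t 0 :: flatPairs W) = ε * ((-1) ^ (l : ℕ) *
        listSign (List.ofFn (t ∘ l.succAbove) ++ Ω.edgeFlat S)) := by
      rw [listSign, listSign.eq_2 (t l) (List.ofFn (t ∘ l.succAbove) ++ Ω.edgeFlat S),
        ← (hperm1.map _).prod_eq] at hlist
      refine mul_left_cancel₀ (prod_orient_ne_zero hnot) ?_
      rw [hlist]
      ring
    have hprod : ν.arcSign =
        ν.windSign s * ν.liftSign s * (L.map fun s => ν.windSign s * ν.liftSign s).prod := by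
      rw [arcSign_eq, (hpermL.map _).prod_eq, List.map_cons, List.prod_cons]
    have hm := ν.matchSign_closeNext ha_bd ha hC L (hperm1.trans hperm)
    rw [hC.phase_next rfl hcont (by rw [hnext, hz]) (by rw [hz]; exact hE l) (by rw [hz]; exact hal),
      hm, flatPairs_cons, hlist', htw, hprod]
    change -windPhase _ * ((C.sheet (a 0).1 * C.sheet z.1 * _ * _ : ℝ) : ℂ) = _
    rw [neg_mul, ← mul_neg, ← Complex.ofReal_neg]
    congr 2
    linear_combination C.sheet (a 0).1 * C.sheet z.1 * (ν.windSign s * ν.liftSign s) *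
      ((-1) ^ (l : ℕ) * listSign (List.ofFn (t ∘ l.succAbove) ++ Ω.edgeFlat S)) *
      ((L.map fun s => ν.windSign s * ν.liftSign s).prod * Ω.weight C.edgeSign S) * hε

end Arcs

end DoubleCover

end Ising
end

noncomputable section

namespace Ising

namespace DiscreteDomain

variable {Ω : DiscreteDomain}

/-! ### Configurations with prescribed ends -/

lemma length_flatPairs (P : List (HalfEdge × HalfEdge)) : (flatPairs P).length = 2 * P.length := by
  induction P with
  | nil => rfl
  | cons p P ih => rw [flatPairs_cons, List.length_cons, List.length_cons, ih, List.length_cons]; ring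

lemma size_eq {S : Finset HalfEdge} {t : List HalfEdge} (ht : t.Nodup)
    (hS : Ω.ends S = t.toFinset) : Ω.size S = t.length + (Ω.edgeSet S).card := by
  have h1 := (perm_toList ht hS).length_eq
  rw [List.length_append, edgeFlat, length_flatPairs, edgePairs, List.length_map,
    Finset.length_toList, Finset.length_toList] at h1
  have h2 : (Ω.ends S).card = t.length := by rw [hS, List.toFinset_card_of_nodup ht]
  have h3 : Ω.ends S ⊆ S := Finset.filter_subset _ _
  rw [size, Finset.card_sdiff_of_subset h3, h2, ← h1]
  omega

lemma sum_ends_eq_partition (x : ℝ) (τ : HalfEdge → ℝ) {t : List HalfEdge} (ht : t.Nodup)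
    {s : Finset (Finset HalfEdge)} (hs : ∀ S, S ∈ s ↔ S ∈ Ω.confGen ∧ Ω.ends S = t.toFinset) :
    ∑ S ∈ s, listSign (t ++ Ω.edgeFlat S) * Ω.weight τ S * x ^ Ω.size S =
      x ^ t.length * Ω.partition (fun h => x * τ h) t := by
  classical
  have : s = Ω.confGen.filter fun S => Ω.ends S = t.toFinset := by
    ext S
    rw [hs, Finset.mem_filter]
  rw [this, partition, Finset.mul_sum]
  refine Finset.sum_congr rfl fun S hS => ?_
  rw [size_eq ht (Finset.mem_filter.1 hS).2, weight, weight, Finset.prod_mul_distrib,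
    Finset.prod_const]
  ring

lemma partition_eq_zero (c : HalfEdge → ℝ) {h : HalfEdge} {t : List HalfEdge} (hh : h ∈ t) :
    Ω.partition c (h :: t) = 0 := by
  rw [partition]
  refine Finset.sum_eq_zero fun S _ => ?_
  have : (((t ++ Ω.edgeFlat S)).map (orient h)).prod = 0 := by
    refine List.prod_eq_zero ?_
    rw [List.mem_map]
    exact ⟨h, by simp [hh], orient_self h⟩
  rw [List.cons_append, listSign, this]
  ring

lemma partition_swap (c : HalfEdge → ℝ) (g h : HalfEdge) :
    Ω.partition c [g, h] = -Ω.partition c [h, g] := by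
  have : [g, h].toFinset = [h, g].toFinset := by
    ext x
    simp [or_comm]
  rw [partition, partition, this, ← Finset.sum_neg_distrib]
  refine Finset.sum_congr rfl fun S _ => ?_
  have := listSign_swap [] g h (Ω.edgeFlat S)
  simp only [List.nil_append, List.cons_append] at this ⊢
  rw [this]
  ring

lemma partition_ofFn_comp (c : HalfEdge → ℝ) {m : ℕ} (t : Fin m → HalfEdge)
    (σ : Equiv.Perm (Fin m)) : Ω.partition c (List.ofFn (t ∘ σ)) =
      ((Equiv.Perm.sign σ : ℤ) : ℝ) * Ω.partition c (List.ofFn t) := by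
  have : (List.ofFn (t ∘ σ)).toFinset = (List.ofFn t).toFinset := by
    ext x
    simp only [List.mem_toFinset, List.mem_ofFn]
    exact σ.surjective.exists (p := fun k => t k = x) |>.symm
  rw [partition, partition, this, Finset.mul_sum]
  refine Finset.sum_congr rfl fun S _ => ?_
  rw [listSign_ofFn_comp]
  ring

lemma mem_conf {es : List HalfEdge} {S : Finset HalfEdge} : S ∈ Ω.conf es ↔ S ∈ Ω.confGen ∧
    ∀ h ∈ Ω.halfEdges, ((∃ g ∈ Ω.ends S, Ω.SamePoint g h) ↔
      Odd (@List.countP HalfEdge (fun e => @decide (Ω.SamePoint e h) (Classical.propDecidable _))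
        es)) := by
  classical
  rw [conf, Finset.mem_filter]

lemma samePoint_boundary {g h : HalfEdge} (hg : g ∉ Ω.E) : Ω.SamePoint g h ↔ g = h := by
  refine ⟨fun e => e.resolve_right fun e => hg ?_, .inl⟩
  rw [e.2]
  exact Ω.opp_mem _ e.1

lemma samePoint_boundary' {g h : HalfEdge} (hh : h ∉ Ω.E) : Ω.SamePoint g h ↔ g = h :=
  ⟨fun e => e.resolve_right fun e => hh e.1, .inl⟩

lemma samePoint_symm {g h : HalfEdge} (e : Ω.SamePoint g h) : Ω.SamePoint h g := by
  rcases e with rfl | ⟨h1, rfl⟩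
  · exact .inl rfl
  · exact .inr ⟨Ω.opp_mem _ h1, (opp_opp h).symm⟩

lemma samePoint_trans {f g h : HalfEdge} (e : Ω.SamePoint f g) (e' : Ω.SamePoint g h) :
    Ω.SamePoint f h := by
  rcases e with rfl | ⟨h1, rfl⟩
  · exact e'
  rcases e' with rfl | ⟨h2, rfl⟩
  · exact .inr ⟨h1, rfl⟩
  · rw [opp_opp]
    exact .inl rfl

lemma eq_of_samePoint_ends {S : Finset HalfEdge} {g h : HalfEdge} (hg : g ∈ Ω.ends S)
    (hh : h ∈ Ω.ends S) (e : Ω.SamePoint g h) : g = h := by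
  rw [mem_ends] at hg hh
  exact e.resolve_right fun e => hh.2 ⟨e.1, e.2 ▸ hg.1⟩

section

variable {m : ℕ} {t : Fin m → HalfEdge}

/-- The sources are distinct boundary points, so a point occurs at most once among them; adding `D`
modulo 2 is an exclusive or. -/
lemma odd_countP_iff (htE : ∀ k, t k ∉ Ω.E) (ht : Function.Injective t) (D h : HalfEdge) :
    Odd (@List.countP HalfEdge (fun e => @decide (Ω.SamePoint e h) (Classical.propDecidable _))
      (List.ofFn t ++ [D])) ↔ ¬ ((∃ k, t k = h) ↔ Ω.SamePoint D h) := by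
  classical
  have h1 : (List.ofFn t).countP (fun e => decide (Ω.SamePoint e h)) = (List.ofFn t).count h := by
    rw [List.count]
    refine List.countP_congr fun e he => ?_
    obtain ⟨k, rfl⟩ := List.mem_ofFn.1 he
    simp [samePoint_boundary (htE k)]
  have h2 : (List.ofFn t).count h = if ∃ k, t k = h then 1 else 0 := by
    rw [List.Nodup.count (List.nodup_ofFn.2 ht)]
    simp only [List.mem_ofFn]
  have h3 : (List.ofFn t ++ [D]).countP (fun e => decide (Ω.SamePoint e h)) =
      (if ∃ k, t k = h then 1 else 0) + if Ω.SamePoint D h then 1 else 0 := by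
    rw [List.countP_append, h1, h2, List.countP_singleton]
    simp
  have h4 : ∀ A B : Prop, [Decidable A] → [Decidable B] →
      (Odd ((if A then 1 else 0) + if B then 1 else 0) ↔ ¬ (A ↔ B)) := by
    intro A B _ _
    by_cases hA : A <;> by_cases hB : B <;> simp [hA, hB]
  rw [← h4, ← h3]

/-- The half-edges with the same point as `D`. -/
def points (Ω : DiscreteDomain) (D : HalfEdge) : Finset HalfEdge :=
  if D ∈ Ω.E then {D, opp D} else {D}

lemma mem_points {D b : HalfEdge} : b ∈ Ω.points D ↔ Ω.SamePoint b D := by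
  unfold points SamePoint
  split_ifs with h <;> simp [h]

/-- For an interior edge the end at its midpoint may be either half, but not both; hence an
observable is a sum of partition functions over `points`. -/
theorem mem_conf_generic (htb : ∀ k, t k ∈ Ω.boundary) (ht : Function.Injective t) {D : HalfEdge}
    (hD : D ∈ Ω.halfEdges) (hDt : ∀ k, D ≠ t k) {S : Finset HalfEdge} :
    S ∈ Ω.conf (List.ofFn t ++ [D]) ↔ S ∈ Ω.confGen ∧
      ∃ b, Ω.SamePoint b D ∧ Ω.ends S = (b :: List.ofFn t).toFinset := by
  have htE : ∀ k, t k ∉ Ω.E := fun k => (mem_boundary.1 (htb k)).2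
  rw [mem_conf]
  refine and_congr_right fun hS => ?_
  simp only [odd_countP_iff htE ht]
  constructor
  · intro hc
    have hDD : ¬ ∃ k, t k = D := fun ⟨k, hk⟩ => hDt k hk.symm
    obtain ⟨b, hb, hbD⟩ := (hc D hD).2 fun e => hDD (e.2 (.inl rfl))
    refine ⟨b, hbD, ?_⟩
    ext g
    rw [List.mem_toFinset, List.mem_cons, List.mem_ofFn]
    constructor
    · intro hg
      have hgE : g ∈ Ω.halfEdges := (mem_confGen.1 hS).1 (mem_ends.1 hg).1
      by_cases hgt : ∃ k, t k = g
      · exact .inr hgt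
      · have h1 := (hc g hgE).1 ⟨g, hg, .inl rfl⟩
        have h2 : Ω.SamePoint D g := by_contra fun e => h1 (iff_of_false hgt e)
        exact .inl (eq_of_samePoint_ends hb hg (samePoint_trans hbD h2)).symm
    · rintro (rfl | ⟨k, rfl⟩)
      · exact hb
      · have h1 : ¬ Ω.SamePoint D (t k) := fun e => hDt k ((samePoint_boundary' (htE k)).1 e)
        obtain ⟨g, hg, e⟩ := (hc (t k) (mem_halfEdges.2 (mem_boundary.1 (htb k)).1)).2
          fun e => h1 (e.1 ⟨k, rfl⟩)
        rwa [← (samePoint_boundary' (htE k)).1 e]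
  · rintro ⟨b, hbD, he⟩ h -
    have h1 : (∃ k, t k = h) → ¬ Ω.SamePoint D h := by
      rintro ⟨k, rfl⟩ e
      exact hDt k ((samePoint_boundary' (htE k)).1 e)
    have h2 : (∃ g ∈ Ω.ends S, Ω.SamePoint g h) ↔ (∃ k, t k = h) ∨ Ω.SamePoint D h := by
      rw [he]
      simp only [List.mem_toFinset, List.mem_cons, List.mem_ofFn]
      constructor
      · rintro ⟨g, rfl | ⟨k, rfl⟩, e⟩
        · exact .inr (samePoint_trans (samePoint_symm hbD) e)
        · exact .inl ⟨k, (samePoint_boundary (htE k)).1 e⟩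
      · rintro (⟨k, rfl⟩ | e)
        · exact ⟨_, .inr ⟨k, rfl⟩, .inl rfl⟩
        · exact ⟨b, .inl rfl, samePoint_trans hbD e⟩
    rw [h2]
    tauto

theorem mem_conf_marked {t : Fin (m + 1) → HalfEdge} (htb : ∀ k, t k ∈ Ω.boundary)
    (ht : Function.Injective t) (l : Fin (m + 1)) {S : Finset HalfEdge} :
    S ∈ Ω.conf (List.ofFn t ++ [t l]) ↔ S ∈ Ω.confGen ∧
      Ω.ends S = (List.ofFn (t ∘ l.succAbove)).toFinset := by
  have htE : ∀ k, t k ∉ Ω.E := fun k => (mem_boundary.1 (htb k)).2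
  rw [mem_conf]
  refine and_congr_right fun hS => ?_
  simp only [odd_countP_iff htE ht, samePoint_boundary (htE l)]
  have hQ : ∀ h, ¬ ((∃ k, t k = h) ↔ t l = h) ↔ ∃ k, t (l.succAbove k) = h := by
    intro h
    constructor
    · intro hn
      by_cases h1 : t l = h
      · exact absurd ⟨fun _ => h1, fun _ => ⟨l, h1⟩⟩ hn
      · have h2 : ∃ k, t k = h := by tauto
        obtain ⟨k, rfl⟩ := h2
        rcases Fin.eq_self_or_eq_succAbove l k with rfl | ⟨j, rfl⟩
        · exact absurd rfl h1
        · exact ⟨j, rfl⟩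
    · rintro ⟨k, rfl⟩ e
      exact Fin.succAbove_ne l k (ht (e.1 ⟨_, rfl⟩)).symm
  simp only [hQ]
  constructor
  · intro hc
    ext g
    rw [List.mem_toFinset, List.mem_ofFn]
    constructor
    · intro hg
      exact (hc g ((mem_confGen.1 hS).1 (mem_ends.1 hg).1)).1 ⟨g, hg, .inl rfl⟩
    · rintro ⟨k, rfl⟩
      obtain ⟨g, hg, e⟩ := (hc (t (l.succAbove k)) (mem_halfEdges.2 (mem_boundary.1 (htb _)).1)).2
        ⟨k, rfl⟩
      rw [(samePoint_boundary' (htE _)).1 e] at hg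
      exact hg
  · intro he h _
    rw [he]
    simp only [List.mem_toFinset, List.mem_ofFn, Function.comp_apply]
    constructor
    · rintro ⟨g, ⟨k, rfl⟩, e⟩
      exact ⟨k, (samePoint_boundary (htE _)).1 e⟩
    · rintro ⟨k, rfl⟩
      exact ⟨_, ⟨k, rfl⟩, .inl rfl⟩

end

end DiscreteDomain

end Ising
end

noncomputable section

namespace Ising

namespace DoubleCover

variable {Ω : DiscreteDomain} {C : DoubleCover Ω}

/-! ### The observables as partition functions -/

variable (C) in
/-- The edge weights, with signs that describe the double cover. -/
def coverWeight (h : HalfEdge) : ℝ := xCrit * C.edgeSign h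

variable (C) in
/-- The sign of the sheet of `z`, transported to the half-edge `b` that names the same point. -/
def sheetOver (b : HalfEdge) (z : C.HEdge) : ℝ :=
  if b = C.down z then C.sheet z.1 else C.edgeSign b * C.sheet z.1

variable (C) in
/-- The partition functions with sources `u` and `z`, weighted by the phase at `z`. -/
def endSum (z : C.HEdge) (u : List HalfEdge) : ℂ :=
  ∑ b ∈ Ω.points (C.down z), windPhase (rank b.2) *
    ((C.sheetOver b z * Ω.partition C.coverWeight (b :: u) : ℝ) : ℂ)

lemma down_mem_halfEdges (z : C.HEdge) : C.down z ∈ Ω.halfEdges :=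
  DiscreteDomain.mem_halfEdges.2 (C.proj_mem z.1)

section

variable {n : ℕ} {a : Fin (2 * n + 1) → C.HEdge} (ν : C.Arcs a)
  (ha_bd : ∀ k, C.down (a k) ∈ Ω.boundary) (ha : Function.Injective fun k => C.down (a k))

lemma Arcs.sheetAt_eq {b : HalfEdge} {z : C.HEdge} (hb : Ω.SamePoint b (C.down z)) :
    (ν.transport ha_bd ha).sheetAt b z = C.sheetOver b z := by
  rw [Transport.sheetAt, sheetOver]
  split_ifs with h
  · rfl
  · obtain ⟨h1, h2⟩ := hb.resolve_left h
    have h3 : ν.sheetSign b = C.edgeSign b :=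
      arcCases_edge _ _ _ ha_bd (by rw [h2]; exact Ω.opp_mem _ h1)
    rw [← h3]
    rfl

/-- All factors that depend on the arcs and on `a 0` are common to the configurations, so as a
function of `z` only `endSum` remains. The explicit power of x counts the 2n + 2 end half-edges, as
`partition` weighs full edges only. -/
theorem Arcs.observable_generic (ha_bd : ∀ k, C.down (a k) ∈ Ω.boundary)
    (ha : Function.Injective fun k => C.down (a k)) (ρ : Finset HalfEdge → ℤ × ℤ → Bool) (η : ℂ)
    {z : C.HEdge} (hz : ∀ k, C.down z ≠ C.down (a k)) :
    ν.observable ρ η z = η * windPhase (-(rank (a 0).2 : ℤ)) *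
      ((C.sheet (a 0).1 * ν.arcSign * xCrit ^ (2 * n + 2) : ℝ) : ℂ) *
      C.endSum z (List.ofFn fun k => C.down (a k)) := by
  classical
  set t : Fin (2 * n + 1) → HalfEdge := fun k => C.down (a k) with ht
  have hbt : ∀ b ∈ Ω.points (C.down z), ∀ k, b ≠ t k := by
    rintro b hb k rfl
    rw [DiscreteDomain.mem_points,
      DiscreteDomain.samePoint_boundary (DiscreteDomain.mem_boundary.1 (ha_bd k)).2] at hb
    exact hz k hb.symm
  have hconf : Ω.conf (List.ofFn t ++ [C.down z]) = (Ω.points (C.down z)).biUnion fun b =>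
      Ω.confGen.filter fun S => Ω.ends S = (b :: List.ofFn t).toFinset := by
    ext S
    rw [DiscreteDomain.mem_conf_generic ha_bd ha (down_mem_halfEdges z) hz]
    simp only [Finset.mem_biUnion, Finset.mem_filter, DiscreteDomain.mem_points]
    tauto
  rw [Arcs.observable, hconf, Finset.sum_biUnion, endSum, Finset.mul_sum, Finset.mul_sum]
  · refine Finset.sum_congr rfl fun b hb => ?_
    have hnd : (b :: List.ofFn t).Nodup := by
      rw [List.nodup_cons, List.mem_ofFn]
      exact ⟨fun ⟨k, hk⟩ => hbt b hb k hk.symm, List.nodup_ofFn.2 ha⟩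
    have hsum := DiscreteDomain.sum_ends_eq_partition (Ω := Ω) xCrit C.edgeSign hnd
      (s := Ω.confGen.filter fun S => Ω.ends S = (b :: List.ofFn t).toFinset)
      fun S => Finset.mem_filter
    have hlen : (b :: List.ofFn t).length = 2 * n + 2 := by simp
    rw [hlen] at hsum
    have hterm : ∀ S ∈ Ω.confGen.filter fun S => Ω.ends S = (b :: List.ofFn t).toFinset,
        C.phase S (ρ S) ν.Jump (a 0) z * (-1) ^ C.numZeroWinding S (ρ S) ν.Jump *
          (xCrit : ℂ) ^ Ω.size S = -Complex.I * windPhase ((rank b.2 : ℤ) - rank (a 0).2) *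
          ((C.sheet (a 0).1 * C.sheetOver b z * ν.arcSign : ℝ) : ℂ) *
          ((listSign ((b :: List.ofFn t) ++ Ω.edgeFlat S) * Ω.weight C.edgeSign S *
            xCrit ^ Ω.size S : ℝ) : ℂ) := by
      intro S hS
      rw [Finset.mem_filter] at hS
      rw [ν.phase_generic ha_bd ha hS.1 (ρ S) hS.2 (hbt b hb) (DiscreteDomain.mem_points.1 hb),
        ν.sheetAt_eq ha_bd ha (DiscreteDomain.mem_points.1 hb)]
      push_cast
      ring
    rw [Finset.sum_congr rfl hterm, ← Finset.mul_sum, ← Complex.ofReal_sum, hsum, sub_eq_neg_add,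
      windPhase_add, show (fun h => xCrit * C.edgeSign h) = C.coverWeight from rfl]
    push_cast
    linear_combination -η * windPhase (-(rank (a 0).2 : ℤ)) * windPhase (rank b.2) *
      C.sheet (a 0).1 * C.sheetOver b z * ν.arcSign * xCrit ^ (2 * n + 2) *
      Ω.partition C.coverWeight (b :: List.ofFn t) * Complex.I_mul_I
  · intro b hb b' hb' hne
    rw [Function.onFun, Finset.disjoint_left]
    intro S h1 h2
    have h3 := (Finset.mem_filter.1 h1).2.symm.trans (Finset.mem_filter.1 h2).2
    have h4 : b ∈ (b' :: List.ofFn t).toFinset := by rw [← h3]; simp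
    rw [List.mem_toFinset, List.mem_cons, List.mem_ofFn] at h4
    rcases h4 with h4 | ⟨k, h4⟩
    · exact hne h4
    · exact hbt b hb k h4.symm

theorem Arcs.observable_marked (ha_bd : ∀ k, C.down (a k) ∈ Ω.boundary)
    (ha : Function.Injective fun k => C.down (a k)) (ρ : Finset HalfEdge → ℤ × ℤ → Bool) (η : ℂ)
    {z : C.HEdge} (l : Fin (2 * n + 1)) (hz : C.down z = C.down (a l)) :
    ν.observable ρ η z = Complex.I * η * windPhase ((rank z.2 : ℤ) - rank (a 0).2) *
      ((C.sheet (a 0).1 * C.sheet z.1 * ν.arcSign * (-1) ^ (l : ℕ) * xCrit ^ (2 * n) *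
        Ω.partition C.coverWeight (List.ofFn ((fun k => C.down (a k)) ∘ l.succAbove)) : ℝ) : ℂ) := by
  classical
  set t : Fin (2 * n + 1) → HalfEdge := fun k => C.down (a k) with ht
  have hnd : (List.ofFn (t ∘ l.succAbove)).Nodup :=
    List.nodup_ofFn.2 (ha.comp Fin.succAbove_right_injective)
  have hsum := DiscreteDomain.sum_ends_eq_partition (Ω := Ω) xCrit C.edgeSign hnd
    (s := Ω.conf (List.ofFn t ++ [t l])) fun S => DiscreteDomain.mem_conf_marked ha_bd ha l
  rw [List.length_ofFn] at hsum
  rw [Arcs.observable, hz]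
  have hterm : ∀ S ∈ Ω.conf (List.ofFn t ++ [t l]),
      C.phase S (ρ S) ν.Jump (a 0) z * (-1) ^ C.numZeroWinding S (ρ S) ν.Jump *
        (xCrit : ℂ) ^ Ω.size S = windPhase ((rank z.2 : ℤ) - rank (a 0).2) *
        ((C.sheet (a 0).1 * C.sheet z.1 * ν.arcSign * (-1) ^ (l : ℕ) : ℝ) : ℂ) *
        ((listSign (List.ofFn (t ∘ l.succAbove) ++ Ω.edgeFlat S) * Ω.weight C.edgeSign S *
          xCrit ^ Ω.size S : ℝ) : ℂ) := by
    intro S hS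
    rw [DiscreteDomain.mem_conf_marked ha_bd ha] at hS
    rw [ν.phase_marked ha_bd ha hS.1 (ρ S) l hS.2 hz]
    push_cast
    ring
  rw [show C.down (a l) = t l from rfl, Finset.sum_congr rfl hterm, ← Finset.mul_sum,
    ← Complex.ofReal_sum, hsum, show (fun h => xCrit * C.edgeSign h) = C.coverWeight from rfl]
  push_cast
  ring

end

/-! ### One source -/

variable (C) in
/-- The empty family of arcs. -/
def noArcs (a : C.HEdge) : C.Arcs (n := 0) fun _ => a where
  wind := Fin.elim0
  wind_mod s := s.elim0
  lift s := s.elim0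

lemma noArcs_jump (a : C.HEdge) : (C.noArcs a).Jump = fun _ _ _ => False := by
  funext x k y
  exact propext ⟨fun ⟨s, _⟩ => s.elim0, False.elim⟩

/-- A restatement of `listSign_even_subgraph` for matchings by interior edges; applied to single
loops it gives their winding. -/
lemma matchSign_opp_eq_one {K : Finset HalfEdge} {m : HalfEdge → HalfEdge} {B : HalfEdge → ℝ}
    (hp : PairedBy m K) (hm : ∀ h ∈ K, m h = opp h) (hB : ∀ h ∈ K, B h = DiscreteDomain.edgeOrient h)
    (hK : EvenDegrees K) : matchSign m B K = 1 := by
  have hE : ∀ h ∈ K, opp h ∈ K := fun h hh => by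
    rw [← hm h hh]
    exact hp.mem h hh
  rw [← chordSign_eq_matchSign hp (fun h hh => by
      rw [hB _ (hp.mem h hh), hB h hh, hm h hh, DiscreteDomain.edgeOrient_opp])
    (P := (K.filter fun h => Primary h).toList.map fun h => (h, opp h)), chordSign,
    listSign_even_subgraph hE hK, one_mul, List.prod_eq_one]
  · intro x hx
    rw [List.map_map, List.mem_map] at hx
    obtain ⟨h, hh, rfl⟩ := hx
    rw [Finset.mem_toList, Finset.mem_filter] at hh
    exact (hB h hh.1).trans (if_pos hh.2)
  · intro p hp
    obtain ⟨h, hh, rfl⟩ := List.mem_map.1 hp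
    rw [Finset.mem_toList, Finset.mem_filter] at hh
    exact (hm h hh.1).symm
  · refine (List.perm_ext_iff_of_nodup ?_ (Finset.nodup_toList _)).2 fun h => ?_
    · simp only [flatPairs, List.flatMap_map]
      rw [List.nodup_flatMap]
      refine ⟨fun h _ => by simp [(opp_ne_self h).symm], ?_⟩
      refine (Finset.nodup_toList _).pairwise_of_forall_ne fun g hg h hh hne => ?_
      rw [Finset.mem_toList, Finset.mem_filter] at hg hh
      have h1 := primary_opp g
      have h2 := primary_opp h
      simp only [Function.onFun, List.disjoint_cons_left, List.mem_cons, List.not_mem_nil, or_false,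
        not_or, List.disjoint_nil_left, and_true]
      refine ⟨⟨hne, ?_⟩, ?_, fun e => hne (opp_injective e)⟩
      · rintro rfl; tauto
      · rintro rfl; tauto
    · simp only [flatPairs, List.flatMap_map, List.mem_flatMap, Finset.mem_toList,
        Finset.mem_filter, List.mem_cons, List.not_mem_nil, or_false]
      constructor
      · rintro ⟨g, ⟨h1, -⟩, rfl | rfl⟩
        · exact h1
        · exact hE _ h1
      · intro hh
        by_cases hq : Primary h
        · exact ⟨h, ⟨hh, hq⟩, .inl rfl⟩
        · exact ⟨opp h, ⟨hE h hh, (primary_opp h).2 hq⟩, .inr (opp_opp h).symm⟩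

lemma evenDegrees_of_paired {S K : Finset HalfEdge} {ρ : ℤ × ℤ → Bool} (hS : EvenDegrees S)
    (hKS : K ⊆ S) (hK : PairedBy (joinOf S ρ) K) : EvenDegrees K := by
  intro v
  have hp : PairedBy (joinOf S ρ) (K.filter fun h => h.1 = v) :=
    hK.mono (Finset.filter_subset _ _) fun h hh => by
      rw [Finset.mem_filter] at hh ⊢
      obtain ⟨d, -, e⟩ := exists_joined (ρ := ρ) hS (hKS hh.1)
      exact ⟨hK.mem h hh.1, by rw [e]; exact hh.2⟩
  -- The product of -1 over a perfectly matched set is 1, which shows that its cardinality is even.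
  have h1 := prod_eq_one_of_paired hp (F := fun _ => -1) fun h _ => by norm_num
  rw [Finset.prod_const] at h1
  exact (neg_one_pow_eq_one_iff_even (by norm_num)).1 h1

section

variable {a : C.HEdge} (ha_bd : C.down a ∈ Ω.boundary)

lemma noArcs_injective (a : C.HEdge) :
    Function.Injective fun k : Fin (2 * 0 + 1) => C.down ((fun _ => a) k) :=
  fun i j _ => Fin.ext (by omega)

/-- A loop without arcs is an even subgraph of the lattice and has sign one, whereas winding zero
modulo 4π would give -1. So planar loops have winding 2π modulo 4π. -/
lemma numZeroWinding_noArcs {S P : Finset HalfEdge} {m₂ : HalfEdge → HalfEdge}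
    (hC : Closing ((C.noArcs a).transport (fun _ => ha_bd) (noArcs_injective a)) S P m₂)
    (ρ : ℤ × ℤ → Bool) : C.numZeroWinding S ρ (C.noArcs a).Jump = 0 := by
  have h1 := pairedBy_joinOf (ρ := ρ) hC.even
  rw [numZeroWinding, hC.numZeroWinding_set]
  convert Set.ncard_empty (Finset HalfEdge)
  refine Set.eq_empty_of_forall_notMem ?_
  rintro K ⟨hK, he⟩
  obtain ⟨h, hh, rfl⟩ := Finset.mem_image.1 hK
  rw [loopPart, Finset.mem_filter] at hh
  have hsub := loopSet_subset h1 hC.paired hh.1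
  have hE : ∀ g ∈ loopSet (joinOf S ρ) m₂ h, g ∈ Ω.E ∧ m₂ g = opp g := fun g hg => by
    obtain ⟨h2, h3⟩ := hC.regular g (hsub hg) (Finset.disjoint_left.1 hh.2 hg)
    have hgE : g ∈ Ω.E := by
      rcases h3 with h3 | ⟨s, -⟩ | ⟨s, -⟩
      · exact h3
      · exact s.elim0
      · exact s.elim0
    exact ⟨hgE, by rw [h2, Transport.next_edge _ _ hgE]⟩
  rw [matchSign_opp_eq_one (loopSet_paired_snd h1 hC.paired hh.1) (fun g hg => (hE g hg).2)
    (fun g hg => Transport.phase_edge _ _ (hE g hg).1)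
    (evenDegrees_of_paired hC.even hsub (loopSet_paired_fst h1 hC.paired hh.1))] at he
  norm_num at he

/-- The one-source observable is the multi-source observable without arcs. -/
theorem observable_eq_noArcs (ha_bd : C.down a ∈ Ω.boundary)
    (ρ : Finset HalfEdge → ℤ × ℤ → Bool) (η : ℂ) (z : C.HEdge) :
    C.observable ρ η a z = (C.noArcs a).observable ρ η z := by
  rw [DoubleCover.observable, Arcs.observable]
  have hlist : List.ofFn (fun k : Fin (2 * 0 + 1) => C.down ((fun _ => a) k)) ++ [C.down z] =
      [C.down a, C.down z] := by simp
  rw [hlist]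
  refine congrArg _ (Finset.sum_congr rfl fun S hS => ?_)
  have hzero : C.numZeroWinding S (ρ S) (C.noArcs a).Jump = 0 := by
    rw [← hlist] at hS
    by_cases hz : C.down z = C.down a
    · rw [hz, DiscreteDomain.mem_conf_marked (t := fun k : Fin (2 * 0 + 1) => C.down ((fun _ => a) k))
        (fun _ => ha_bd) (noArcs_injective a) 0] at hS
      refine numZeroWinding_noArcs ha_bd (closing_next hS.1 fun h hh => ?_) (ρ S)
      obtain ⟨h3, h4⟩ := Arcs.cont_of_notMem_ends (h := h) hh (by rw [hS.2]; simp)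
      exact ⟨.inl h3, by rwa [Transport.next_edge _ _ h3]⟩
    · rw [DiscreteDomain.mem_conf_generic (fun _ => ha_bd) (noArcs_injective a)
        (down_mem_halfEdges z) fun _ => hz] at hS
      obtain ⟨hS, b, hb, hends⟩ := hS
      refine numZeroWinding_noArcs ha_bd ((C.noArcs a).pathClosing_generic (fun _ => ha_bd)
        (noArcs_injective a) hS hends ?_).toClosing (ρ S)
      rintro - rfl
      exact hz ((DiscreteDomain.samePoint_boundary (DiscreteDomain.mem_boundary.1 ha_bd).2).1 hb).symm
  rw [hzero, pow_zero, mul_one, noArcs_jump]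

lemma arcSign_noArcs : (C.noArcs a).arcSign = 1 := rfl

theorem observable_generic (ha_bd : C.down a ∈ Ω.boundary) (ρ : Finset HalfEdge → ℤ × ℤ → Bool)
    (η : ℂ) {z : C.HEdge} (hz : C.down z ≠ C.down a) :
    C.observable ρ η a z = η * windPhase (-(rank a.2 : ℤ)) *
      ((C.sheet a.1 * xCrit ^ 2 : ℝ) : ℂ) * C.endSum z [C.down a] := by
  rw [observable_eq_noArcs ha_bd, (C.noArcs a).observable_generic (fun _ => ha_bd)
    (noArcs_injective a) ρ η fun _ => hz, arcSign_noArcs, mul_one]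
  rfl

theorem observable_marked (ha_bd : C.down a ∈ Ω.boundary) (ρ : Finset HalfEdge → ℤ × ℤ → Bool)
    (η : ℂ) {z : C.HEdge} (hz : C.down z = C.down a) :
    C.observable ρ η a z = Complex.I * η *
      ((C.sheet a.1 * C.sheet z.1 * Ω.partition C.coverWeight [] : ℝ) : ℂ) := by
  have hr : (C.down z).2 = (C.down a).2 := by rw [hz]
  change z.2 = a.2 at hr
  rw [observable_eq_noArcs ha_bd, (C.noArcs a).observable_marked (fun _ => ha_bd)
    (noArcs_injective a) ρ η 0 hz, arcSign_noArcs, hr, sub_self, windPhase_zero]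
  simp

end

end DoubleCover

end Ising
end

noncomputable section

namespace Ising

/-! ### Boundary partition functions as Pfaffians. -/

namespace DiscreteDomain

variable {Ω : DiscreteDomain}

/-- Partition functions with sources on the boundary are Pfaffians. -/
theorem pfaffian_partition {c : HalfEdge → ℝ} (hc : ∀ g ∈ Ω.E, c (opp g) = c g)
    (hc2 : ∀ g ∈ Ω.E, c g * c g = DoubleCover.xCrit * DoubleCover.xCrit)
    (hZ : Ω.partition c [] ≠ 0) {N : ℕ} {t : Fin N → HalfEdge} (htb : ∀ k, t k ∈ Ω.boundary)
    (ht : Function.Injective t) (κ : Fin N → ℝ) (x : ℝ) {m : ℕ} {u : Fin (2 * m) → Fin N}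
    (hu : Function.Injective u) :
    pfaffian (Matrix.of fun i j => κ (u i) * κ (u j) * x ^ 2 *
      Ω.partition c [t (u i), t (u j)] / Ω.partition c []) =
      (∏ i, κ (u i)) * x ^ (2 * m) * Ω.partition c (List.ofFn (t ∘ u)) / Ω.partition c [] := by
  -- The family is normalized by the partition function without sources and carries one factor κ and
  -- one factor x per source, so that two-point values are the matrix entries.
  refine pfaffian_of_expansion
    (P := fun m u => (∏ i, κ (u i)) * x ^ m * Ω.partition c (List.ofFn (t ∘ u)) / Ω.partition c [])
    (g := fun i j => κ i * κ j * x ^ 2 * Ω.partition c [t i, t j] / Ω.partition c [])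
    (fun u => ?_) (fun m u hu => ?_) (fun m u σ => ?_) m u hu
  · simp [div_self hZ]
  · have hexp := partition_cons_expansion hc hc2 (t := t ∘ u ∘ Fin.succ)
      (ht.comp (hu.comp (Fin.succ_injective _))) (fun l => htb _) (h := t (u 0))
      (mem_boundary.1 (htb _)).1
    have hlist : List.ofFn (t ∘ u) = t (u 0) :: List.ofFn (t ∘ u ∘ Fin.succ) := List.ofFn_succ
    rw [hlist, div_eq_iff hZ, ← mul_right_inj' hZ]
    rw [show Ω.partition c [] * ((∏ i, κ (u i)) * x ^ (m + 2) *
        Ω.partition c (t (u 0) :: List.ofFn (t ∘ u ∘ Fin.succ))) =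
      (∏ i, κ (u i)) * x ^ (m + 2) * (Ω.partition c (t (u 0) :: List.ofFn (t ∘ u ∘ Fin.succ)) *
        Ω.partition c []) by ring, hexp, Finset.mul_sum, Finset.sum_mul, Finset.mul_sum]
    refine Finset.sum_congr rfl fun k _ => ?_
    rw [Fin.prod_univ_succ, Fin.prod_univ_succAbove _ k,
      show (t ∘ fun i => u (k.succAbove i).succ) = (t ∘ u ∘ Fin.succ) ∘ k.succAbove from rfl]
    simp only [Function.comp_apply]
    field_simp
    ring
  · rw [show t ∘ u ∘ σ = (t ∘ u) ∘ σ from rfl, partition_ofFn_comp,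
      show ∏ i, κ ((u ∘ σ) i) = ∏ i, κ (u i) from Equiv.prod_comp σ fun i => κ (u i)]
    ring

end DiscreteDomain

namespace DoubleCover

variable {Ω : DiscreteDomain} {C : DoubleCover Ω}

/-! ### Signs -/

lemma xCrit_pos : 0 < xCrit := by
  rw [xCrit, sub_pos]
  exact Real.lt_sqrt_of_sq_lt (by norm_num)

lemma xCrit_lt_one : xCrit < 1 := by
  have : √2 < 2 := by
    rw [Real.sqrt_lt' (by norm_num)]
    norm_num
  rw [xCrit]
  linarith

lemma coverWeight_opp (g : HalfEdge) (hg : g ∈ Ω.E) : C.coverWeight (opp g) = C.coverWeight g := by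
  rw [coverWeight, coverWeight, edgeSign_opp hg]

lemma coverWeight_mul_self (g : HalfEdge) : C.coverWeight g * C.coverWeight g = xCrit * xCrit := by
  rw [coverWeight]
  linear_combination xCrit * xCrit * C.edgeSign_mul_self g

lemma partition_coverWeight_pos : 0 < Ω.partition C.coverWeight [] := by
  refine DiscreteDomain.partition_nil_pos fun g _ => abs_lt_of_sq_lt_sq' ?_ zero_le_one |> abs_lt.2
  rw [sq, coverWeight_mul_self]
  nlinarith [xCrit_pos, xCrit_lt_one]

/-- A uniform choice of the root (i a/|a|)^(-1/2) in terms of ranks. Any `η` differs from it by a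
sign `θ`, and the ranks cancel those in the phases. -/
lemma windPhase_rank_sq (d : Dir) : windPhase ((rank d : ℤ) - 1) ^ 2 =
    (Complex.I * Complex.I ^ d.val)⁻¹ := by
  rw [sq, ← windPhase_add]
  have h : ∀ d : Dir, ((rank d : ℤ) - 1 + (rank d - 1) = 2 ∧ d.val = 0) ∨
      ((rank d : ℤ) - 1 + (rank d - 1) = 4 ∧ d.val = 1) ∨
      ((rank d : ℤ) - 1 + (rank d - 1) = -2 ∧ d.val = 2) ∨
      ((rank d : ℤ) - 1 + (rank d - 1) = 0 ∧ d.val = 3) := by decide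
  rcases h d with ⟨h1, h2⟩ | ⟨h1, h2⟩ | ⟨h1, h2⟩ | ⟨h1, h2⟩ <;> rw [h1, h2]
  · rw [windPhase_two, pow_zero, mul_one, Complex.inv_I]
  · rw [windPhase_four, pow_one, Complex.I_mul_I]
    norm_num
  · rw [windPhase_neg_two, Complex.I_sq, mul_neg_one, inv_neg, Complex.inv_I, neg_neg]
  · rw [windPhase_zero, Complex.I_pow_three, mul_neg, Complex.I_mul_I]
    norm_num

lemma exists_root_sign {η : ℂ} {d : Dir} (h : η ^ 2 = (Complex.I * Complex.I ^ d.val)⁻¹) :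
    ∃ θ : ℝ, θ * θ = 1 ∧ η = θ * windPhase ((rank d : ℤ) - 1) := by
  rw [← windPhase_rank_sq, sq_eq_sq_iff_eq_or_eq_neg] at h
  rcases h with h | h
  · exact ⟨1, by norm_num, by simp [h]⟩
  · exact ⟨-1, by norm_num, by simp [h]⟩

/-- The coefficients in `partition_cons_expansion` do not involve the movable source, so the
expansion survives any linear combination over the halves of the edge of `z`. -/
lemma endSum_expansion (z : C.HEdge) {m : ℕ} {t : Fin (m + 1) → HalfEdge}
    (htb : ∀ k, t k ∈ Ω.boundary) (ht : Function.Injective t) :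
    C.endSum z (List.ofFn t) * (Ω.partition C.coverWeight [] : ℂ) =
      ∑ l : Fin (m + 1), (-1 : ℂ) ^ (l : ℕ) *
        (Ω.partition C.coverWeight (List.ofFn (t ∘ l.succAbove)) : ℂ) * C.endSum z [t l] := by
  simp only [endSum]
  rw [Finset.sum_mul]
  simp only [Finset.mul_sum]
  rw [Finset.sum_comm]
  refine Finset.sum_congr rfl fun b hb => ?_
  have hbV : b.1 ∈ Ω.V := by
    rcases DiscreteDomain.mem_points.1 hb with rfl | ⟨h1, rfl⟩
    · exact DiscreteDomain.mem_halfEdges.1 (down_mem_halfEdges z)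
    · exact Ω.vertex_mem _ (Ω.opp_mem _ h1)
  have h := congrArg (Complex.ofReal) (DiscreteDomain.partition_cons_expansion
    (c := C.coverWeight) coverWeight_opp (fun g _ => coverWeight_mul_self g) ht htb hbV)
  push_cast at h ⊢
  rw [show ∀ A B D E : ℂ, A * (B * D) * E = A * B * (D * E) by intros; ring, h, Finset.mul_sum]
  exact Finset.sum_congr rfl fun l _ => by ring

lemma endSum_boundary {z : C.HEdge} (hz : C.down z ∈ Ω.boundary) (u : List HalfEdge) :
    C.endSum z u = windPhase (rank z.2) *
      ((C.sheet z.1 * Ω.partition C.coverWeight (C.down z :: u) : ℝ) : ℂ) := by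
  rw [endSum, DiscreteDomain.points, if_neg (DiscreteDomain.mem_boundary.1 hz).2,
    Finset.sum_singleton, sheetOver, if_pos rfl]
  rfl

lemma prod_univ_arcs {n : ℕ} (κ : Fin (2 * n + 1) → ℝ) :
    ∏ k, κ k = κ 0 * ∏ s, κ (arcSrc s) * κ (arcTgt s) := by
  rw [Fin.prod_univ_succ, ← List.prod_ofFn (f := fun k : Fin (2 * n) => κ k.succ), List.ofFn_mul',
    List.prod_flatten, List.map_ofFn, List.prod_ofFn]
  refine congrArg _ (Finset.prod_congr rfl fun s _ => ?_)
  rw [Function.comp_apply, List.ofFn_succ, List.ofFn_succ, List.ofFn_zero, List.prod_cons,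
    List.prod_cons, List.prod_nil, mul_one]
  rfl

section

variable {n : ℕ} {a : Fin (2 * n + 1) → C.HEdge} (ν : C.Arcs a) {η : Fin (2 * n + 1) → ℂ}
  {θ : Fin (2 * n + 1) → ℝ}

open Classical in
lemma ite_eq_of_mul_self {p : Prop} {r : ℝ} (hr : r * r = 1) (hp : p ↔ r = 1) :
    (if p then (1 : ℝ) else -1) = r := by
  split_ifs with h
  · exact (hp.1 h).symm
  · exact ((mul_self_eq_one_iff.1 hr).resolve_left (mt hp.2 h)).symm

lemma Arcs.liftsToMarked_iff (s : Fin n) : ν.LiftsToMarked s ↔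
    ν.liftSign s * C.sheet (a (arcSrc s)).1 * C.sheet (a (arcTgt s)).1 = 1 := by
  have h := ν.sheet_lift s ⟨(a (arcSrc s)).1, rfl⟩
  have ht := sheet_mul_self (a (arcTgt s)).1
  rw [← h, LiftsToMarked]
  constructor
  · intro e
    rw [e, ht]
  · intro e
    refine sheet_inj _ _ (ν.lift s _).2 ?_
    linear_combination C.sheet (a (arcTgt s)).1 * e -
      C.sheet (ν.lift s ⟨(a (arcSrc s)).1, rfl⟩).1 * ht

/-- The prescribed equality holds up to a sign for every arc, and that sign is the product of the
sign of its winding and of its two roots. -/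
lemma Arcs.compatible_iff (hθ : ∀ k, θ k * θ k = 1)
    (hη : ∀ k, η k = θ k * windPhase ((rank (a k).2 : ℤ) - 1)) (s : Fin n) :
    ν.Compatible η s ↔ ν.windSign s * θ (arcSrc s) * θ (arcTgt s) = 1 := by
  have h1 := ν.windPhase_windSign s
  have hne : η (arcSrc s) ≠ 0 := by
    rw [hη]
    refine mul_ne_zero (fun e => ?_) (windPhase_ne_zero _)
    have := hθ (arcSrc s)
    rw [Complex.ofReal_eq_zero.1 e] at this
    norm_num at this
  have hs : (θ (arcSrc s) : ℂ) * θ (arcSrc s) = 1 := by exact_mod_cast hθ (arcSrc s)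
  have ht : (θ (arcTgt s) : ℂ) * θ (arcTgt s) = 1 := by exact_mod_cast hθ (arcTgt s)
  have h2 : Complex.I * η (arcSrc s) * windPhase (ν.wind s) =
      ν.windSign s * θ (arcSrc s) * θ (arcTgt s) * η (arcTgt s) := by
    rw [hη, hη, ← h1]
    have h3 : windPhase ((rank (a (arcSrc s)).2 : ℤ) - 1) * windPhase (ν.wind s) =
        windPhase (ν.wind s + (rank (a (arcSrc s)).2 - rank (a (arcTgt s)).2)) *
          windPhase ((rank (a (arcTgt s)).2 : ℤ) - 1) := by
      rw [← windPhase_add, ← windPhase_add]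
      congr 1
      ring
    linear_combination Complex.I * θ (arcSrc s) * h3 - Complex.I * θ (arcSrc s) *
      windPhase (ν.wind s + (rank (a (arcSrc s)).2 - rank (a (arcTgt s)).2)) *
          windPhase ((rank (a (arcTgt s)).2 : ℤ) - 1) * ht
  have hnt : η (arcTgt s) ≠ 0 := by
    rw [hη]
    refine mul_ne_zero (fun e => ?_) (windPhase_ne_zero _)
    have := hθ (arcTgt s)
    rw [Complex.ofReal_eq_zero.1 e] at this
    norm_num at this
  rw [Compatible, eq_div_iff (mul_ne_zero Complex.I_ne_zero hne)]
  change windPhase (ν.wind s) * _ = _ ↔ _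
  rw [mul_comm, h2, mul_eq_right₀ hnt]
  norm_cast

/-- Each arc contributes to ε its own winding and lift signs, together with the root and sheet signs
of its two ends; the latter square to one against the product over all the sources. -/
lemma Arcs.sign_mul_prod (hθ : ∀ k, θ k * θ k = 1)
    (hη : ∀ k, η k = θ k * windPhase ((rank (a k).2 : ℤ) - 1)) :
    ((ν.sign η : ℤ) : ℝ) * ∏ k, (θ k * C.sheet (a k).1) =
      θ 0 * C.sheet (a 0).1 * ν.arcSign := by
  have h1 : ((ν.sign η : ℤ) : ℝ) = ∏ s, (ν.liftSign s * C.sheet (a (arcSrc s)).1 *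
      C.sheet (a (arcTgt s)).1 * (ν.windSign s * θ (arcSrc s) * θ (arcTgt s))) := by
    rw [sign]
    push_cast
    refine Finset.prod_congr rfl fun s _ => ?_
    rw [ite_eq_of_mul_self _ (ν.liftsToMarked_iff s),
      ite_eq_of_mul_self _ (ν.compatible_iff hθ hη s)]
    · rw [mul_mul_mul_comm, mul_mul_mul_comm (ν.windSign s), ν.windSign_mul_self, hθ, hθ]
      norm_num
    · rw [mul_mul_mul_comm, mul_mul_mul_comm (ν.liftSign s), ν.liftSign_mul_self, sheet_mul_self,
        sheet_mul_self]
      norm_num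
  rw [h1, prod_univ_arcs, mul_left_comm, ← Finset.prod_mul_distrib, arcSign]
  refine congrArg _ (Finset.prod_congr rfl fun s _ => ?_)
  have h2 := hθ (arcSrc s)
  have h3 := hθ (arcTgt s)
  have h4 := sheet_mul_self (a (arcSrc s)).1
  have h5 := sheet_mul_self (a (arcTgt s)).1
  rw [show ν.liftSign s * C.sheet (a (arcSrc s)).1 * C.sheet (a (arcTgt s)).1 *
      (ν.windSign s * θ (arcSrc s) * θ (arcTgt s)) * (θ (arcSrc s) * C.sheet (a (arcSrc s)).1 *
      (θ (arcTgt s) * C.sheet (a (arcTgt s)).1)) = ν.windSign s * ν.liftSign s *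
      (θ (arcSrc s) * θ (arcSrc s)) * (θ (arcTgt s) * θ (arcTgt s)) *
      (C.sheet (a (arcSrc s)).1 * C.sheet (a (arcSrc s)).1) *
      (C.sheet (a (arcTgt s)).1 * C.sheet (a (arcTgt s)).1) by ring, h2, h3, h4, h5]
  ring

end

end DoubleCover

end Ising
end

noncomputable section

namespace Ising

namespace DoubleCover

variable {Ω : DiscreteDomain} {C : DoubleCover Ω} {n : ℕ} {a : Fin (2 * n + 1) → C.HEdge}

/-! ### The Pfaffian formula -/

section

variable {η : Fin (2 * n + 1) → ℂ} {θ : Fin (2 * n + 1) → ℝ}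

lemma root_mul_windPhase (hη : ∀ k, η k = θ k * windPhase ((rank (a k).2 : ℤ) - 1))
    (k : Fin (2 * n + 1)) (m : ℤ) :
    η k * windPhase (m - rank (a k).2) = θ k * windPhase (m - 1) := by
  rw [hη, mul_assoc, ← windPhase_add]
  congr 2
  ring

lemma observable_source_generic (ha_bd : ∀ k, C.down (a k) ∈ Ω.boundary)
    (hη : ∀ k, η k = θ k * windPhase ((rank (a k).2 : ℤ) - 1))
    (ρ : Finset HalfEdge → ℤ × ℤ → Bool) (k : Fin (2 * n + 1)) {z : C.HEdge}
    (hz : C.down z ≠ C.down (a k)) : C.observable ρ (η k) (a k) z =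
      windPhase (-1) * ((θ k * C.sheet (a k).1 * xCrit ^ 2 : ℝ) : ℂ) *
        C.endSum z [C.down (a k)] := by
  have h := root_mul_windPhase hη k 0
  rw [zero_sub, zero_sub] at h
  rw [observable_generic (ha_bd k) ρ (η k) hz, h]
  push_cast
  ring

lemma observable_source_marked (ha_bd : ∀ k, C.down (a k) ∈ Ω.boundary)
    (hη : ∀ k, η k = θ k * windPhase ((rank (a k).2 : ℤ) - 1))
    (ρ : Finset HalfEdge → ℤ × ℤ → Bool) (k : Fin (2 * n + 1)) {z : C.HEdge}
    (hz : C.down z = C.down (a k)) : C.observable ρ (η k) (a k) z =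
      Complex.I * windPhase ((rank z.2 : ℤ) - 1) *
        ((θ k * C.sheet (a k).1 * C.sheet z.1 * Ω.partition C.coverWeight [] : ℝ) : ℂ) := by
  have hr : (C.down z).2 = (C.down (a k)).2 := by rw [hz]
  change z.2 = (a k).2 at hr
  rw [observable_marked (ha_bd k) ρ (η k) hz, hη, hr]
  push_cast
  ring

lemma observable_source_ne_zero (ha_bd : ∀ k, C.down (a k) ∈ Ω.boundary)
    (hθ : ∀ k, θ k * θ k = 1) (hη : ∀ k, η k = θ k * windPhase ((rank (a k).2 : ℤ) - 1))
    (ρ : Finset HalfEdge → ℤ × ℤ → Bool) (k : Fin (2 * n + 1)) :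
    C.observable ρ (η k) (a k) (a k) ≠ 0 := by
  rw [observable_source_marked ha_bd hη ρ k rfl]
  refine mul_ne_zero (mul_ne_zero Complex.I_ne_zero (windPhase_ne_zero _)) ?_
  rw [Complex.ofReal_ne_zero, mul_assoc (θ k), sheet_mul_self, mul_one]
  refine mul_ne_zero (fun e => ?_) partition_coverWeight_pos.ne'
  have := hθ k
  rw [e] at this
  norm_num at this

/-- The direction-dependent phases of numerator and denominator agree, so the ratio is real; the two
factors i in the denominator give -1, undone by swapping the two sources. -/
lemma observable_div (ha_bd : ∀ k, C.down (a k) ∈ Ω.boundary)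
    (ha : Function.Injective fun k => C.down (a k)) (hθ : ∀ k, θ k * θ k = 1)
    (hη : ∀ k, η k = θ k * windPhase ((rank (a k).2 : ℤ) - 1))
    (ρ : Finset HalfEdge → ℤ × ℤ → Bool) {j k : Fin (2 * n + 1)} (hjk : j ≠ k) :
    C.observable ρ (η j) (a j) (a k) / (Complex.I * C.observable ρ (η k) (a k) (a k)) =
      ((θ j * C.sheet (a j).1 * (θ k * C.sheet (a k).1) * xCrit ^ 2 *
        Ω.partition C.coverWeight [C.down (a j), C.down (a k)] /
          Ω.partition C.coverWeight [] : ℝ) : ℂ) := by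
  have hZ : (Ω.partition C.coverWeight [] : ℂ) ≠ 0 :=
    Complex.ofReal_ne_zero.2 partition_coverWeight_pos.ne'
  have hk : (θ k : ℂ) * θ k = 1 := by exact_mod_cast hθ k
  rw [div_eq_iff (mul_ne_zero Complex.I_ne_zero (observable_source_ne_zero ha_bd hθ hη ρ k)),
    observable_source_marked ha_bd hη ρ k rfl,
    observable_source_generic ha_bd hη ρ j (fun e => hjk (ha e.symm)), endSum_boundary (ha_bd k),
    DiscreteDomain.partition_swap _ (C.down (a k)), sub_eq_neg_add, windPhase_add]
  push_cast
  field_simp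
  have hs : (C.sheet (a k).1 : ℂ) ^ 2 = 1 := by
    rw [sq]
    exact_mod_cast sheet_mul_self (a k).1
  linear_combination windPhase (-1) * θ j * C.sheet (a j).1 * xCrit ^ 2 * windPhase (rank (a k).2) *
    C.sheet (a k).1 * Ω.partition C.coverWeight [C.down (a j), C.down (a k)] *
    (hs + C.sheet (a k).1 ^ 2 * hk - C.sheet (a k).1 ^ 2 * θ k ^ 2 * Complex.I_sq)

lemma gMatrix_eq (ha_bd : ∀ k, C.down (a k) ∈ Ω.boundary)
    (ha : Function.Injective fun k => C.down (a k)) (hθ : ∀ k, θ k * θ k = 1)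
    (hη : ∀ k, η k = θ k * windPhase ((rank (a k).2 : ℤ) - 1))
    (ρ : Finset HalfEdge → ℤ × ℤ → Bool) : gMatrix a ρ η =
      Matrix.of fun j k => θ j * C.sheet (a j).1 * (θ k * C.sheet (a k).1) * xCrit ^ 2 *
        Ω.partition C.coverWeight [C.down (a j), C.down (a k)] /
          Ω.partition C.coverWeight [] := by
  ext j k
  rw [gMatrix, Matrix.of_apply, Matrix.of_apply]
  split_ifs with h
  · rw [h, DiscreteDomain.partition_eq_zero _ (List.mem_singleton_self _)]
    simp
  · rw [observable_div ha_bd ha hθ hη ρ h, Complex.ofReal_re]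

lemma pfaffian_gMatrix (ha_bd : ∀ k, C.down (a k) ∈ Ω.boundary)
    (ha : Function.Injective fun k => C.down (a k)) (hθ : ∀ k, θ k * θ k = 1)
    (hη : ∀ k, η k = θ k * windPhase ((rank (a k).2 : ℤ) - 1))
    (ρ : Finset HalfEdge → ℤ × ℤ → Bool) (k : Fin (2 * n + 1)) :
    pfaffian ((gMatrix a ρ η).submatrix k.succAbove k.succAbove) =
      (∏ i, (θ (k.succAbove i) * C.sheet (a (k.succAbove i)).1)) * xCrit ^ (2 * n) *
        Ω.partition C.coverWeight (List.ofFn ((fun k => C.down (a k)) ∘ k.succAbove)) /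
          Ω.partition C.coverWeight [] := by
  rw [gMatrix_eq ha_bd ha hθ hη ρ]
  exact DiscreteDomain.pfaffian_partition coverWeight_opp (fun g _ => coverWeight_mul_self g)
    partition_coverWeight_pos.ne' ha_bd ha (fun k => θ k * C.sheet (a k).1) xCrit
    Fin.succAbove_right_injective

theorem Arcs.observable_eq_pfaffian (ν : C.Arcs a) (ha_bd : ∀ k, C.down (a k) ∈ Ω.boundary)
    (ha : Function.Injective fun k => C.down (a k)) (hθ : ∀ k, θ k * θ k = 1)
    (hη : ∀ k, η k = θ k * windPhase ((rank (a k).2 : ℤ) - 1))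
    (ρ : Finset HalfEdge → ℤ × ℤ → Bool) (z : C.HEdge) :
    ν.observable ρ (η 0) z = (ν.sign η : ℂ) * ∑ k : Fin (2 * n + 1), (-1 : ℂ) ^ (k : ℕ) *
      (pfaffian ((gMatrix a ρ η).submatrix k.succAbove k.succAbove) : ℂ) *
        C.observable ρ (η k) (a k) z := by
  have hZ : (Ω.partition C.coverWeight [] : ℂ) ≠ 0 :=
    Complex.ofReal_ne_zero.2 partition_coverWeight_pos.ne'
  have hsign := congrArg (Complex.ofReal) (ν.sign_mul_prod hθ hη)
  simp only [pfaffian_gMatrix ha_bd ha hθ hη ρ]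
  set t : Fin (2 * n + 1) → HalfEdge := fun k => C.down (a k) with ht
  set K : ℝ := ∏ k, (θ k * C.sheet (a k).1) with hK
  have hKk : ∀ k : Fin (2 * n + 1), K = θ k * C.sheet (a k).1 *
      ∏ i, (θ (k.succAbove i) * C.sheet (a (k.succAbove i)).1) := fun k =>
    Fin.prod_univ_succAbove _ k
  push_cast at hsign
  -- Away from the marked points both sides are the expansion of one `endSum`. At a marked point the
  -- repeated source makes `endSum` vanish, so only the term `k = l`, given by a different formula,
  -- can contribute.
  by_cases hz : ∃ l, C.down z = t l
  · obtain ⟨l, hl⟩ := hz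
    have hzb : C.down z ∈ Ω.boundary := hl ▸ ha_bd l
    have hr0 := root_mul_windPhase hη 0 (rank z.2)
    have hexp := endSum_expansion z ha_bd ha
    -- The left side and the `l`-th term of the expansion repeat a source and are zero; what remains
    -- says that the terms with `k ≠ l` sum to zero.
    rw [endSum_boundary hzb, DiscreteDomain.partition_eq_zero _ (by rw [hl, List.mem_ofFn]; exact ⟨l, rfl⟩),
      mul_zero, Complex.ofReal_zero, mul_zero, zero_mul, Fin.sum_univ_succAbove _ l,
      endSum_boundary hzb, hl, DiscreteDomain.partition_eq_zero _ (List.mem_singleton_self _),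
      mul_zero, Complex.ofReal_zero, mul_zero, mul_zero, zero_add] at hexp
    have hrest : ∑ i, (-1 : ℂ) ^ (l.succAbove i : ℕ) *
        (((∏ j, (θ ((l.succAbove i).succAbove j) * C.sheet (a ((l.succAbove i).succAbove j)).1)) *
          xCrit ^ (2 * n) * Ω.partition C.coverWeight (List.ofFn (t ∘ (l.succAbove i).succAbove)) /
            Ω.partition C.coverWeight [] : ℝ) : ℂ) *
        C.observable ρ (η (l.succAbove i)) (a (l.succAbove i)) z =
        windPhase (-1) * K * xCrit ^ (2 * n + 2) / Ω.partition C.coverWeight [] *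
          ∑ i, (-1 : ℂ) ^ (l.succAbove i : ℕ) *
            (Ω.partition C.coverWeight (List.ofFn (t ∘ (l.succAbove i).succAbove)) : ℂ) *
              C.endSum z [t (l.succAbove i)] := by
      rw [Finset.mul_sum]
      refine Finset.sum_congr rfl fun i _ => ?_
      rw [observable_source_generic ha_bd hη ρ _ (by
        rw [hl]
        exact fun e => Fin.succAbove_ne l i (ha e).symm), hKk (l.succAbove i)]
      push_cast
      field_simp
      ring
    rw [Fin.sum_univ_succAbove _ l, hrest, ← hexp, mul_zero, add_zero,
      observable_source_marked ha_bd hη ρ l hl, ν.observable_marked ha_bd ha ρ (η 0) l hl,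
      mul_assoc Complex.I, hr0]
    rw [hKk l] at hsign
    push_cast at hsign ⊢
    field_simp
    linear_combination -(windPhase ((rank z.2 : ℤ) - 1) * C.sheet z.1 *
      xCrit ^ (2 * n) * Ω.partition C.coverWeight (List.ofFn (t ∘ l.succAbove))) * hsign
  · push Not at hz
    have hr0 := root_mul_windPhase hη 0 0
    rw [zero_sub, zero_sub] at hr0
    have hexp := endSum_expansion z ha_bd ha
    have hsum : ∑ k : Fin (2 * n + 1), (-1 : ℂ) ^ (k : ℕ) *
        (((∏ j, (θ (k.succAbove j) * C.sheet (a (k.succAbove j)).1)) *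
          xCrit ^ (2 * n) * Ω.partition C.coverWeight (List.ofFn (t ∘ k.succAbove)) /
            Ω.partition C.coverWeight [] : ℝ) : ℂ) * C.observable ρ (η k) (a k) z =
        windPhase (-1) * K * xCrit ^ (2 * n + 2) / Ω.partition C.coverWeight [] *
          ∑ k : Fin (2 * n + 1), (-1 : ℂ) ^ (k : ℕ) *
            (Ω.partition C.coverWeight (List.ofFn (t ∘ k.succAbove)) : ℂ) *
              C.endSum z [t k] := by
      rw [Finset.mul_sum]
      refine Finset.sum_congr rfl fun k _ => ?_
      rw [observable_source_generic ha_bd hη ρ k (hz k), hKk k]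
      push_cast
      field_simp
      ring
    rw [hsum, ← hexp, ν.observable_generic ha_bd ha ρ (η 0) hz, hr0]
    push_cast at hsign ⊢
    field_simp
    linear_combination -(windPhase (-1) * xCrit ^ (2 * n + 2) *
      C.endSum z (List.ofFn t)) * hsign

end

end DoubleCover

end Ising
end
-- The proposition.
theorem mainTheorem8 (Ω : Ising.DiscreteDomain) (C : Ising.DoubleCover Ω) (n : ℕ)
    (a : Fin (2 * n + 1) → C.HEdge)
    (ha_bd : ∀ k, C.down (a k) ∈ Ω.boundary)
    (ha_inj : Function.Injective fun k => C.down (a k))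
    (η : Fin (2 * n + 1) → ℂ)
    (hη : ∀ k, η k ^ 2 = (Complex.I * Complex.I ^ (a k).2.val)⁻¹)
    (ν : C.Arcs a)
    (ρ : Finset Ising.HalfEdge → ℤ × ℤ → Bool) :
    (∀ k, C.observable ρ (η k) (a k) (a k) ≠ 0) ∧
    (∀ j k, j ≠ k → (Ising.DoubleCover.gMatrix a ρ η j k : ℂ) =
      C.observable ρ (η j) (a j) (a k) /
        (Complex.I * C.observable ρ (η k) (a k) (a k))) ∧
    (Ising.DoubleCover.gMatrix a ρ η).transpose = -Ising.DoubleCover.gMatrix a ρ η ∧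
    (∀ z : C.HEdge, ν.observable ρ (η 0) z =
      (ν.sign η : ℂ) * ∑ k : Fin (2 * n + 1), (-1 : ℂ) ^ (k : ℕ) *
        (Ising.pfaffian
          ((Ising.DoubleCover.gMatrix a ρ η).submatrix k.succAbove k.succAbove) : ℂ) *
        C.observable ρ (η k) (a k) z) ∧
    ((∀ s, ν.LiftsToMarked s ∧ ν.Compatible η s) →
      ∀ z : C.HEdge, ν.observable ρ (η 0) z =
        ∑ k : Fin (2 * n + 1), (-1 : ℂ) ^ (k : ℕ) *
          (Ising.pfaffian
            ((Ising.DoubleCover.gMatrix a ρ η).submatrix k.succAbove k.succAbove) : ℂ) *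
          C.observable ρ (η k) (a k) z) := by
  -- The free choice of each square root is reduced to a real sign relative to the reference root.
  choose θ hθ hηθ using fun k => Ising.DoubleCover.exists_root_sign (hη k)
  have hmain := ν.observable_eq_pfaffian ha_bd ha_inj hθ hηθ ρ
  refine ⟨fun k => Ising.DoubleCover.observable_source_ne_zero ha_bd hθ hηθ ρ k, fun j k hjk => ?_,
    ?_, hmain, fun hν z => ?_⟩
  · rw [Ising.DoubleCover.gMatrix_eq ha_bd ha_inj hθ hηθ ρ,
      Ising.DoubleCover.observable_div ha_bd ha_inj hθ hηθ ρ hjk]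
    rfl
  · rw [Ising.DoubleCover.gMatrix_eq ha_bd ha_inj hθ hηθ ρ]
    ext j k
    rw [Matrix.transpose_apply, Matrix.neg_apply, Matrix.of_apply, Matrix.of_apply,
      Ising.DiscreteDomain.partition_swap]
    ring
  · have hsign : ν.sign η = 1 := by
      rw [Ising.DoubleCover.Arcs.sign]
      exact Finset.prod_eq_one fun s _ => by rw [if_pos (hν s).1, if_pos (hν s).2, one_mul]
    rw [hmain, hsign, Int.cast_one, one_mul]
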